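/- **Theorem 6.2.** Let $n\ge 2$, let $F_n$ be a free group of rank $n$, and let $H_{\mathbb Z}=F_n^{\mathrm{abel}}=F_n/[F_n,F_n]\cong\mathbb Z^n$, written additively. Let $H_{\mathbb Z}^*=\mathrm{Hom}(H_{\mathbb Z},\mathbb Z)$. Let $\mathrm{Out}(F_n)=\mathrm{Aut}(F_n)/\mathrm{Inn}(F_n)$, let $IO_n$ be the kernel of the homomorphism $\mathrm{Out}(F_n)\to GL(H_{\mathbb Z})$ induced by abelianization, and let $IO_n^{\mathrm{abel}}=IO_n/[IO_n,IO_n]$. This homomorphism is surjective, so $GL(H_{\mathbb Z})=\mathrm{Out}(F_n)/IO_n$ acts on $IO_n^{\mathrm{abel}}$ by conjugation. Let $GL(H_{\mathbb Z})$ act on $H_{\mathbb Z}^*\otimes\Lambda^2H_{\mathbb Z}=\mathrm{Hom}(H_{\mathbb Z},\Lambda^2H_{\mathbb Z})$ by $A\cdot u=\Lambda^2A\circ u\circ A^{-1}$. Let $$\iota_*:H_{\mathbb Z}\to H_{\mathbb Z}^*\otimes\Lambda^2H_{\mathbb Z},\qquad \iota_*(Y)(Z)=YZ-ZY\quad(Y,Z\in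 H_{\mathbb Z}),$$ where $YZ-ZY=Y\otimes Z-Z\otimes Y$ stands for $Y\wedge Z\in\Lambda^2H_{\mathbb Z}$ under the embedding $\Lambda^2H_{\mathbb Z}\subset H_{\mathbb Z}^{\otimes2}$, $Y\wedge Z\mapsto Y\otimes Z-Z\otimes Y$. The map $\iota_*$ is $GL(H_{\mathbb Z})$-equivariant, so $GL(H_{\mathbb Z})$ also acts on the quotient $(H_{\mathbb Z}^*\otimes\Lambda^2H_{\mathbb Z})/\iota_*(H_{\mathbb Z})$. Then there is a $GL(H_{\mathbb Z})$-equivariant isomorphism of abelian groups $$IO_n^{\mathrm{abel}}\;\cong\;(H_{\mathbb Z}^*\otimes\Lambda^2H_{\mathbb Z})/\iota_*(H_{\mathbb Z}).$$ In particular, $IO_n^{\mathrm{abel}}$ is a free abelian group of (finite) rank $(n+1)n(n-2)/2$. -/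

import Mathlib

open scoped TensorProduct

noncomputable section

namespace OutFree

/-- `H_ℤ`, the abelianization of the free group `F_n` on `n` letters, written additively. -/
abbrev HZ (n : ℕ) : Type := Additive (Abelianization (FreeGroup (Fin n)))

/-- The class `[γ] ∈ H_ℤ` of `γ ∈ F_n`. -/
def cls {n : ℕ} (γ : FreeGroup (Fin n)) : HZ n := Additive.ofMul (Abelianization.of γ)

/-- The basis `X_i = [x_i]` of `H_ℤ`. -/
def basisHZ (n : ℕ) : Module.Basis (Fin n) ℤ (HZ n) := FreeAbelianGroup.basis (Fin n)

theorem basisHZ_apply (n : ℕ) (i : Fin n) : basisHZ n i = cls (FreeGroup.of i) := by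
  have h : (FreeAbelianGroup.basis (Fin n)) i = FreeAbelianGroup.of i := by
    simp [FreeAbelianGroup.basis]
  exact h

instance (n : ℕ) : Module.Free ℤ (HZ n) := Module.Free.of_basis (basisHZ n)

instance (n : ℕ) : Module.Finite ℤ (HZ n) := Module.Finite.of_basis (basisHZ n)

/-- `GL(H_ℤ)`, the group of `ℤ`-linear automorphisms of `H_ℤ`. -/
abbrev GLHZ (n : ℕ) : Type := HZ n ≃ₗ[ℤ] HZ n

/-- The homomorphism `φ ↦ |φ|` from `Aut(F_n)` to `GL(H_ℤ)` induced by abelianization. -/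
def autToGL (n : ℕ) : MulAut (FreeGroup (Fin n)) →* GLHZ n where
  toFun φ := (MulEquiv.toAdditive (MulEquiv.abelianizationCongr φ)).toIntLinearEquiv
  map_one' := by
    ext x
    induction x using Additive.rec with | _ x =>
    induction x using QuotientGroup.induction_on
    rfl
  map_mul' φ ψ := by
    ext x
    induction x using Additive.rec with | _ x =>
    induction x using QuotientGroup.induction_on
    rfl

theorem autToGL_cls {n : ℕ} (φ : MulAut (FreeGroup (Fin n))) (γ : FreeGroup (Fin n)) :
    autToGL n φ (cls γ) = cls (φ γ) := rfl

theorem cls_mul {n : ℕ} (γ δ : FreeGroup (Fin n)) : cls (γ * δ) = cls γ + cls δ := rfl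

theorem cls_inv {n : ℕ} (γ : FreeGroup (Fin n)) : cls γ⁻¹ = - cls γ := rfl

theorem HZ_induction {n : ℕ} {p : HZ n → Prop} (h : ∀ γ, p (cls γ)) (x : HZ n) : p x := by
  induction x using Additive.rec with | _ x =>
  induction x using QuotientGroup.induction_on with | _ γ =>
  exact h γ

/-! ### Surjectivity of `Aut(F_n) → GL(H_ℤ)`, needed for the action of `GL(H_ℤ)` -/

/-- The endomorphism of `F_n` with `x_i ↦ x_i w` that fixes the other generators. -/
def nielsenHom {n : ℕ} (i : Fin n) (w : FreeGroup (Fin n)) :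
    FreeGroup (Fin n) →* FreeGroup (Fin n) :=
  FreeGroup.lift fun m => if m = i then FreeGroup.of i * w else FreeGroup.of m

theorem exists_nielsen {n : ℕ} (i j : Fin n) (hij : i ≠ j) (ε : ℤ) :
    ∃ t ∈ (autToGL n).range, ∀ m, t (basisHZ n m) =
      if m = i then basisHZ n i + ε • basisHZ n j else basisHZ n m := by
  have key : ∀ ε : ℤ, (nielsenHom i (FreeGroup.of j ^ (-ε))).comp
      (nielsenHom i (FreeGroup.of j ^ ε)) = MonoidHom.id _ := by
    intro ε
    ext m
    by_cases hm : m = i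
    · subst hm; simp [nielsenHom, hij.symm]
    · simp [nielsenHom, hm]
  refine ⟨_, ⟨MonoidHom.toMulEquiv (nielsenHom i (FreeGroup.of j ^ ε))
    (nielsenHom i (FreeGroup.of j ^ (-ε))) (key ε) (by simpa using key (-ε)), rfl⟩, fun m => ?_⟩
  simp only [basisHZ_apply, autToGL_cls]
  by_cases hm : m = i
  · subst hm
    simp [nielsenHom, cls_mul]
    rfl
  · simp [nielsenHom, hm]

theorem exists_perm {n : ℕ} (σ : Equiv.Perm (Fin n)) :
    ∃ t ∈ (autToGL n).range, ∀ m, t (basisHZ n m) = basisHZ n (σ m) := by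
  refine ⟨_, ⟨FreeGroup.freeGroupCongr σ, rfl⟩, fun m => ?_⟩
  simp [basisHZ_apply, autToGL_cls]

theorem exists_neg {n : ℕ} (i : Fin n) :
    ∃ t ∈ (autToGL n).range, ∀ m, t (basisHZ n m) =
      if m = i then - basisHZ n i else basisHZ n m := by
  let f : FreeGroup (Fin n) →* FreeGroup (Fin n) :=
    FreeGroup.lift fun m => if m = i then (FreeGroup.of i)⁻¹ else FreeGroup.of m
  have hf : f.comp f = MonoidHom.id _ := by
    ext m
    by_cases hm : m = i
    · subst hm; simp [f]
    · simp [f, hm]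
  refine ⟨_, ⟨MonoidHom.toMulEquiv f f hf hf, rfl⟩, fun m => ?_⟩
  simp only [basisHZ_apply, autToGL_cls]
  by_cases hm : m = i
  · subst hm; simp [f, cls_inv]
  · simp [f, hm]

/-- Column reduction over `ℤ`: one more row can be made standard by elementary moves. -/
theorem reduce_row {n : ℕ} (k : Fin n) (g : GLHZ n)
    (hg : ∀ i < k, ∀ v, (basisHZ n).repr (g v) i = (basisHZ n).repr v i) :
    ∃ s ∈ (autToGL n).range, ∀ i ≤ k, ∀ v,
      (basisHZ n).repr ((g * s) v) i = (basisHZ n).repr v i := by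
  classical
  set b := basisHZ n with hb
  -- choose a reduction with the smallest `k`-th row
  let P : GLHZ n → Prop := fun s => s ∈ (autToGL n).range ∧
    ∀ i < k, ∀ m, b.repr (g (s (b m))) i = b.repr (b m) i
  let μ : GLHZ n → ℕ := fun s => ∑ m, (b.repr (g (s (b m))) k).natAbs
  have hex : ∃ N s, P s ∧ μ s = N := ⟨_, 1, ⟨one_mem _, fun i hi m => hg i hi _⟩, rfl⟩
  obtain ⟨s, ⟨hs, hPs⟩, hμ⟩ := Nat.find_spec hex
  have hmin : ∀ t, P t → μ s ≤ μ t := fun t ht => hμ ▸ Nat.find_min' hex ⟨t, ht, rfl⟩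
  -- minimality
  have hlt : ∀ l, k ≤ l → b.repr (g (s (b l))) k ≠ 0 → ∀ j, j ≠ l →
      (b.repr (g (s (b j))) k).natAbs < (b.repr (g (s (b l))) k).natAbs := by
    intro l hl hl0 j hj
    by_contra hcon
    have hε : ∃ ε : ℤ, (b.repr (g (s (b j))) k + ε * b.repr (g (s (b l))) k).natAbs <
        (b.repr (g (s (b j))) k).natAbs := by
      generalize b.repr (g (s (b j))) k = x at *
      generalize b.repr (g (s (b l))) k = y at *
      by_cases hx : 0 < x <;> by_cases hy : 0 < y
      · exact ⟨-1, by omega⟩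
      · exact ⟨1, by omega⟩
      · exact ⟨1, by omega⟩
      · exact ⟨-1, by omega⟩
    obtain ⟨ε, hε⟩ := hε
    obtain ⟨t, ht, hte⟩ := exists_nielsen j l hj ε
    rw [← hb] at hte
    have := hmin (s * t) ⟨mul_mem hs ht, fun i hi m => by
      by_cases hm : m = j
      · subst hm
        have hli : l ≠ i := fun h => absurd (h ▸ hi) (not_lt.2 hl)
        simp [hte, hPs i hi, hli]
      · simp only [LinearEquiv.mul_apply, hte, hm, if_false]
        exact hPs i hi m⟩
    refine absurd this (not_le.2 (Finset.sum_lt_sum (fun m _ => ?_) ⟨j, Finset.mem_univ _, ?_⟩))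
    · by_cases hm : m = j
      · subst hm
        simpa [hte] using hε.le
      · simp [hte, hm]
    · simpa [hte] using hε
  -- a pivot
  obtain ⟨l, hkl, hl⟩ : ∃ l, k ≤ l ∧ ∀ j, k ≤ j → j ≠ l → b.repr (g (s (b j))) k = 0 := by
    by_cases h : ∃ l, k ≤ l ∧ b.repr (g (s (b l))) k ≠ 0
    · obtain ⟨l, hkl, hl⟩ := h
      refine ⟨l, hkl, fun j hj hjl => ?_⟩
      by_contra hj0
      have h1 := hlt l hkl hl j hjl
      have h2 := hlt j hj hj0 l hjl.symm
      omega
    · push Not at h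
      exact ⟨k, le_rfl, fun j hj _ => h j hj⟩
  have hrow : ∀ (i : Fin n) (w : HZ n), b.repr (g (s w)) i =
      ∑ m, b.repr w m * b.repr (g (s (b m))) i := by
    intro i w
    conv_lhs => rw [← b.sum_repr w]
    simp only [map_sum, map_smul, Finsupp.finsetSum_apply, Finsupp.smul_apply, smul_eq_mul]
  have hpre : ∀ i < k, ∀ w, b.repr (g (s w)) i = b.repr w i := by
    intro i hi w
    rw [hrow]
    simp [hPs i hi, Finsupp.single_apply]
  have hunit : IsUnit (b.repr (g (s (b l))) k) := by
    have h := hrow k (s.symm (g.symm (b k)))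
    have hz : ∀ m, m ≠ l → b.repr (s.symm (g.symm (b k))) m * b.repr (g (s (b m))) k = 0 := by
      intro m hm
      rcases lt_or_ge m k with hmk | hmk
      · rw [← hpre m hmk]
        simp [hmk.ne']
      · rw [hl m hmk hm, mul_zero]
    rw [Finset.sum_eq_single l (fun m _ hm => hz m hm) (by simp)] at h
    simp only [LinearEquiv.apply_symm_apply, Module.Basis.repr_self, Finsupp.single_eq_same] at h
    exact IsUnit.of_mul_eq_one_right _ h.symm
  have hzero : ∀ j, j ≠ l → b.repr (g (s (b j))) k = 0 := by
    intro j hj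
    have h := hlt l hkl hunit.ne_zero j hj
    rw [Int.isUnit_iff_natAbs_eq.1 hunit] at h
    omega
  obtain ⟨p, hp, hpe⟩ := exists_perm (Equiv.swap k l)
  rw [← hb] at hpe
  have hswap : ∀ i < k, ∀ m, b.repr (b (Equiv.swap k l m)) i = b.repr (b m) i := by
    intro i hi m
    have hik : i ≠ k := hi.ne
    have hil : i ≠ l := (hi.trans_le hkl).ne
    have : (Equiv.swap k l m = i) ↔ m = i := by
      rw [Equiv.swap_apply_eq_iff, Equiv.swap_apply_of_ne_of_ne hik hil]
    simp [Finsupp.single_apply, this]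
  -- sign
  obtain ⟨u, hu, hue⟩ : ∃ u ∈ (autToGL n).range, ∀ m, u (b m) =
      if m = k then b.repr (g (s (b l))) k • b k else b m := by
    rcases Int.isUnit_iff.1 hunit with h | h
    · exact ⟨1, one_mem _, fun m => by by_cases hm : m = k <;> simp [h, hm]⟩
    · obtain ⟨t, ht, hte⟩ := exists_neg k
      rw [← hb] at hte
      exact ⟨t, ht, fun m => by simp [h, hte]⟩
  refine ⟨s * p * u, mul_mem (mul_mem hs hp) hu, fun i hi v => ?_⟩
  suffices h : ∀ m, b.repr (g (s (p (u (b m))))) i = b.repr (b m) i by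
    conv_lhs => rw [← b.sum_repr v]
    conv_rhs => rw [← b.sum_repr v]
    simp only [LinearEquiv.mul_apply, map_sum, map_smul, Finsupp.finsetSum_apply,
      Finsupp.smul_apply, h]
  intro m
  rcases hi.lt_or_eq with hi | rfl
  · rw [hpre i hi]
    by_cases hm : m = k
    · subst hm
      simp [hue, hpe, hi.ne, (hi.trans_le hkl).ne']
    · simp only [hue, hm, if_false, hpe, hswap i hi]
  · by_cases hm : m = i
    · subst hm
      simp only [hue, if_true, map_smul, hpe, Equiv.swap_apply_left, Finsupp.smul_apply,
        smul_eq_mul, Module.Basis.repr_self, Finsupp.single_eq_same]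
      exact Int.isUnit_mul_self hunit
    · simp only [hue, hm, if_false, hpe]
      rw [hzero]
      · simp [hm]
      · rw [Ne, Equiv.swap_apply_eq_iff, Equiv.swap_apply_right]
        exact hm

theorem autToGL_surjective (n : ℕ) : Function.Surjective (autToGL n) := by
  have key : ∀ k ≤ n, ∀ g : GLHZ n, ∃ s ∈ (autToGL n).range, ∀ i : Fin n, i.1 < k → ∀ v,
      (basisHZ n).repr ((g * s) v) i = (basisHZ n).repr v i := by
    intro k
    induction k with
    | zero => exact fun _ g => ⟨1, one_mem _, fun i hi => absurd hi (Nat.not_lt_zero _)⟩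
    | succ k ih =>
      intro hk g
      obtain ⟨s, hs, h⟩ := ih (by omega) g
      obtain ⟨t, ht, h'⟩ := reduce_row ⟨k, by omega⟩ (g * s) (fun i hi => h i hi)
      refine ⟨s * t, mul_mem hs ht, fun i hi v => ?_⟩
      rw [← mul_assoc]
      exact h' i (Nat.lt_succ_iff.1 hi) v
  intro g
  obtain ⟨s, hs, h⟩ := key n le_rfl g
  have h1 : g * s = 1 := by
    ext v
    apply (basisHZ n).repr.injective
    ext i
    exact h i i.2 v
  have : g ∈ (autToGL n).range := by
    rw [eq_inv_of_mul_eq_one_left h1]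
    exact inv_mem hs
  exact this

/-! ### `Out(F_n)`, `IO_n` and its abelianization -/

/-- `Inn(F_n)`, the image of `γ ↦ (δ ↦ γ δ γ⁻¹)`. -/
def Inn (n : ℕ) : Subgroup (MulAut (FreeGroup (Fin n))) := (MulAut.conj).range

instance (n : ℕ) : (Inn n).Normal where
  conj_mem := by
    rintro _ ⟨γ, rfl⟩ φ
    refine ⟨φ γ, ?_⟩
    ext δ
    simp

/-- `Out(F_n) = Aut(F_n) / Inn(F_n)`. -/
abbrev Out (n : ℕ) : Type := MulAut (FreeGroup (Fin n)) ⧸ Inn n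

/-- The homomorphism `Out(F_n) → GL(H_ℤ)` induced by abelianization. -/
def outToGL (n : ℕ) : Out n →* GLHZ n :=
  QuotientGroup.lift (Inn n) (autToGL n) (by
    rintro _ ⟨γ, rfl⟩
    ext x
    induction x using HZ_induction with | _ δ =>
    rw [autToGL_cls, MulAut.conj_apply, cls_mul, cls_mul, cls_inv]
    simp)

theorem outToGL_mk {n : ℕ} (φ : MulAut (FreeGroup (Fin n))) :
    outToGL n (QuotientGroup.mk φ) = autToGL n φ := rfl

theorem outToGL_surjective (n : ℕ) : Function.Surjective (outToGL n) := fun A => by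
  obtain ⟨φ, hφ⟩ := autToGL_surjective n A
  exact ⟨QuotientGroup.mk φ, hφ⟩

/-- `IO_n`, the kernel of `Out(F_n) → GL(H_ℤ)`. -/
def IOn (n : ℕ) : Subgroup (Out n) := (outToGL n).ker

instance (n : ℕ) : (IOn n).Normal := inferInstanceAs (outToGL n).ker.Normal

/-- `IO_n^abel = IO_n / [IO_n, IO_n]`, written additively. -/
abbrev IOAbel (n : ℕ) : Type := Additive (Abelianization (IOn n))

/-- The class in `IO_n^abel` of an element of `IO_n`. -/
def ioCls {n : ℕ} (ψ : IOn n) : IOAbel n := Additive.ofMul (Abelianization.of ψ)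

theorem IOAbel_induction {n : ℕ} {p : IOAbel n → Prop} (h : ∀ ψ, p (ioCls ψ)) (x : IOAbel n) :
    p x := by
  induction x using Additive.rec with | _ x =>
  induction x using QuotientGroup.induction_on with | _ ψ =>
  exact h ψ

/-- The action of `Out(F_n)` on `IO_n^abel` induced by conjugation on `IO_n`. -/
def outRepIO (n : ℕ) : Representation ℤ (Out n) (IOAbel n) where
  toFun φ := (MonoidHom.toAdditive
    (Abelianization.map (MulAut.conjNormal (H := IOn n) φ).toMonoidHom)).toIntLinearMap
  map_one' := by
    apply LinearMap.ext
    apply IOAbel_induction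
    intro ψ
    change ioCls (MulAut.conjNormal (H := IOn n) 1 ψ) = ioCls ψ
    simp
  map_mul' φ χ := by
    apply LinearMap.ext
    apply IOAbel_induction
    intro ψ
    change ioCls (MulAut.conjNormal (H := IOn n) (φ * χ) ψ) =
      ioCls (MulAut.conjNormal (H := IOn n) φ (MulAut.conjNormal (H := IOn n) χ ψ))
    simp

theorem outRepIO_ioCls {n : ℕ} (φ : Out n) (ψ : IOn n) :
    outRepIO n φ (ioCls ψ) = ioCls (MulAut.conjNormal φ ψ) := rfl

theorem ker_le_ker_outRepIO (n : ℕ) : (outToGL n).ker ≤ (outRepIO n).ker := by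
  intro φ hφ
  rw [MonoidHom.mem_ker]
  apply LinearMap.ext
  apply IOAbel_induction
  intro ψ
  have h : MulAut.conjNormal φ ψ = (⟨φ, hφ⟩ : IOn n) * ψ * (⟨φ, hφ⟩ : IOn n)⁻¹ := by
    ext
    simp [MulAut.conjNormal_apply]
  rw [outRepIO_ioCls, h]
  change ioCls (⟨φ, hφ⟩ : IOn n) + ioCls ψ + - ioCls (⟨φ, hφ⟩ : IOn n) = ioCls ψ
  abel

/-- The action of `GL(H_ℤ) = Out(F_n) / IO_n` on `IO_n^abel`: the matrix `|φ|` acts as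
conjugation by `φ`, see `glRepIO_outToGL`. -/
def glRepIO (n : ℕ) : Representation ℤ (GLHZ n) (IOAbel n) :=
  (QuotientGroup.lift (IOn n) (outRepIO n) (ker_le_ker_outRepIO n)).comp
    (QuotientGroup.quotientKerEquivOfSurjective (outToGL n)
      (outToGL_surjective n)).symm.toMonoidHom

theorem glRepIO_outToGL {n : ℕ} (φ : Out n) : glRepIO n (outToGL n φ) = outRepIO n φ := by
  have h : (QuotientGroup.quotientKerEquivOfSurjective (outToGL n)
      (outToGL_surjective n)).symm (outToGL n φ) = QuotientGroup.mk φ := by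
    rw [MulEquiv.symm_apply_eq]
    rfl
  change QuotientGroup.lift (IOn n) (outRepIO n) (ker_le_ker_outRepIO n)
    ((QuotientGroup.quotientKerEquivOfSurjective (outToGL n)
      (outToGL_surjective n)).symm (outToGL n φ)) = _
  rw [h]
  rfl

theorem glRepIO_apply {n : ℕ} (φ : Out n) (ψ : IOn n) :
    glRepIO n (outToGL n φ) (ioCls ψ) = ioCls (MulAut.conjNormal φ ψ) := by
  rw [glRepIO_outToGL, outRepIO_ioCls]

/-! ### The quotient of `H_ℤ^* ⊗ Λ² H_ℤ` by `ι_* (H_ℤ)` -/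

/-- The tautological action of `GL(H_ℤ)` on `H_ℤ`. -/
def stdRep (n : ℕ) : Representation ℤ (GLHZ n) (HZ n) where
  toFun A := A.toLinearMap
  map_one' := rfl
  map_mul' _ _ := rfl

/-- The induced action of `GL(H_ℤ)` on `Λ² H_ℤ`, with `A (Y ∧ Z) = A Y ∧ A Z`. -/
def wedgeRep (n : ℕ) : Representation ℤ (GLHZ n) (⋀[ℤ]^2 (HZ n)) where
  toFun A := exteriorPower.map 2 A.toLinearMap
  map_one' := exteriorPower.map_id
  map_mul' A B := exteriorPower.map_comp B.toLinearMap A.toLinearMap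

/-- `H_ℤ^* ⊗ Λ² H_ℤ`. -/
abbrev TensorTarget (n : ℕ) : Type := Module.Dual ℤ (HZ n) ⊗[ℤ] (⋀[ℤ]^2 (HZ n))

/-- The action of `GL(H_ℤ)` on `H_ℤ^* ⊗ Λ² H_ℤ`, contragredient on the first factor. -/
def tensorRep (n : ℕ) : Representation ℤ (GLHZ n) (TensorTarget n) :=
  (stdRep n).dual.tprod (wedgeRep n)

theorem vec_update {M : Type*} (Y Z W : M) : Function.update ![Y, Z] 1 W = ![Y, W] := by
  ext i
  fin_cases i <;> simp

/-- The element `Y ∧ Z` of `Λ² H_ℤ`, linear in both variables. -/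
def wedge (n : ℕ) : HZ n →ₗ[ℤ] HZ n →ₗ[ℤ] ⋀[ℤ]^2 (HZ n) :=
  LinearMap.mk₂ ℤ (fun Y Z => exteriorPower.ιMulti ℤ 2 ![Y, Z])
    (fun Y Y' Z => (exteriorPower.ιMulti ℤ 2).map_vecCons_add ![Z] Y Y')
    (fun c Y Z => (exteriorPower.ιMulti ℤ 2).map_vecCons_smul ![Z] c Y)
    (fun Y Z Z' => by
      have h := (exteriorPower.ιMulti ℤ 2).map_update_add ![Y, Z] 1 Z Z'
      simpa only [vec_update] using h)
    (fun c Y Z => by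
      have h := (exteriorPower.ιMulti ℤ 2).map_update_smul ![Y, Z] 1 c Z
      simpa only [vec_update] using h)

theorem wedge_apply {n : ℕ} (Y Z : HZ n) : wedge n Y Z = exteriorPower.ιMulti ℤ 2 ![Y, Z] := rfl

/-- Under the standard map `Λ² H_ℤ → H_ℤ ⊗ H_ℤ` the element `Y ∧ Z` is `Y ⊗ Z - Z ⊗ Y`,
that is, `YZ - ZY` in the tensor algebra. -/
theorem toTensorPower_wedge {n : ℕ} (Y Z : HZ n) :
    exteriorPower.toTensorPower ℤ (HZ n) 2 (wedge n Y Z) =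
      PiTensorProduct.tprod ℤ ![Y, Z] - PiTensorProduct.tprod ℤ ![Z, Y] := by
  have h0 : (fun i => ![Y, Z] ((Equiv.swap (0 : Fin 2) 1) i)) = ![Z, Y] := by
    ext i; fin_cases i <;> simp
  have h1 : (Finset.univ : Finset (Equiv.Perm (Fin 2))) = {1, Equiv.swap 0 1} := by decide
  have h2 : (1 : Equiv.Perm (Fin 2)) ∉ ({Equiv.swap 0 1} : Finset _) := by decide
  rw [wedge_apply, exteriorPower.toTensorPower_apply_ιMulti, h1, Finset.sum_insert h2,
    Finset.sum_singleton, h0, Equiv.Perm.sign_one, Equiv.Perm.sign_swap (by decide)]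
  simp [sub_eq_add_neg]

/-- The homomorphism `ι_*`: under the identification of `H_ℤ^* ⊗ Λ² H_ℤ` with
`Hom(H_ℤ, Λ² H_ℤ)`, it sends `Y` to `Z ↦ Y ∧ Z = YZ - ZY`. -/
def iotaStar (n : ℕ) : HZ n →ₗ[ℤ] TensorTarget n :=
  (dualTensorHomEquiv ℤ (HZ n) (⋀[ℤ]^2 (HZ n))).symm.toLinearMap ∘ₗ wedge n

theorem dualTensorHom_iotaStar {n : ℕ} (Y Z : HZ n) :
    dualTensorHom ℤ (HZ n) (⋀[ℤ]^2 (HZ n)) (iotaStar n Y) Z = wedge n Y Z := by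
  have h := (dualTensorHomEquiv ℤ (HZ n) (⋀[ℤ]^2 (HZ n))).apply_symm_apply (wedge n Y)
  exact congrArg (fun f => f Z) h

theorem dualTensorHom_tensorRep {n : ℕ} (A : GLHZ n) (t : TensorTarget n) (Z : HZ n) :
    dualTensorHom ℤ (HZ n) (⋀[ℤ]^2 (HZ n)) (tensorRep n A t) Z =
      wedgeRep n A (dualTensorHom ℤ (HZ n) (⋀[ℤ]^2 (HZ n)) t (A.symm Z)) := by
  induction t using TensorProduct.induction_on with
  | zero => simp
  | tmul f w =>
    simp only [tensorRep, dualTensorHom_apply, map_smul]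
    rfl
  | add x y hx hy => simp only [map_add, LinearMap.add_apply, hx, hy]

/-- `ι_*` is equivariant. -/
theorem tensorRep_iotaStar {n : ℕ} (A : GLHZ n) (Y : HZ n) :
    tensorRep n A (iotaStar n Y) = iotaStar n (A Y) := by
  apply (dualTensorHomEquiv ℤ (HZ n) (⋀[ℤ]^2 (HZ n))).injective
  ext1 Z
  change dualTensorHom ℤ (HZ n) (⋀[ℤ]^2 (HZ n)) _ Z = dualTensorHom ℤ (HZ n) (⋀[ℤ]^2 (HZ n)) _ Z
  rw [dualTensorHom_tensorRep, dualTensorHom_iotaStar, dualTensorHom_iotaStar, wedge_apply,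
    wedge_apply]
  refine (exteriorPower.map_apply_ιMulti A.toLinearMap _).trans ?_
  congr 1
  ext i
  fin_cases i <;> simp

/-- `(H_ℤ^* ⊗ Λ² H_ℤ) / ι_* (H_ℤ)`. -/
abbrev TensorQuot (n : ℕ) : Type := TensorTarget n ⧸ LinearMap.range (iotaStar n)

/-- The action of `GL(H_ℤ)` on `(H_ℤ^* ⊗ Λ² H_ℤ) / ι_* (H_ℤ)` induced by `tensorRep`. -/
def quotRep (n : ℕ) : Representation ℤ (GLHZ n) (TensorQuot n) :=
  (tensorRep n).quotient (LinearMap.range (iotaStar n)) (by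
    rintro A _ ⟨Y, rfl⟩
    exact ⟨A Y, (tensorRep_iotaStar A Y).symm⟩)

end OutFree

end

open scoped commutatorElement

noncomputable section

namespace OutFree

variable {n : ℕ}

/-! ### The Johnson homomorphism -/

/-! The isomorphism is induced by the Johnson homomorphism `τ : IA_n → Hom(H, Λ²H)`, which sends `φ`
to `[γ] ↦` the class of `φ(γ)γ⁻¹` in `[F, F]/[F, [F, F]] ≅ Λ²H`. That class is computed by
`magnusQuad`, the central coordinate of a map from `F_n` to a Heisenberg group, normalised so that
`[γ, δ]` goes to `[γ] ∧ [δ]`. The map `τ` is an `Aut(F_n)`-equivariant homomorphism, and on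
conjugation by `γ` it takes the value `ι_*([γ])`. It therefore descends to an equivariant map from
`IO_n^abel` to the quotient by `ι_*(H)`.

For bijectivity it is enough that `τ` induces `IA_n^abel ≅ Hom(H, Λ²H)`, since `IO_n` is `IA_n`
modulo inner automorphisms. Surjectivity is explicit: `x_i ↦ x_j x_i x_j⁻¹` and `x_i ↦ x_i [x_j,
x_k]` are sent to the elements `X_i^* ⊗ (X_j ∧ X_k)`. Injectivity needs a weak form of Magnus's
theorem: these automorphisms generate `IA_n` modulo `[IA_n, IA_n]` (`magnusSubgroup_eq_IA`). Given
this, sending each basis element back to the class of its automorphism inverts `τ`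
(`johnsonInv_johnsonHom`).

Magnus's theorem rests on three facts. Signed permutations and transvections generate `Aut(F_n)`, by
Nielsen reduction (`mulAut_eq_top`). The subgroup `N` generated by Magnus's automorphisms and
`[IA_n, IA_n]` is normal in `Aut(F_n)` (`magnusSubgroup_normal`). In `Aut(F_n)/N` the generators
satisfy the elementary relations of `GL(n, ℤ)`, and any group generated by such elements acts
faithfully on `ℤ^n` (`SteinbergSystem.eq_one_of_mem_closure`). Hence `Aut(F_n)/N → GL(n, ℤ)` is
injective and `N = IA_n`. The faithfulness is proved by peak reduction: cosets of the obvious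
stabilizer of a basis vector are matched with vectors in its orbit by following moves that decrease
the sum of absolute values of the coordinates.

For `n ≥ 2` the map `ι_*` is split injective over `ℤ`, so the quotient is free of rank `n · n(n-1)/2
- n`. -/

theorem wedge_self (Y : HZ n) : wedge n Y Y = 0 := by
  rw [wedge_apply]
  exact (exteriorPower.ιMulti ℤ 2).map_eq_zero_of_eq _ (i := 0) (j := 1) rfl (by decide)

theorem wedge_swap (Y Z : HZ n) : wedge n Z Y = - wedge n Y Z := by
  have h := wedge_self (Y + Z)
  simp only [map_add, LinearMap.add_apply, wedge_self, zero_add, add_zero] at h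
  exact eq_neg_of_add_eq_zero_left h

/-- A bilinear form whose antisymmetrization is `Y ∧ Z`. -/
def halfWedge (n : ℕ) : HZ n →ₗ[ℤ] HZ n →ₗ[ℤ] ⋀[ℤ]^2 (HZ n) :=
  (basisHZ n).constr ℤ fun i => (basisHZ n).constr ℤ fun j =>
    if i < j then wedge n (basisHZ n i) (basisHZ n j) else 0

theorem halfWedge_basis (i j : Fin n) : halfWedge n (basisHZ n i) (basisHZ n j) =
    if i < j then wedge n (basisHZ n i) (basisHZ n j) else 0 := by
  rw [halfWedge, Module.Basis.constr_basis, Module.Basis.constr_basis]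

theorem halfWedge_sub (Y Z : HZ n) : halfWedge n Y Z - halfWedge n Z Y = wedge n Y Z := by
  have h : halfWedge n - (halfWedge n).flip = wedge n := by
    refine (basisHZ n).ext fun i => (basisHZ n).ext fun j => ?_
    simp only [LinearMap.sub_apply, LinearMap.flip_apply, halfWedge_basis]
    rcases lt_trichotomy i j with h | rfl | h
    · simp [h, h.not_gt]
    · simp [wedge_self]
    · simp [h, h.not_gt, wedge_swap (basisHZ n i) (basisHZ n j)]
  exact congrArg (fun f => f Y Z) h

/-- Left translation in the Heisenberg group with cocycle `halfWedge`. -/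
def heisTranslate (h : HZ n) : Equiv.Perm (HZ n × ⋀[ℤ]^2 (HZ n)) where
  toFun p := (p.1 + h, p.2 + halfWedge n h p.1)
  invFun p := (p.1 - h, p.2 - halfWedge n h (p.1 - h))
  left_inv p := by simp
  right_inv p := by simp

/-- The action of `F_n` on the Heisenberg group. -/
def heisAction (n : ℕ) : FreeGroup (Fin n) →* Equiv.Perm (HZ n × ⋀[ℤ]^2 (HZ n)) :=
  FreeGroup.lift fun i => heisTranslate (basisHZ n i)

theorem cls_one : cls (1 : FreeGroup (Fin n)) = 0 := rfl

/-- The quadratic part of the Magnus expansion. -/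
def magnusQuad (γ : FreeGroup (Fin n)) : ⋀[ℤ]^2 (HZ n) := (heisAction n γ 0).2

/-- Generators act by left translations, so every word acts as left translation by some `([γ], u)`.
The induction only asserts that `u` exists; evaluation at the origin then identifies it as
`magnusQuad γ`. -/
theorem heisAction_apply (γ : FreeGroup (Fin n)) (p : HZ n × ⋀[ℤ]^2 (HZ n)) :
    heisAction n γ p = (p.1 + cls γ, p.2 + magnusQuad γ + halfWedge n (cls γ) p.1) := by
  have key : ∃ u, ∀ p : HZ n × ⋀[ℤ]^2 (HZ n),
      heisAction n γ p = (p.1 + cls γ, p.2 + u + halfWedge n (cls γ) p.1) := by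
    induction γ using FreeGroup.induction_on with
    | C1 => exact ⟨0, fun p => by simp [cls_one]⟩
    | of i => exact ⟨0, fun p => by simp [heisAction, heisTranslate, basisHZ_apply]⟩
    | inv_of i ih =>
      obtain ⟨u, hu⟩ := ih
      refine ⟨- u + halfWedge n (cls (FreeGroup.of i)) (cls (FreeGroup.of i)), fun p => ?_⟩
      rw [map_inv, Equiv.Perm.inv_eq_iff_eq, hu]
      ext1
      · simp [cls_inv]
      · simp only [cls_inv, map_neg, map_add, LinearMap.neg_apply]
        abel
    | mul x y hx hy =>
      obtain ⟨u, hu⟩ := hx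
      obtain ⟨v, hv⟩ := hy
      refine ⟨u + v + halfWedge n (cls x) (cls y), fun p => ?_⟩
      rw [map_mul, Equiv.Perm.mul_apply, hv, hu, cls_mul]
      ext1
      · simp only; abel
      · simp only [map_add, LinearMap.add_apply]; abel
  obtain ⟨u, hu⟩ := key
  have h0 : magnusQuad γ = u := by simp [magnusQuad, hu]
  rw [hu, h0]

theorem magnusQuad_mul (γ δ : FreeGroup (Fin n)) :
    magnusQuad (γ * δ) = magnusQuad γ + magnusQuad δ + halfWedge n (cls γ) (cls δ) := by
  have h : magnusQuad (γ * δ) = (heisAction n γ (heisAction n δ 0)).2 := by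
    rw [magnusQuad, map_mul, Equiv.Perm.mul_apply]
  rw [h, heisAction_apply δ, heisAction_apply γ]
  simp only [Prod.fst_zero, Prod.snd_zero, map_zero, zero_add, add_zero]
  abel

theorem magnusQuad_one : magnusQuad (1 : FreeGroup (Fin n)) = 0 := by
  simp [magnusQuad]

/-- Evaluate the cocycle formula on both sides of `[γ, δ] · δγ = γδ`. The commutator has trivial
class, so it adds no cross term, and what remains is the antisymmetrization of `halfWedge`. -/
theorem magnusQuad_commutator (γ δ : FreeGroup (Fin n)) :
    magnusQuad ⁅γ, δ⁆ = wedge n (cls γ) (cls δ) := by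
  have h1 := magnusQuad_mul ⁅γ, δ⁆ (δ * γ)
  have h0 : cls ⁅γ, δ⁆ = 0 := by
    simp only [commutatorElement_def, cls_mul, cls_inv]; abel
  rw [show ⁅γ, δ⁆ * (δ * γ) = γ * δ by simp [commutatorElement_def, mul_assoc], magnusQuad_mul,
    magnusQuad_mul, h0, map_zero, LinearMap.zero_apply, add_zero] at h1
  rw [← halfWedge_sub, eq_sub_iff_add_eq]
  have h2 : magnusQuad γ + magnusQuad δ + halfWedge n (cls γ) (cls δ) =
    magnusQuad γ + magnusQuad δ + (magnusQuad ⁅γ, δ⁆ + halfWedge n (cls δ) (cls γ)) := by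
    rw [h1]; abel
  exact (add_left_cancel h2).symm

/-- The subgroup `IA_n` of automorphisms that act trivially on `H_ℤ`. -/
abbrev IA (n : ℕ) : Subgroup (MulAut (FreeGroup (Fin n))) := (autToGL n).ker

theorem cls_apply_of_mem_IA {φ : MulAut (FreeGroup (Fin n))} (hφ : φ ∈ IA n)
    (γ : FreeGroup (Fin n)) : cls (φ γ) = cls γ := by
  rw [← autToGL_cls, MonoidHom.mem_ker.1 hφ]; rfl

theorem mem_IA_of_cls {φ : MulAut (FreeGroup (Fin n))}
    (h : ∀ i, cls (φ (FreeGroup.of i)) = cls (FreeGroup.of i)) : φ ∈ IA n := by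
  rw [MonoidHom.mem_ker]
  refine LinearEquiv.toLinearMap_injective ((basisHZ n).ext fun i => ?_)
  rw [basisHZ_apply]
  exact h i

/-- The value of the Johnson homomorphism at `φ`, as the homomorphism `γ ↦ φ(γ)γ⁻¹`. -/
def johnsonHom (φ : IA n) : HZ n →ₗ[ℤ] ⋀[ℤ]^2 (HZ n) :=
  (MonoidHom.toAdditiveLeft (Abelianization.lift
    ({ toFun := fun γ => Multiplicative.ofAdd (magnusQuad (φ.1 γ) - magnusQuad γ)
       map_one' := by simp
       map_mul' := fun γ δ => by
        rw [map_mul, magnusQuad_mul, magnusQuad_mul, cls_apply_of_mem_IA φ.2,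
          cls_apply_of_mem_IA φ.2, ← ofAdd_add]
        congr 1
        abel } : FreeGroup (Fin n) →* Multiplicative (⋀[ℤ]^2 (HZ n))))).toIntLinearMap

theorem johnsonHom_cls (φ : IA n) (γ : FreeGroup (Fin n)) :
    johnsonHom φ (cls γ) = magnusQuad (φ.1 γ) - magnusQuad γ := rfl

theorem johnsonHom_ext {u v : HZ n →ₗ[ℤ] ⋀[ℤ]^2 (HZ n)} (h : ∀ γ, u (cls γ) = v (cls γ)) :
    u = v := LinearMap.ext fun x => HZ_induction (p := fun x => u x = v x) h x

/-- The difference telescopes through `magnusQuad (ψ γ)`. The first half is the value of `johnsonHom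
φ` at `[ψ γ]`, which equals `[γ]` because `ψ` acts trivially on `H_ℤ`. -/
theorem johnsonHom_mul (φ ψ : IA n) : johnsonHom (φ * ψ) = johnsonHom φ + johnsonHom ψ := by
  refine johnsonHom_ext fun γ => ?_
  rw [LinearMap.add_apply]
  nth_rewrite 2 [← cls_apply_of_mem_IA ψ.2]
  simp only [johnsonHom_cls, Subgroup.coe_mul, MulAut.mul_apply]
  abel

theorem conj_mem_IA (γ : FreeGroup (Fin n)) : MulAut.conj γ ∈ IA n :=
  mem_IA_of_cls fun i => by
    rw [MulAut.conj_apply, cls_mul, cls_mul, cls_inv]; abel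

theorem johnsonHom_conj (γ : FreeGroup (Fin n)) :
    johnsonHom ⟨MulAut.conj γ, conj_mem_IA γ⟩ = wedge n (cls γ) := by
  refine johnsonHom_ext fun δ => ?_
  have h : cls (γ * δ * γ⁻¹ * δ⁻¹) = 0 := by simp only [cls_mul, cls_inv]; abel
  rw [johnsonHom_cls, ← magnusQuad_commutator, MulAut.conj_apply,
    show γ * δ * γ⁻¹ = (γ * δ * γ⁻¹ * δ⁻¹) * δ by simp, magnusQuad_mul, h, commutatorElement_def]
  simp

theorem cls_eq_zero {γ : FreeGroup (Fin n)} :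
    cls γ = 0 ↔ γ ∈ commutator (FreeGroup (Fin n)) := by
  rw [← Abelianization.ker_of]
  rfl

/-- The defect of equivariance of `magnusQuad` vanishes on commutators. -/
theorem magnusQuad_apply_of_cls_eq_zero (g : MulAut (FreeGroup (Fin n)))
    {κ : FreeGroup (Fin n)} (hκ : cls κ = 0) :
    magnusQuad (g κ) = wedgeRep n (autToGL n g) (magnusQuad κ) := by
  rw [cls_eq_zero, commutator_eq_closure] at hκ
  have h0 : ∀ κ ∈ Subgroup.closure (commutatorSet (FreeGroup (Fin n))), cls κ = 0 := by
    intro κ hκ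
    rwa [cls_eq_zero, commutator_eq_closure]
  have hg : ∀ κ ∈ Subgroup.closure (commutatorSet (FreeGroup (Fin n))), cls (g κ) = 0 := by
    intro κ hκ
    rw [← autToGL_cls, h0 κ hκ, map_zero]
  induction hκ using Subgroup.closure_induction with
  | mem x hx =>
    obtain ⟨γ, δ, rfl⟩ := hx
    rw [map_commutatorElement, magnusQuad_commutator, magnusQuad_commutator, wedge_apply,
      wedge_apply]
    refine Eq.trans ?_ (exteriorPower.map_apply_ιMulti (autToGL n g).toLinearMap _).symm
    congr 1
    ext i
    fin_cases i <;> rfl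
  | one => simp [magnusQuad_one]
  | mul x y hx hy ihx ihy =>
    rw [map_mul, magnusQuad_mul, magnusQuad_mul, hg x hx, h0 x hx, ihx, ihy]
    simp
  | inv x hx ih =>
    have h1 := magnusQuad_mul x x⁻¹
    have h2 := magnusQuad_mul (g x) (g x⁻¹)
    rw [mul_inv_cancel, magnusQuad_one, h0 x hx, map_zero, LinearMap.zero_apply, add_zero] at h1
    rw [← map_mul, mul_inv_cancel, map_one, magnusQuad_one, hg x hx, map_zero,
      LinearMap.zero_apply, add_zero] at h2
    rw [eq_neg_of_add_eq_zero_right h1.symm, eq_neg_of_add_eq_zero_right h2.symm, ih, map_neg]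

theorem johnsonHom_apply (φ : IA n) (γ : FreeGroup (Fin n)) :
    johnsonHom φ (cls γ) = magnusQuad (φ.1 γ * γ⁻¹) := by
  have h : cls (φ.1 γ * γ⁻¹) = 0 := by
    rw [cls_mul, cls_inv, cls_apply_of_mem_IA φ.2, add_neg_cancel]
  have h1 := magnusQuad_mul (φ.1 γ * γ⁻¹) γ
  rw [inv_mul_cancel_right, h, map_zero, LinearMap.zero_apply, add_zero] at h1
  rw [johnsonHom_cls, h1, add_sub_cancel_right]

/-- `magnusQuad` itself depends on the chosen basis and is not equivariant, but the Johnson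
homomorphism only evaluates it on `φ(γ)γ⁻¹`, an element of the commutator subgroup, where it is. -/
theorem johnsonHom_conj_aut (g : MulAut (FreeGroup (Fin n))) (φ : IA n) (Z : HZ n) :
    johnsonHom (MulAut.conjNormal g φ) Z =
      wedgeRep n (autToGL n g) (johnsonHom φ ((autToGL n g).symm Z)) := by
  obtain ⟨Z, rfl⟩ := (autToGL n g).surjective Z
  rw [LinearEquiv.symm_apply_apply]
  induction Z using HZ_induction with | _ γ =>
  rw [autToGL_cls, johnsonHom_apply, johnsonHom_apply, ← magnusQuad_apply_of_cls_eq_zero]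
  · simp [MulAut.conjNormal_apply]
  · rw [cls_mul, cls_inv, cls_apply_of_mem_IA φ.2, add_neg_cancel]

end OutFree

/-! ### Longest common prefixes in free groups -/

namespace List

variable {β : Type*} [DecidableEq β]

/-- The length of the longest common prefix of two lists. -/
def lcpLength : List β → List β → ℕ
  | a :: l, b :: m => if a = b then lcpLength l m + 1 else 0
  | _, _ => 0

theorem exists_lcpLength (l m : List β) : ∃ c l' m', l = c ++ l' ∧ m = c ++ m' ∧
    lcpLength l m = c.length ∧ ∀ x ∈ l'.head?, ∀ y ∈ m'.head?, x ≠ y := by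
  induction l generalizing m with
  | nil => exact ⟨[], [], m, by simp [lcpLength]⟩
  | cons a l ih =>
    cases m with
    | nil => exact ⟨[], a :: l, [], by simp [lcpLength]⟩
    | cons b m =>
      by_cases h : a = b
      · subst h
        obtain ⟨c, l', m', rfl, rfl, h1, h2⟩ := ih m
        exact ⟨a :: c, l', m', by simpa [lcpLength, h1] using h2⟩
      · exact ⟨[], a :: l, b :: m, by simp [lcpLength, h]⟩

theorem le_lcpLength_iff (l m : List β) (k : ℕ) : k ≤ lcpLength l m ↔
    k ≤ l.length ∧ k ≤ m.length ∧ l.take k = m.take k := by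
  induction l generalizing m k with
  | nil => simp [lcpLength]; rintro rfl; simp
  | cons a l ih =>
    cases m with
    | nil => simp [lcpLength]; rintro rfl; simp
    | cons b m =>
      cases k with
      | zero => simp
      | succ k =>
        by_cases h : a = b
        · simp [lcpLength, h, ih]
        · simp [lcpLength, h]

theorem lcpLength_comm (l m : List β) : lcpLength l m = lcpLength m l := by
  have key : ∀ l m : List β, lcpLength l m ≤ lcpLength m l := fun l m => by
    have h := (le_lcpLength_iff l m _).1 le_rfl
    exact (le_lcpLength_iff _ _ _).2 ⟨h.2.1, h.1, h.2.2.symm⟩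
  exact le_antisymm (key l m) (key m l)

/-- The ultrametric inequality for common prefixes. It is used below in the form that, among three
such lengths, the two smallest coincide. -/
theorem min_lcpLength_le (l m k : List β) :
    min (lcpLength l m) (lcpLength m k) ≤ lcpLength l k := by
  obtain ⟨h1, h2, h3⟩ := (le_lcpLength_iff _ _ _).1 (min_le_left (lcpLength l m) (lcpLength m k))
  obtain ⟨h4, h5, h6⟩ := (le_lcpLength_iff _ _ _).1 (min_le_right (lcpLength l m) (lcpLength m k))
  exact (le_lcpLength_iff _ _ _).2 ⟨h1, h5, h3.trans h6⟩

end List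

/-! ### Cancellation in products of reduced words, and Nielsen reduced systems. -/

namespace FreeGroup

open List

variable {α : Type*} [DecidableEq α]

/-- The length of the longest common prefix of two reduced words. -/
def lcp (a b : FreeGroup α) : ℕ := lcpLength a.toWord b.toWord

theorem lcp_comm (a b : FreeGroup α) : lcp a b = lcp b a := lcpLength_comm _ _

theorem min_lcp_le (a b c : FreeGroup α) : min (lcp a b) (lcp b c) ≤ lcp a c :=
  min_lcpLength_le _ _ _

theorem lcp_le_norm (a b : FreeGroup α) : lcp a b ≤ a.norm :=
  ((le_lcpLength_iff _ _ _).1 le_rfl).1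

theorem lcp_self (a : FreeGroup α) : lcp a a = a.norm :=
  le_antisymm (lcp_le_norm a a) ((le_lcpLength_iff _ _ _).2 ⟨le_rfl, le_rfl, rfl⟩)

theorem isReduced_invRev {l : List (α × Bool)} (h : IsReduced l) : IsReduced (invRev l) := by
  rw [isReduced_iff_reduce_eq, reduce_invRev, h.reduce_eq]

/-- Once the longest common prefix is removed, the two remaining words start with different letters,
so nothing cancels at the junction. -/
theorem toWord_inv_mul (a b : FreeGroup α) : (a⁻¹ * b).toWord =
    invRev (a.toWord.drop (lcp a b)) ++ b.toWord.drop (lcp a b) := by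
  obtain ⟨c, l, m, hl, hm, hc, hne⟩ := exists_lcpLength a.toWord b.toWord
  rw [lcp, hc]
  have hl' : IsReduced l := (isReduced_toWord (x := a)).infix (hl ▸ (List.suffix_append c l).isInfix)
  have hm' : IsReduced m := (isReduced_toWord (x := b)).infix (hm ▸ (List.suffix_append c m).isInfix)
  have h : a⁻¹ * b = mk (invRev l ++ m) := by
    rw [← mk_toWord (x := a), ← mk_toWord (x := b), hl, hm, ← mul_mk, ← mul_mk, ← mul_mk, mul_inv_rev,
      ← inv_mk]
    group
  rw [h, toWord_mk, hl, hm, drop_left, drop_left, ← isReduced_iff_reduce_eq]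
  refine List.isChain_append.2 ⟨isReduced_invRev hl', hm', ?_⟩
  cases l with
  | nil => simp
  | cons x l =>
    cases m with
    | nil => simp
    | cons y m =>
      have hxy : x ≠ y := hne x (by simp) y (by simp)
      rintro z hz w hw h1
      simp only [invRev, List.map_cons, List.reverse_cons, List.getLast?_concat,
        Option.mem_def, Option.some.injEq, List.head?_cons] at hz hw
      subst hz hw
      by_contra h2
      refine hxy (Prod.ext h1 ?_)
      simpa using h2

theorem norm_inv_mul_add (a b : FreeGroup α) :
    (a⁻¹ * b).norm + 2 * lcp a b = a.norm + b.norm := by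
  have h1 := lcp_le_norm a b
  have h2 := lcp_le_norm b a
  rw [lcp_comm] at h2
  have h3 := congrArg List.length (toWord_inv_mul a b)
  rw [List.length_append, invRev_length, List.length_drop, List.length_drop] at h3
  unfold norm at *
  omega

/-- If `v` and `v⁻¹` agreed on half of their length, letters at mirror positions of `v` would be
mutually inverse. For even length the two middle letters would then cancel; for odd length the
middle letter would be its own inverse. -/
theorem two_mul_lcp_inv_lt {v : FreeGroup α} (hv : v ≠ 1) : 2 * lcp v v⁻¹ < v.norm := by
  by_contra! hcon
  have hpos : 0 < v.norm := by
    rw [Nat.pos_iff_ne_zero, Ne, norm_eq_zero]; exact hv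
  obtain ⟨-, -, h⟩ := (le_lcpLength_iff v.toWord v⁻¹.toWord (lcp v v⁻¹)).1 le_rfl
  have hred : IsReduced v.toWord := isReduced_toWord
  unfold norm at hcon hpos
  rw [toWord_inv] at h
  generalize lcp v v⁻¹ = k at *
  generalize v.toWord = l at *
  have key : ∀ i, (hi : i < k) → (hl : i < l.length) →
      l[i] = ((l[l.length - 1 - i]).1, !(l[l.length - 1 - i]).2) := by
    intro i hi hl
    have h1 := congrArg (fun m => m[i]?) h
    simp only [List.getElem?_take, hi, if_true] at h1
    rw [List.getElem?_eq_getElem hl, List.getElem?_eq_getElem (by simpa using hl)] at h1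
    have h2 := Option.some.inj h1
    rw [h2]
    simp [invRev, List.getElem_reverse]
  rcases Nat.even_or_odd' l.length with ⟨m, hm | hm⟩
  · have h1 := key (m - 1) (by omega) (by omega)
    have h2 : l.length - 1 - (m - 1) = m - 1 + 1 := by omega
    have h3 := (List.isChain_iff_getElem.1 hred) (m - 1) (by omega)
    simp only [h2] at h1
    rw [h1] at h3
    simp at h3
  · have h1 := key m (by omega) (by omega)
    have h2 : l.length - 1 - m = m := by omega
    simp only [h2] at h1
    have := congrArg Prod.snd h1
    simp at this

/-- A system of letters `v` is Nielsen reduced. -/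
structure NielsenReduced {β : Type*} (v : β × Bool → FreeGroup α) : Prop where
  inv : ∀ i b, v (i, !b) = (v (i, b))⁻¹
  ne_one : ∀ l, v l ≠ 1
  two_mul_lcp_le : ∀ k l, k ≠ l → 2 * lcp (v k) (v l) ≤ (v l).norm
  lcp_add_lcp_lt : ∀ k l m, k ≠ l → m ≠ (l.1, !l.2) →
    lcp (v k) (v l) + lcp (v l)⁻¹ (v m) < (v l).norm

/-- In a product over a reduced word, part of every factor survives cancellation. The first clause
is the form that carries the induction: the product follows its first factor `v l` further than any
other `v k` does. The last clause is the goal: a product of length one has a single factor. -/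
theorem NielsenReduced.norm_prod {β : Type*} {v : β × Bool → FreeGroup α} (hv : NielsenReduced v)
    (l : β × Bool) (L : List (β × Bool)) (hL : IsReduced (l :: L)) :
    (∀ k ≠ l, lcp (v k) (v l) < lcp ((l :: L).map v).prod (v l)) ∧
      0 < ((l :: L).map v).prod.norm ∧ (((l :: L).map v).prod.norm = 1 → L = []) := by
  have hpos : ∀ l, 0 < (v l).norm := fun l => by
    rw [Nat.pos_iff_ne_zero, Ne, norm_eq_zero]; exact hv.ne_one l
  induction L generalizing l with
  | nil =>
    simp only [List.map_cons, List.map_nil, List.prod_cons, List.prod_nil, mul_one, lcp_self]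
    refine ⟨fun k hk => ?_, hpos l, fun _ => trivial⟩
    have := hv.two_mul_lcp_le k l hk
    have := hpos l
    omega
  | cons m L ih =>
    obtain ⟨h1, h2, h3⟩ := ih m (hL.infix (List.suffix_cons l _).isInfix)
    rw [List.map_cons, List.prod_cons]
    generalize hQ : ((m :: L).map v).prod = Q at *
    have hlm : (l.1, !l.2) ≠ m := by
      rintro rfl
      simp [isReduced_cons_cons] at hL
    have hinv : v (l.1, !l.2) = (v l)⁻¹ := hv.inv l.1 l.2
    have h4 := h1 _ hlm
    have h5 := hv.two_mul_lcp_le m (l.1, !l.2) hlm.symm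
    rw [hinv] at h4 h5
    rw [norm_inv_eq, lcp_comm] at h5
    -- `(v l)⁻¹` leaves `v m` strictly before `Q` does, so by the ultrametric inequality it
    -- separates from `Q` and from `v m` at the same place.
    have h6 : lcp (v l)⁻¹ Q = lcp (v l)⁻¹ (v m) := by
      have e1 := min_lcp_le (v l)⁻¹ (v m) Q
      have e2 := min_lcp_le (v l)⁻¹ Q (v m)
      rw [lcp_comm (v m) Q] at e1
      omega
    have h7 := norm_inv_mul_add (v l)⁻¹ Q
    rw [inv_inv, norm_inv_eq, h6] at h7
    -- Together with `h7` this says that the part of `v l` kept in `v l * Q` is exactly what does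
    -- not cancel against `v m`.
    have h8 := norm_inv_mul_add (v l * Q) (v l)
    rw [mul_inv_rev, inv_mul_cancel_right, norm_inv_eq] at h8
    have h9 := lcp_le_norm Q (v m)
    have h10 := hpos l
    refine ⟨fun k hk => ?_, by omega, fun h => by omega⟩
    have := hv.lcp_add_lcp_lt k l m hk hlm.symm
    omega

end FreeGroup

namespace OutFree

variable {n : ℕ}

/-! ### Elementary automorphisms of a free group -/

theorem mulAut_ext {φ ψ : MulAut (FreeGroup (Fin n))}
    (h : ∀ i, φ (FreeGroup.of i) = ψ (FreeGroup.of i)) : φ = ψ :=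
  MulEquiv.toMonoidHom_injective (FreeGroup.ext_hom _ _ h)

/-- The free factor of `F_n` generated by the letters other than `x_i`. -/
def cofactor (i : Fin n) : Subgroup (FreeGroup (Fin n)) :=
  Subgroup.closure (FreeGroup.of '' {j | j ≠ i})

theorem of_mem_cofactor {i j : Fin n} (h : j ≠ i) : FreeGroup.of j ∈ cofactor i :=
  Subgroup.subset_closure ⟨j, h, rfl⟩

/-- The letter `x_j`, as an element of the free factor that omits `x_i`. -/
def cogen {i j : Fin n} (h : j ≠ i) : cofactor i := ⟨FreeGroup.of j, of_mem_cofactor h⟩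

@[simp] theorem coe_cogen {i j : Fin n} (h : j ≠ i) : (cogen h : FreeGroup (Fin n)) =
    FreeGroup.of j := rfl

theorem eq_of_mem_cofactor {G : Type*} [Group G] {i : Fin n} {φ ψ : FreeGroup (Fin n) →* G}
    (h : ∀ j ≠ i, φ (FreeGroup.of j) = ψ (FreeGroup.of j)) {u : FreeGroup (Fin n)}
    (hu : u ∈ cofactor i) : φ u = ψ u := by
  refine MonoidHom.eqOn_closure (f := φ) (g := ψ) ?_ hu
  rintro _ ⟨j, hj, rfl⟩
  exact h j hj

theorem map_mem_cofactor {i : Fin n} {φ : FreeGroup (Fin n) →* FreeGroup (Fin n)}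
    (h : ∀ j ≠ i, φ (FreeGroup.of j) ∈ cofactor i) {u : FreeGroup (Fin n)}
    (hu : u ∈ cofactor i) : φ u ∈ cofactor i := by
  have h1 : cofactor i ≤ (cofactor i).comap φ := by
    refine (Subgroup.closure_le _).2 ?_
    rintro _ ⟨j, hj, rfl⟩
    exact h j hj
  exact h1 hu

/-- The endomorphism `x_i ↦ u x_i w`, fixing the other letters. -/
def substHom (i : Fin n) (u w : FreeGroup (Fin n)) : FreeGroup (Fin n) →* FreeGroup (Fin n) :=
  FreeGroup.lift fun m => if m = i then u * FreeGroup.of i * w else FreeGroup.of m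

theorem substHom_fix {i : Fin n} (u w : FreeGroup (Fin n)) {g : FreeGroup (Fin n)}
    (hg : g ∈ cofactor i) : substHom i u w g = g :=
  eq_of_mem_cofactor (ψ := MonoidHom.id _) (fun j hj => by simp [substHom, hj]) hg

theorem substHom_comp {i : Fin n} (u w u' w' : cofactor i) :
    (substHom i u w).comp (substHom i u' w') = substHom i (u' * u) (w * w') := by
  ext j
  by_cases h : j = i
  · subst h
    have h1 := substHom_fix (i := j) u w u'.2
    have h2 := substHom_fix (i := j) u w w'.2
    have h3 : ∀ a b, substHom j a b (FreeGroup.of j) = a * FreeGroup.of j * b := by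
      simp [substHom]
    simp only [MonoidHom.comp_apply, h3, map_mul, h1, h2, mul_assoc]
  · simp [substHom, h]

theorem substHom_one (i : Fin n) : substHom i 1 1 = MonoidHom.id _ := by
  ext j
  by_cases h : j = i
  · subst h; simp [substHom]
  · simp [substHom, h]

/-- The automorphism `x_i ↦ u x_i w`, fixing the other letters, where `u` and `w` do not
involve `x_i`. -/
def substAut (i : Fin n) (u w : cofactor i) : MulAut (FreeGroup (Fin n)) :=
  MonoidHom.toMulEquiv (substHom i u w) (substHom i ↑u⁻¹ ↑w⁻¹)
    (by rw [substHom_comp]; simp [substHom_one]) (by rw [substHom_comp]; simp [substHom_one])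

@[simp] theorem substAut_self (i : Fin n) (u w : cofactor i) :
    substAut i u w (FreeGroup.of i) = u * FreeGroup.of i * w := by
  simp [substAut, substHom]

theorem substAut_ne {i j : Fin n} (h : j ≠ i) (u w : cofactor i) :
    substAut i u w (FreeGroup.of j) = FreeGroup.of j := by
  simp [substAut, substHom, h]

theorem substAut_fix {i : Fin n} (u w : cofactor i) {g : FreeGroup (Fin n)}
    (hg : g ∈ cofactor i) : substAut i u w g = g := by
  have h : substHom i u w g = g := substHom_fix _ _ hg
  exact h

theorem substAut_mul (i : Fin n) (u w u' w' : cofactor i) :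
    substAut i u w * substAut i u' w' = substAut i (u' * u) (w * w') := by
  refine MulEquiv.toMonoidHom_injective ?_
  exact substHom_comp u w u' w'

theorem substAut_one (i : Fin n) : substAut i 1 1 = 1 := by
  refine MulEquiv.toMonoidHom_injective ?_
  exact substHom_one i

theorem substAut_inv (i : Fin n) (u w : cofactor i) :
    (substAut i u w)⁻¹ = substAut i u⁻¹ w⁻¹ := by
  rw [inv_eq_iff_mul_eq_one, substAut_mul]
  simp [substAut_one]

/-- The elementary automorphism `x_i ↦ x_i x_j`. -/
def transv {i j : Fin n} (h : j ≠ i) : MulAut (FreeGroup (Fin n)) := substAut i 1 (cogen h)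

/-- The automorphism `x_i ↦ x_{σ i}^{f i}`. -/
def signedPerm (σ : Equiv.Perm (Fin n)) (f : Fin n → ℤˣ) : MulAut (FreeGroup (Fin n)) :=
  MonoidHom.toMulEquiv
    (FreeGroup.lift fun i => FreeGroup.of (σ i) ^ (f i : ℤ))
    (FreeGroup.lift fun i => FreeGroup.of (σ⁻¹ i) ^ (f (σ⁻¹ i) : ℤ))
    (by
      ext i
      rcases Int.units_eq_one_or (f i) with h | h <;> simp [h])
    (by
      ext i
      simp only [MonoidHom.comp_apply, FreeGroup.lift_apply_of, map_zpow, MonoidHom.id_apply,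
        show σ (σ⁻¹ i) = i from σ.apply_symm_apply i]
      rcases Int.units_eq_one_or (f (σ⁻¹ i)) with h | h <;> rw [h] <;> simp)

@[simp] theorem signedPerm_of (σ : Equiv.Perm (Fin n)) (f : Fin n → ℤˣ) (i : Fin n) :
    signedPerm σ f (FreeGroup.of i) = FreeGroup.of (σ i) ^ (f i : ℤ) := by
  simp [signedPerm]

theorem signedPerm_mul (σ τ : Equiv.Perm (Fin n)) (f g : Fin n → ℤˣ) :
    signedPerm σ f * signedPerm τ g = signedPerm (σ * τ) fun i => f (τ i) * g i := by
  refine mulAut_ext fun i => ?_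
  rw [MulAut.mul_apply, signedPerm_of, map_zpow, signedPerm_of, signedPerm_of, ← zpow_mul]
  simp

theorem signedPerm_one : signedPerm (1 : Equiv.Perm (Fin n)) (fun _ => 1) = 1 :=
  mulAut_ext fun i => by simp

/-- The move `y ↦ z y` for letters `y = x_i^±`, `z = x_j^±` with `i ≠ j`. -/
def nielsenMove (y z : Fin n × Bool) (h : z.1 ≠ y.1) : MulAut (FreeGroup (Fin n)) :=
  if y.2 then substAut y.1 (cogen h ^ (if z.2 then 1 else -1 : ℤ)) 1
  else substAut y.1 1 (cogen h ^ (if z.2 then -1 else 1 : ℤ))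

theorem mk_true (i : Fin n) : FreeGroup.mk [(i, true)] = FreeGroup.of i := rfl

theorem mk_false (i : Fin n) : FreeGroup.mk [(i, false)] = (FreeGroup.of i)⁻¹ := rfl

theorem nielsenMove_mk (y z : Fin n × Bool) (h : z.1 ≠ y.1) :
    nielsenMove y z h (FreeGroup.mk [y]) = FreeGroup.mk [z] * FreeGroup.mk [y] := by
  obtain ⟨i, a⟩ := y
  obtain ⟨j, b⟩ := z
  cases a <;> cases b <;> simp [nielsenMove, mk_true, mk_false]

theorem nielsenMove_of (y z : Fin n × Bool) (h : z.1 ≠ y.1) {j : Fin n} (hj : j ≠ y.1) :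
    nielsenMove y z h (FreeGroup.of j) = FreeGroup.of j := by
  unfold nielsenMove
  split_ifs <;> simp only [substAut_ne hj]

/-! ### Automorphisms of free groups are products of elementary ones -/

open List
open FreeGroup hiding map_mul map_one map_inv norm

/-- The numerical value of a word, a strictly monotone code for the lexicographic order. -/
def wordCode (L : List (Fin n × Bool)) : ℕ :=
  Nat.ofDigits (2 * n + 2) (L.map fun l => 2 * l.1.1 + if l.2 then 1 else 0).reverse

theorem wordCode_append (L M : List (Fin n × Bool)) :
    wordCode (L ++ M) = wordCode M + (2 * n + 2) ^ M.length * wordCode L := by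
  simp [wordCode, Nat.ofDigits_append]

theorem wordCode_inj {L M : List (Fin n × Bool)} (h : L.length = M.length)
    (hc : wordCode L = wordCode M) : L = M := by
  have hlt : ∀ L : List (Fin n × Bool), ∀ x ∈
      (L.map fun l : Fin n × Bool => 2 * l.1.1 + if l.2 then 1 else 0).reverse, x < 2 * n + 2 := by
    intro L x hx
    rw [List.mem_reverse, List.mem_map] at hx
    obtain ⟨l, -, rfl⟩ := hx
    have := l.1.2
    split_ifs <;> omega
  have h1 := Nat.ofDigits_inj_of_len_eq (by omega) (by simp [h]) (hlt L) (hlt M) hc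
  refine List.map_injective_iff.2 ?_ (List.reverse_injective h1)
  rintro ⟨i, a⟩ ⟨j, b⟩ hab
  cases a <;> cases b <;> simp at hab <;> first | omega | skip
  all_goals simp [Fin.ext_iff, hab]

/-- The codes of the initial halves of a word and of its inverse. -/
def halfCode (L : List (Fin n × Bool)) : ℕ :=
  wordCode (L.take ((L.length + 1) / 2)) + wordCode ((invRev L).take ((L.length + 1) / 2))

theorem halfCode_invRev (L : List (Fin n × Bool)) : halfCode (invRev L) = halfCode L := by
  simp [halfCode, invRev_length, invRev_invRev, add_comm]

/-- Since `p` is at most half of `p ++ c`, the initial half of the word contains all of `p`, while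
the initial half of the inverse word sees only `c`. Only the first summand changes, and in its most
significant digits. -/
theorem halfCode_lt {p q c : List (Fin n × Bool)} (hpq : p.length = q.length)
    (hc : p.length ≤ c.length) (h : wordCode q < wordCode p) :
    halfCode (q ++ c) < halfCode (p ++ c) := by
  unfold halfCode
  simp only [List.length_append, invRev_append, ← hpq]
  generalize hK : (p.length + c.length + 1) / 2 = K
  rw [List.take_append_of_le_length (l₁ := invRev c) (by rw [invRev_length]; omega),
    List.take_append_of_le_length (l₁ := invRev c) (by rw [invRev_length]; omega),
    List.take_append, List.take_append, List.take_of_length_le (l := p) (by omega),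
    List.take_of_length_le (l := q) (by omega), hpq, wordCode_append, wordCode_append]
  have := Nat.mul_lt_mul_of_pos_left h
    (show 0 < (2 * n + 2) ^ (List.take (K - q.length) c).length by positivity)
  omega

/-- The complexity of an automorphism in the Nielsen reduction process. -/
def complexity (φ : MulAut (FreeGroup (Fin n))) : ℕ ×ₗ ℕ :=
  toLex (∑ i, (φ (of i)).norm, ∑ i, halfCode (φ (of i)).toWord)

theorem complexity_lt {φ ψ : MulAut (FreeGroup (Fin n))} (y : Fin n × Bool)
    (h : ∀ j ≠ y.1, ψ (of j) = φ (of j))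
    (hlt : (ψ (mk [y])).norm < (φ (mk [y])).norm ∨ ((ψ (mk [y])).norm = (φ (mk [y])).norm ∧
      halfCode (ψ (mk [y])).toWord < halfCode (φ (mk [y])).toWord)) :
    complexity ψ < complexity φ := by
  obtain ⟨i, b⟩ := y
  have h1 : ∀ φ : MulAut (FreeGroup (Fin n)), (φ (mk [(i, b)])).norm = (φ (of i)).norm := by
    cases b <;> simp [mk_true, mk_false, norm_inv_eq]
  have h2 : ∀ φ : MulAut (FreeGroup (Fin n)),
      halfCode (φ (mk [(i, b)])).toWord = halfCode (φ (of i)).toWord := by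
    cases b <;> simp [mk_true, mk_false, toWord_inv, halfCode_invRev]
  simp only [h1, h2] at hlt
  rw [complexity, complexity, Prod.Lex.toLex_lt_toLex]
  rcases hlt with hlt | ⟨heq, hlt⟩
  · left
    refine Finset.sum_lt_sum (fun j _ => ?_) ⟨i, Finset.mem_univ _, hlt⟩
    rcases eq_or_ne j i with rfl | hj
    · exact hlt.le
    · rw [h j hj]
  · right
    refine ⟨by
      change ∑ i, (ψ (of i)).norm = ∑ i, (φ (of i)).norm
      refine Finset.sum_congr rfl fun j _ => ?_
      rcases eq_or_ne j i with rfl | hj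
      · exact heq
      · rw [h j hj], Finset.sum_lt_sum (fun j _ => ?_) ⟨i, Finset.mem_univ _, hlt⟩⟩
    · rcases eq_or_ne j i with rfl | hj
      · exact hlt.le
      · rw [h j hj]

theorem mk_bar (l : Fin n × Bool) : mk [(l.1, !l.2)] = (mk [l])⁻¹ := by
  simp [invRev]

theorem mk_ne_one (l : Fin n × Bool) : mk [l] ≠ 1 := by
  obtain ⟨i, b⟩ := l
  cases b
  · rw [mk_false, inv_ne_one]; exact of_ne_one i
  · exact of_ne_one i

/-- If no move decreases the complexity of `φ`, the images of the letters are Nielsen reduced. -/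
theorem nielsenReduced_of_minimal (φ : MulAut (FreeGroup (Fin n)))
    (hφ : ∀ y z h, ¬ complexity (φ * nielsenMove y z h) < complexity φ) :
    NielsenReduced fun l : Fin n × Bool => φ (mk [l]) := by
  have hinv : ∀ l : Fin n × Bool, φ (mk [(l.1, !l.2)]) = (φ (mk [l]))⁻¹ := fun l => by
    rw [mk_bar, map_inv]
  have hne : ∀ l : Fin n × Bool, φ (mk [l]) ≠ 1 := fun l => by
    simpa using mk_ne_one l
  have hmin : ∀ y z : Fin n × Bool, z.1 ≠ y.1 →
      (φ (mk [y])).norm ≤ (φ (mk [z]) * φ (mk [y])).norm ∧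
      ((φ (mk [z]) * φ (mk [y])).norm = (φ (mk [y])).norm →
        halfCode (φ (mk [y])).toWord ≤ halfCode (φ (mk [z]) * φ (mk [y])).toWord) := by
    intro y z hyz
    by_contra hcon
    refine hφ y z hyz (complexity_lt y (fun j hj => ?_) ?_)
    · rw [MulAut.mul_apply, nielsenMove_of y z hyz hj]
    · rw [MulAut.mul_apply, nielsenMove_mk, map_mul]
      by_contra h
      exact hcon ⟨by omega, fun h' => by omega⟩
  have hbar : ∀ k l : Fin n × Bool, k.1 = l.1 → k ≠ l → k = (l.1, !l.2) := by
    intro k l h h'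
    refine Prod.ext h ?_
    have h2 : k.2 ≠ l.2 := fun h2 => h' (Prod.ext h h2)
    exact Bool.eq_not.2 h2
  have hsq : ∀ l : Fin n × Bool, 2 * lcp (φ (mk [l])) (φ (mk [l]))⁻¹ < (φ (mk [l])).norm :=
    fun l => two_mul_lcp_inv_lt (hne l)
  have hN1 : ∀ k l : Fin n × Bool, k ≠ l → 2 * lcp (φ (mk [k])) (φ (mk [l])) ≤
      (φ (mk [l])).norm := by
    intro k l hkl
    by_cases h1 : k.1 = l.1
    · rw [hbar k l h1 hkl, hinv, lcp_comm]
      exact (hsq l).le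
    · have h2 := (hmin k (l.1, !l.2) (by simpa using Ne.symm h1)).1
      rw [hinv] at h2
      have h3 := norm_inv_mul_add (φ (mk [l])) (φ (mk [k]))
      rw [lcp_comm] at h3
      omega
  -- When exactly half of `v l` cancels in `(v l)⁻¹ * v k`, the move keeps the length of `v k` and
  -- replaces its prefix, the first half of `v l`, by the first half of `(v l)⁻¹`. Minimality of the
  -- second component of the complexity forbids this to lower the code.
  have hcode : ∀ k l : Fin n × Bool, k ≠ l →
      2 * lcp (φ (mk [k])) (φ (mk [l])) = (φ (mk [l])).norm →
      wordCode ((φ (mk [l])).toWord.take (lcp (φ (mk [k])) (φ (mk [l])))) ≤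
      wordCode ((φ (mk [l]))⁻¹.toWord.take (lcp (φ (mk [k])) (φ (mk [l])))) := by
    intro k l hkl hh
    have h1 : k.1 ≠ l.1 := by
      intro h1
      have := hsq l
      rw [hbar k l h1 hkl, hinv, lcp_comm] at hh
      omega
    by_contra! hlt
    have h2 := (hmin k (l.1, !l.2) (by simpa using Ne.symm h1)).2
    rw [hinv] at h2
    have h3 := norm_inv_mul_add (φ (mk [l])) (φ (mk [k]))
    have h4 := hN1 l k hkl.symm
    have h5 := toWord_inv_mul (φ (mk [l])) (φ (mk [k]))
    rw [lcp_comm] at h3 h4 h5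
    obtain ⟨h6, h7, h8⟩ := (le_lcpLength_iff (φ (mk [k])).toWord (φ (mk [l])).toWord _).1 le_rfl
    specialize h2 (by omega)
    rw [h5] at h2
    change _ ≤ (φ (mk [k])).norm at h6
    change _ ≤ (φ (mk [l])).norm at h7
    change take (lcp _ _) _ = take (lcp _ _) _ at h8
    change lcp _ _ ≤ _ at h6
    change lcp _ _ ≤ _ at h7
    unfold FreeGroup.norm at *
    rw [toWord_inv] at hlt
    generalize lcp (φ (mk [k])) (φ (mk [l])) = d at *
    generalize (φ (mk [k])).toWord = K at *
    generalize (φ (mk [l])).toWord = M at *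
    have e1 : invRev (M.drop d) = (invRev M).take d := by
      conv_rhs => rw [← List.take_append_drop d M, invRev_append]
      rw [List.take_append_of_le_length (by rw [invRev_length, List.length_drop]; omega),
        List.take_of_length_le (by rw [invRev_length, List.length_drop]; omega)]
    have e2 : K = M.take d ++ K.drop d := by
      rw [← h8, List.take_append_drop]
    rw [e1] at h2
    nth_rewrite 1 [e2] at h2
    refine absurd h2 (not_le.2 (halfCode_lt ?_ ?_ hlt))
    · simp [invRev_length]
    · simp; omega
  refine ⟨fun i b => hinv (i, b), hne, hN1, fun k l m hkl hml => ?_⟩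
  by_contra! hcon
  have h1 := hN1 k l hkl
  have h2 := hN1 m (l.1, !l.2) hml
  rw [hinv, norm_inv_eq, lcp_comm] at h2
  -- If nothing of `v l` survived between its two neighbours, each would cancel exactly half of it.
  -- The code comparisons from the two sides are opposite inequalities, so the first halves of `v l`
  -- and `(v l)⁻¹` coincide, against `hsq`.
  have c1 := hcode k l hkl (by omega)
  have c2 := hcode m (l.1, !l.2) hml (by rw [hinv, norm_inv_eq, lcp_comm]; omega)
  rw [hinv, inv_inv, lcp_comm (φ (mk [m])),
    show lcp (φ (mk [l]))⁻¹ (φ (mk [m])) = lcp (φ (mk [k])) (φ (mk [l])) by omega] at c2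
  have hd : lcp (φ (mk [k])) (φ (mk [l])) ≤ (φ (mk [l])).toWord.length := by
    change _ ≤ (φ (mk [l])).norm; omega
  have hd' : lcp (φ (mk [k])) (φ (mk [l])) ≤ (φ (mk [l]))⁻¹.toWord.length := by
    change _ ≤ (φ (mk [l]))⁻¹.norm; rw [norm_inv_eq]; omega
  have h3 := wordCode_inj (by simp [hd]) (le_antisymm c1 c2)
  have h4 : lcp (φ (mk [k])) (φ (mk [l])) ≤ lcp (φ (mk [l])) (φ (mk [l]))⁻¹ :=
    (le_lcpLength_iff _ _ _).2 ⟨hd, hd', h3⟩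
  have h5 := hsq l
  omega

/-- Write `φ⁻¹(x_j)` as a reduced word in the letters. Applying `φ` gives a product of the Nielsen
reduced elements that equals `x_j`, of length one, so the word is a single letter. -/
theorem exists_signedPerm_of_nielsenReduced (φ : MulAut (FreeGroup (Fin n)))
    (hφ : NielsenReduced fun l : Fin n × Bool => φ (mk [l])) :
    ∃ σ f, φ⁻¹ = signedPerm σ f := by
  have hprod : ∀ L : List (Fin n × Bool), (L.map fun l => φ (mk [l])).prod = φ (mk L) := by
    intro L
    induction L with
    | nil => simp [← one_eq_mk]
    | cons l L ih => rw [List.map_cons, List.prod_cons, ih, ← map_mul, mul_mk, List.singleton_append]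
  have h1 : ∀ j, ∃ l : Fin n × Bool, φ⁻¹ (of j) = mk [l] := by
    intro j
    have hj : φ (φ⁻¹ (of j)) = of j := MulAut.apply_inv_self _ _ _
    rw [← mk_toWord (x := φ⁻¹ (of j))] at hj ⊢
    have hred : IsReduced (φ⁻¹ (of j)).toWord := isReduced_toWord
    cases hL : (φ⁻¹ (of j)).toWord with
    | nil =>
      rw [hL, ← one_eq_mk, map_one] at hj
      exact absurd hj.symm (of_ne_one j)
    | cons l L =>
      rw [hL] at hj hred
      have h := (hφ.norm_prod l L hred).2.2
      rw [hprod, hj, norm_of] at h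
      exact ⟨l, by rw [h rfl]⟩
  choose l hl using h1
  have hinj : Function.Injective fun j => (l j).1 := by
    intro j k hjk
    have h2 : of j = of k ∨ of j = (of k)⁻¹ := by
      have h3 : mk [l j] = mk [l k] ∨ mk [l j] = (mk [l k])⁻¹ := by
        have hjk' : (l j).1 = (l k).1 := hjk
        revert hjk'
        generalize l j = a
        generalize l k = b
        obtain ⟨a, s⟩ := a
        obtain ⟨b, t⟩ := b
        rintro (rfl : a = b)
        cases s <;> cases t <;> simp [mk_true, mk_false]
      rw [← hl, ← hl, ← map_inv] at h3
      exact h3.imp (fun h => φ⁻¹.injective h) fun h => φ⁻¹.injective h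
    rcases h2 with h2 | h2
    · exact of_injective h2
    · have h4 := congrArg toWord h2
      simp [toWord_inv, invRev] at h4
  refine ⟨Equiv.ofBijective _ (Finite.injective_iff_bijective.1 hinj),
    fun j => if (l j).2 then 1 else -1, mulAut_ext fun j => ?_⟩
  rw [hl, signedPerm_of, Equiv.ofBijective_apply]
  obtain ⟨a, s⟩ := l j
  cases s <;> simp [mk_true, mk_false]

/-- Nielsen's theorem: compose `φ` with Nielsen moves as long as the complexity drops. Its values
are well ordered, so the process stops, and there the images of the letters are Nielsen reduced and
`φ⁻¹` is a signed permutation. -/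
theorem mulAut_eq_top (E : Subgroup (MulAut (FreeGroup (Fin n))))
    (hs : ∀ σ f, signedPerm σ f ∈ E) (ht : ∀ i j (h : j ≠ i), transv h ∈ E) : E = ⊤ := by
  have hz : ∀ i j (h : j ≠ i) (m : ℤ), substAut i 1 (cogen h ^ m) ∈ E := by
    intro i j h m
    have h1 : substAut i 1 (cogen h ^ m) = transv h ^ m := by
      induction m using Int.induction_on with
      | zero => simp [substAut_one]
      | succ m ih => rw [zpow_add_one, zpow_add_one, ← ih, transv, substAut_mul, one_mul]
      | pred m ih => rw [zpow_sub_one, zpow_sub_one, ← ih, transv, substAut_inv, substAut_mul,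
          inv_one, one_mul]
    rw [h1]
    exact E.zpow_mem (ht i j h) m
  have hz' : ∀ i j (h : j ≠ i) (m : ℤ), substAut i (cogen h ^ m) 1 ∈ E := by
    intro i j h m
    -- Inverting `x_i` exchanges multiplication on the right by `x_j^{-m}` with multiplication on
    -- the left by `x_j^m`.
    have h1 : substAut i (cogen h ^ m) 1 = signedPerm 1 (fun k => if k = i then -1 else 1) *
        substAut i 1 (cogen h ^ (-m)) * signedPerm 1 (fun k => if k = i then -1 else 1) := by
      refine mulAut_ext fun k => ?_
      rw [MulAut.mul_apply, MulAut.mul_apply]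
      by_cases hk : k = i
      · subst hk
        simp [h]
      · simp [hk, substAut_ne hk]
    rw [h1]
    exact mul_mem (mul_mem (hs _ _) (hz _ _ _ _)) (hs _ _)
  have hmove : ∀ y z h, nielsenMove (n := n) y z h ∈ E := by
    intro y z h
    unfold nielsenMove
    by_cases hy : y.2 = true
    · rw [if_pos hy]; exact hz' _ _ h _
    · rw [if_neg hy]; exact hz _ _ h _
  rw [eq_top_iff]
  rintro φ -
  have wf : WellFounded fun φ ψ : MulAut (FreeGroup (Fin n)) => complexity φ < complexity ψ :=
    InvImage.wf complexity wellFounded_lt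
  induction φ using wf.induction with | _ φ ih =>
  by_cases h : ∃ y z h, complexity (φ * nielsenMove y z h) < complexity φ
  · obtain ⟨y, z, h, hlt⟩ := h
    exact (E.mul_mem_cancel_right (hmove y z h)).1 (ih _ hlt)
  · push Not at h
    obtain ⟨σ, f, h1⟩ := exists_signedPerm_of_nielsenReduced φ
      (nielsenReduced_of_minimal φ fun y z hyz => not_lt.2 (h y z hyz))
    rw [← E.inv_mem_iff, h1]
    exact hs σ f

/-! ### The subgroup generated by Magnus's automorphisms and `[IA_n, IA_n]` -/

/-- Magnus's automorphisms `x_i ↦ x_j x_i x_j⁻¹` and `x_i ↦ x_i [x_j, x_k]`. -/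
def magnusSet (n : ℕ) : Set (MulAut (FreeGroup (Fin n))) :=
  {φ | ∃ i j, ∃ h : j ≠ i, φ = substAut i (cogen h) (cogen h)⁻¹} ∪
  {φ | ∃ i j k, ∃ (hj : j ≠ i) (hk : k ≠ i), φ = substAut i 1 ⁅cogen hj, cogen hk⁆}

/-- The subgroup of `IA_n` generated by Magnus's automorphisms and commutators. -/
def magnusSubgroup (n : ℕ) : Subgroup (MulAut (FreeGroup (Fin n))) :=
  Subgroup.closure (magnusSet n) ⊔ ⁅IA n, IA n⁆

theorem substAut_mem_IA {i : Fin n} {u w : cofactor i}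
    (h : cls (u : FreeGroup (Fin n)) + cls (w : FreeGroup (Fin n)) = 0) :
    substAut i u w ∈ IA n := by
  refine mem_IA_of_cls fun j => ?_
  by_cases hj : j = i
  · subst hj
    rw [substAut_self, cls_mul, cls_mul, add_right_comm, h, zero_add]
  · rw [substAut_ne hj]

theorem cls_commutator {G : Subgroup (FreeGroup (Fin n))} (u v : G) :
    cls ((⁅u, v⁆ : G) : FreeGroup (Fin n)) = 0 := by
  simp only [commutatorElement_def, Subgroup.coe_mul, Subgroup.coe_inv, cls_mul, cls_inv]
  abel

theorem magnusSubgroup_le_IA : magnusSubgroup n ≤ IA n := by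
  refine sup_le ((Subgroup.closure_le _).2 ?_) (Subgroup.commutator_le_left _ _)
  rintro _ (⟨i, j, h, rfl⟩ | ⟨i, j, k, hj, hk, rfl⟩)
  · exact substAut_mem_IA (by simp [cls_inv])
  · exact substAut_mem_IA (by rw [cls_commutator]; simp [cls_one])

theorem commutator_le_magnusSubgroup : ⁅IA n, IA n⁆ ≤ magnusSubgroup n := le_sup_right

theorem magnusSet_subset : magnusSet n ⊆ magnusSubgroup n :=
  Subgroup.subset_closure.trans (SetLike.coe_subset_coe.2 le_sup_left)

/-- This is the benefit of including `[IA_n, IA_n]` in the subgroup: conjugation by elements of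
`IA_n` changes `x` only by a commutator. -/
theorem conj_mem_magnusSubgroup {g x : MulAut (FreeGroup (Fin n))} (hg : g ∈ IA n)
    (hx : x ∈ magnusSubgroup n) : g * x * g⁻¹ ∈ magnusSubgroup n := by
  have h : g * x * g⁻¹ = ⁅g, x⁆ * x := by simp [commutatorElement_def]
  rw [h]
  exact mul_mem (commutator_le_magnusSubgroup
    (Subgroup.commutator_mem_commutator hg (magnusSubgroup_le_IA hx))) hx

theorem cofactor_induction {i : Fin n} {p : cofactor i → Prop}
    (gen : ∀ j (h : j ≠ i), p (cogen h)) (one : p 1) (mul : ∀ u v, p u → p v → p (u * v))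
    (inv : ∀ u, p u → p u⁻¹) (u : cofactor i) : p u := by
  obtain ⟨u, hu⟩ := u
  induction hu using Subgroup.closure_induction with
  | mem x hx => obtain ⟨j, hj, rfl⟩ := hx; exact gen j hj
  | one => exact one
  | mul x y hx hy ihx ihy => exact mul _ _ ihx ihy
  | inv x hx ih => exact inv _ ih

theorem substAut_conj_mem {i : Fin n} (u : cofactor i) :
    substAut i u u⁻¹ ∈ magnusSubgroup n := by
  induction u using cofactor_induction with
  | gen j h => exact magnusSet_subset (Or.inl ⟨i, j, h, rfl⟩)
  | one => rw [inv_one, substAut_one]; exact one_mem _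
  | mul u v hu hv =>
    rw [mul_inv_rev, ← substAut_mul]
    exact mul_mem hv hu
  | inv u hu =>
    rw [← substAut_inv]
    exact inv_mem hu

/-- Conjugation by `y` on the letters other than `x_i`, fixing `x_i`. -/
def conjOthers {i : Fin n} (y : cofactor i) : MulAut (FreeGroup (Fin n)) :=
  MulAut.conj (y : FreeGroup (Fin n)) * substAut i y⁻¹ y

theorem conjOthers_mem_IA {i : Fin n} (y : cofactor i) : conjOthers y ∈ IA n :=
  mul_mem (conj_mem_IA _) (substAut_mem_IA (by simp [cls_inv]))

theorem conjOthers_mul {i : Fin n} (y w : cofactor i) :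
    conjOthers y * substAut i 1 w * (conjOthers y)⁻¹ = substAut i 1 (y * w * y⁻¹) := by
  rw [mul_inv_eq_iff_eq_mul]
  refine mulAut_ext fun j => ?_
  rw [MulAut.mul_apply, MulAut.mul_apply, conjOthers, MulAut.mul_apply, MulAut.mul_apply]
  by_cases h : j = i
  · subst h
    simp [substAut_fix _ _ w.2, mul_assoc]
  · simp [substAut_ne h, substAut_fix _ _ y.2]

/-- The conjugation is realised by `conjOthers y`, which fixes `x_i`, conjugates the complementary
factor by `y` and lies in `IA_n`. So the admissible right multipliers `w` are closed under
conjugation in that factor. -/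
theorem substAut_one_conj_mem {i : Fin n} (y : cofactor i) {w : cofactor i}
    (hw : substAut i 1 w ∈ magnusSubgroup n) :
    substAut i 1 (y * w * y⁻¹) ∈ magnusSubgroup n := by
  rw [← conjOthers_mul]
  exact conj_mem_magnusSubgroup (conjOthers_mem_IA y) hw

theorem substAut_one_mul_mem {i : Fin n} {w w' : cofactor i}
    (h : substAut i 1 w ∈ magnusSubgroup n) (h' : substAut i 1 w' ∈ magnusSubgroup n) :
    substAut i 1 (w * w') ∈ magnusSubgroup n := by
  have := mul_mem h h'
  rwa [substAut_mul, one_mul] at this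

theorem substAut_one_inv_mem {i : Fin n} {w : cofactor i}
    (h : substAut i 1 w ∈ magnusSubgroup n) : substAut i 1 w⁻¹ ∈ magnusSubgroup n := by
  have := inv_mem h
  rwa [substAut_inv, inv_one] at this

/-- The admissible right multipliers form a subgroup closed under conjugation, so the identities
expanding `[u u', v]` and `[u⁻¹, v]` reduce the claim to generators, one argument at a time. -/
theorem substAut_commutator_mem {i : Fin n} (u v : cofactor i) :
    substAut i 1 ⁅u, v⁆ ∈ magnusSubgroup n := by
  have key : ∀ v : cofactor i,
      (∀ j (h : j ≠ i), substAut i 1 ⁅cogen h, v⁆ ∈ magnusSubgroup n) →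
      ∀ u : cofactor i, substAut i 1 ⁅u, v⁆ ∈ magnusSubgroup n := by
    intro v hv u
    induction u using cofactor_induction with
    | gen j h => exact hv j h
    | one => rw [commutatorElement_one_left, substAut_one]; exact one_mem _
    | mul u u' hu hu' =>
      rw [show ⁅u * u', v⁆ = u * ⁅u', v⁆ * u⁻¹ * ⁅u, v⁆ by simp only [commutatorElement_def]; group]
      exact substAut_one_mul_mem (substAut_one_conj_mem u hu') hu
    | inv u hu =>
      rw [show ⁅u⁻¹, v⁆ = u⁻¹ * ⁅u, v⁆⁻¹ * u⁻¹⁻¹ by simp only [commutatorElement_def]; group]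
      exact substAut_one_conj_mem u⁻¹ (substAut_one_inv_mem hu)
  refine key v (fun j hj => ?_) u
  rw [← commutatorElement_inv]
  refine substAut_one_inv_mem (key _ (fun k hk => ?_) v)
  exact magnusSet_subset (Or.inr ⟨i, k, j, hk, hj, rfl⟩)

/-- Factor `x_i ↦ p x_i q` as the substitution `x_i ↦ p x_i p⁻¹` composed with right multiplication
of `x_i` by the commutator `p q`. -/
theorem substAut_mem_of_mul_eq {i : Fin n} {p q u v : cofactor i} (h : p * q = ⁅u, v⁆) :
    substAut i p q ∈ magnusSubgroup n := by
  have h1 := mul_mem (substAut_conj_mem p) (substAut_commutator_mem u v)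
  rwa [substAut_mul, ← h, one_mul, inv_mul_cancel_left] at h1

/-! ### Normality -/

theorem mul_substAut {g : MulAut (FreeGroup (Fin n))} {i i' : Fin n}
    (hg : g (FreeGroup.of i) = FreeGroup.of i') (hc : ∀ u ∈ cofactor i, g u ∈ cofactor i')
    (u w : cofactor i) :
    g * substAut i u w * g⁻¹ = substAut i' ⟨g u, hc u u.2⟩ ⟨g w, hc w w.2⟩ := by
  rw [mul_inv_eq_iff_eq_mul]
  refine mulAut_ext fun j => ?_
  rw [MulAut.mul_apply, MulAut.mul_apply]
  by_cases h : j = i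
  · subst h; simp [hg]
  · rw [substAut_ne h, substAut_fix _ _ (hc _ (of_mem_cofactor h))]

theorem mul_substAut_of_inv {g : MulAut (FreeGroup (Fin n))} {i i' : Fin n}
    (hg : g (FreeGroup.of i) = (FreeGroup.of i')⁻¹) (hc : ∀ u ∈ cofactor i, g u ∈ cofactor i')
    (u w : cofactor i) :
    g * substAut i u w * g⁻¹ = substAut i' ⟨g w, hc w w.2⟩⁻¹ ⟨g u, hc u u.2⟩⁻¹ := by
  rw [mul_inv_eq_iff_eq_mul]
  refine mulAut_ext fun j => ?_
  rw [MulAut.mul_apply, MulAut.mul_apply]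
  by_cases h : j = i
  · subst h; simp [hg, mul_assoc]
  · rw [substAut_ne h, substAut_fix _ _ (hc _ (of_mem_cofactor h))]

/-- `g` conjugates the Magnus subgroup into itself if it does so for the generators. -/
theorem magnusSubgroup_conj_le {g : MulAut (FreeGroup (Fin n))}
    (h1 : ∀ i j (h : j ≠ i), g * substAut i (cogen h) (cogen h)⁻¹ * g⁻¹ ∈ magnusSubgroup n)
    (h2 : ∀ i j k (hj : j ≠ i) (hk : k ≠ i),
      g * substAut i 1 ⁅cogen hj, cogen hk⁆ * g⁻¹ ∈ magnusSubgroup n) :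
    ∀ x ∈ magnusSubgroup n, g * x * g⁻¹ ∈ magnusSubgroup n := by
  have h : magnusSubgroup n ≤ (magnusSubgroup n).comap (MulAut.conj g).toMonoidHom := by
    refine sup_le ((Subgroup.closure_le _).2 ?_) fun x hx =>
      commutator_le_magnusSubgroup (Subgroup.Normal.conj_mem inferInstance x hx g)
    rintro _ (⟨i, j, h, rfl⟩ | ⟨i, j, k, hj, hk, rfl⟩)
    · exact h1 i j h
    · exact h2 i j k hj hk
  exact fun x hx => h hx

theorem conj_substAut_mem_of_eq {g : MulAut (FreeGroup (Fin n))} {i i' : Fin n}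
    (hg : g (FreeGroup.of i) = FreeGroup.of i') (hc : ∀ u ∈ cofactor i, g u ∈ cofactor i') :
    (∀ u : cofactor i, g * substAut i u u⁻¹ * g⁻¹ ∈ magnusSubgroup n) ∧
    ∀ u v : cofactor i, g * substAut i 1 ⁅u, v⁆ * g⁻¹ ∈ magnusSubgroup n := by
  refine ⟨fun u => ?_, fun u v => ?_⟩
  · rw [mul_substAut hg hc]
    convert substAut_conj_mem (⟨g u, hc u u.2⟩ : cofactor i') using 2
    ext; simp
  · rw [mul_substAut hg hc]
    refine substAut_mem_of_mul_eq (u := ⟨g u, hc u u.2⟩) (v := ⟨g v, hc v v.2⟩) ?_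
    ext; simp [commutatorElement_def]

theorem conj_substAut_mem_of_eq_inv {g : MulAut (FreeGroup (Fin n))} {i i' : Fin n}
    (hg : g (FreeGroup.of i) = (FreeGroup.of i')⁻¹) (hc : ∀ u ∈ cofactor i, g u ∈ cofactor i') :
    (∀ u : cofactor i, g * substAut i u u⁻¹ * g⁻¹ ∈ magnusSubgroup n) ∧
    ∀ u v : cofactor i, g * substAut i 1 ⁅u, v⁆ * g⁻¹ ∈ magnusSubgroup n := by
  refine ⟨fun u => ?_, fun u v => ?_⟩
  · rw [mul_substAut_of_inv hg hc]
    convert substAut_conj_mem (⟨g u, hc u u.2⟩ : cofactor i') using 2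
    ext; simp
  · rw [mul_substAut_of_inv hg hc]
    refine substAut_mem_of_mul_eq (u := ⟨g v, hc v v.2⟩) (v := ⟨g u, hc u u.2⟩) ?_
    ext; simp [commutatorElement_def, mul_assoc]

theorem signedPerm_conj_mem (σ : Equiv.Perm (Fin n)) (f : Fin n → ℤˣ) :
    ∀ x ∈ magnusSubgroup n, signedPerm σ f * x * (signedPerm σ f)⁻¹ ∈ magnusSubgroup n := by
  have hc : ∀ i, ∀ u ∈ cofactor i, signedPerm σ f u ∈ cofactor (σ i) := by
    intro i u hu
    have h1 : cofactor i ≤ (cofactor (σ i)).comap (signedPerm σ f).toMonoidHom := by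
      refine (Subgroup.closure_le _).2 ?_
      rintro _ ⟨j, hj, rfl⟩
      change signedPerm σ f (FreeGroup.of j) ∈ cofactor (σ i)
      rw [signedPerm_of]
      exact zpow_mem (of_mem_cofactor (σ.injective.ne hj)) _
    exact h1 hu
  have key : ∀ i, (∀ u : cofactor i,
      signedPerm σ f * substAut i u u⁻¹ * (signedPerm σ f)⁻¹ ∈ magnusSubgroup n) ∧
      ∀ u v : cofactor i,
      signedPerm σ f * substAut i 1 ⁅u, v⁆ * (signedPerm σ f)⁻¹ ∈ magnusSubgroup n := by
    intro i
    rcases Int.units_eq_one_or (f i) with h | h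
    · exact conj_substAut_mem_of_eq (by simp [h]) (hc i)
    · exact conj_substAut_mem_of_eq_inv (by simp [h]) (hc i)
  exact magnusSubgroup_conj_le (fun i j h => (key i).1 _) fun i j k hj hk => (key i).2 _ _

/-! ### Conjugation of Magnus's automorphisms by transvections. -/

@[simp] theorem transv_self {a b : Fin n} (h : b ≠ a) :
    transv h (FreeGroup.of a) = FreeGroup.of a * FreeGroup.of b := by
  simp [transv]

theorem transv_ne {a b j : Fin n} (h : b ≠ a) (hj : j ≠ a) :
    transv h (FreeGroup.of j) = FreeGroup.of j := substAut_ne hj _ _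

theorem transv_fix {a b : Fin n} (h : b ≠ a) {u : FreeGroup (Fin n)} (hu : u ∈ cofactor a) :
    transv h u = u := substAut_fix _ _ hu

theorem transv_conj_substAut_self {a b : Fin n} (hab : b ≠ a) (u w : cofactor a) :
    transv hab * substAut a u w * (transv hab)⁻¹ =
      substAut a u (cogen hab * w * (cogen hab)⁻¹) := by
  rw [mul_inv_eq_iff_eq_mul]
  refine mulAut_ext fun j => ?_
  rw [MulAut.mul_apply, MulAut.mul_apply]
  by_cases h : j = a
  · subst h
    simp [transv_fix hab u.2, transv_fix hab w.2, substAut_ne hab, mul_assoc]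
  · rw [substAut_ne h, transv_ne hab h, substAut_ne h]

theorem transv_conj_swap {a b : Fin n} (hab : b ≠ a) :
    transv hab * substAut b (cogen hab.symm) (cogen hab.symm)⁻¹ * (transv hab)⁻¹ =
      substAut b (cogen hab.symm) (cogen hab.symm)⁻¹ * substAut a (cogen hab) (cogen hab)⁻¹ := by
  rw [mul_inv_eq_iff_eq_mul]
  refine mulAut_ext fun j => ?_
  simp only [MulAut.mul_apply]
  by_cases ha : j = a
  · subst ha
    simp [substAut_ne hab, substAut_ne hab.symm]
  · by_cases hb : j = b
    · subst hb
      simp [substAut_ne hab, transv_ne hab hab]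
    · simp [substAut_ne ha, substAut_ne hb, transv_ne hab ha]

theorem transv_conj_third {a b c : Fin n} (hab : b ≠ a) (hca : c ≠ a) (hcb : c ≠ b) :
    transv hab * substAut b (cogen hcb) (cogen hcb)⁻¹ * (transv hab)⁻¹ =
      substAut a 1 ⁅cogen hab, cogen hca⁆ * substAut b (cogen hcb) (cogen hcb)⁻¹ := by
  rw [mul_inv_eq_iff_eq_mul]
  refine mulAut_ext fun j => ?_
  simp only [MulAut.mul_apply]
  by_cases ha : j = a
  · subst ha
    simp [substAut_ne hab, substAut_ne hab.symm, substAut_ne hca, commutatorElement_def,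
      mul_assoc]
  · by_cases hb : j = b
    · subst hb
      simp [substAut_ne hab, substAut_ne hca, transv_ne hab hab, transv_ne hab hca]
    · simp [substAut_ne ha, substAut_ne hb, transv_ne hab ha]

theorem transv_conj_right {a b : Fin n} (hab : b ≠ a) {w : FreeGroup (Fin n)}
    (ha : w ∈ cofactor a) (hb : w ∈ cofactor b) :
    transv hab * substAut b 1 ⟨w, hb⟩ * (transv hab)⁻¹ =
      substAut a 1 (cogen hab * ⟨w, ha⟩⁻¹ * (cogen hab)⁻¹) * substAut b 1 ⟨w, hb⟩ := by
  rw [mul_inv_eq_iff_eq_mul]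
  refine mulAut_ext fun j => ?_
  simp only [MulAut.mul_apply]
  by_cases hj : j = a
  · subst hj
    simp [substAut_ne hab, substAut_ne hab.symm, substAut_fix _ _ ha, mul_assoc]
  · by_cases hj' : j = b
    · subst hj'
      simp [substAut_ne hab, transv_ne hab hab, substAut_fix _ _ ha, transv_fix hab ha]
    · simp [substAut_ne hj, substAut_ne hj', transv_ne hab hj]

/-- The commutator is taken with `x_a⁻¹`, for which the conjugate splits into one substitution at
`x_a` and one at `x_b`, each of the kind covered by `substAut_mem_of_mul_eq`. -/
theorem transv_conj_commutator {a b c : Fin n} (hab : b ≠ a) (hca : c ≠ a) (hcb : c ≠ b) :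
    transv hab * substAut b 1 ⁅cogen hcb, (cogen hab.symm)⁻¹⁆ * (transv hab)⁻¹ =
      substAut a (cogen hca) (cogen hab * (cogen hca)⁻¹ * (cogen hab)⁻¹) *
      substAut b ((cogen hab.symm)⁻¹ * (cogen hcb)⁻¹ * cogen hab.symm) (cogen hcb) := by
  rw [mul_inv_eq_iff_eq_mul]
  refine mulAut_ext fun j => ?_
  simp only [MulAut.mul_apply]
  by_cases ha : j = a
  · subst ha
    simp [substAut_ne hab, substAut_ne hab.symm, substAut_ne hca, mul_assoc]
  · by_cases hb : j = b
    · subst hb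
      simp [substAut_ne hab, substAut_ne hca, transv_ne hab hab, transv_ne hab hca,
        commutatorElement_def, mul_assoc]
    · simp [substAut_ne ha, substAut_ne hb, transv_ne hab ha]

/-- For the transvection `x_a ↦ x_a x_b`, substitutions at a third letter are transported directly
and those at `x_a` stay substitutions at `x_a`. The substance lies in substitutions at `x_b`, above
all those whose multiplier involves `x_a`. -/
theorem transv_conj_mem {a b : Fin n} (hab : b ≠ a) :
    ∀ x ∈ magnusSubgroup n, transv hab * x * (transv hab)⁻¹ ∈ magnusSubgroup n := by
  have hgen : ∀ i, i ≠ a → i ≠ b → ∀ u ∈ cofactor i, transv hab u ∈ cofactor i := by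
    intro i ha hb u hu
    refine map_mem_cofactor (φ := (transv hab).toMonoidHom) (fun j hj => ?_) hu
    change transv hab (FreeGroup.of j) ∈ cofactor i
    by_cases hja : j = a
    · subst hja
      rw [transv_self]
      exact mul_mem (of_mem_cofactor hj) (of_mem_cofactor hb.symm)
    · rw [transv_ne hab hja]
      exact of_mem_cofactor hj
  have hbac : ∀ c (hcb : c ≠ b), transv hab * substAut b 1 ⁅cogen hab.symm, cogen hcb⁆ *
      (transv hab)⁻¹ ∈ magnusSubgroup n := by
    intro c hcb
    by_cases hca : c = a
    · subst hca
      rw [commutatorElement_self, substAut_one, mul_one, mul_inv_cancel]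
      exact one_mem _
    · have h1 : transv hab * substAut b 1 ⁅cogen hcb, (cogen hab.symm)⁻¹⁆ * (transv hab)⁻¹ ∈
          magnusSubgroup n := by
        rw [transv_conj_commutator hab hca hcb]
        refine mul_mem (substAut_mem_of_mul_eq (u := cogen hca) (v := cogen hab) ?_)
          (substAut_mem_of_mul_eq (u := (cogen hab.symm)⁻¹) (v := (cogen hcb)⁻¹) ?_)
        · simp [commutatorElement_def, mul_assoc]
        · simp [commutatorElement_def, mul_assoc]
      -- Conjugating `[x_c, x_a⁻¹]` by `x_a` gives `[x_a, x_c]`. The two substitutions thus differ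
      -- by conjugation by an element of `IA_n`, which is harmless since `IA_n` is normal.
      have h2 : conjOthers (cogen hab.symm) * substAut b 1 ⁅cogen hcb, (cogen hab.symm)⁻¹⁆ *
          (conjOthers (cogen hab.symm))⁻¹ = substAut b 1 ⁅cogen hab.symm, cogen hcb⁆ := by
        rw [conjOthers_mul]
        congr 1
        simp [commutatorElement_def, mul_assoc]
      have h3 := conj_mem_magnusSubgroup (g := transv hab * conjOthers (cogen hab.symm) *
        (transv hab)⁻¹) (Subgroup.Normal.conj_mem inferInstance _ (conjOthers_mem_IA _) _) h1
      rw [← h2]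
      convert h3 using 1
      group
  refine magnusSubgroup_conj_le (fun i j h => ?_) fun i j k hj hk => ?_
  · by_cases ha : i = a
    · subst ha
      rw [transv_conj_substAut_self]
      refine substAut_mem_of_mul_eq (u := cogen h) (v := cogen hab) ?_
      simp [commutatorElement_def, mul_assoc]
    · by_cases hb : i = b
      · subst hb
        by_cases hja : j = a
        · subst hja
          rw [transv_conj_swap]
          exact mul_mem (substAut_conj_mem _) (substAut_conj_mem _)
        · rw [transv_conj_third hab hja h]
          exact mul_mem (substAut_commutator_mem _ _) (substAut_conj_mem _)
      · exact (conj_substAut_mem_of_eq (transv_ne hab ha) (hgen i ha hb)).1 _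
  · by_cases ha : i = a
    · subst ha
      rw [transv_conj_substAut_self]
      exact substAut_one_conj_mem _ (substAut_commutator_mem _ _)
    · by_cases hb : i = b
      · subst hb
        by_cases hja : j = a
        · subst hja
          exact hbac k hk
        · by_cases hka : k = a
          · subst hka
            have h1 := inv_mem (hbac j hj)
            rw [← commutatorElement_inv (cogen hk) (cogen hj)]
            rw [mul_inv_rev, mul_inv_rev, inv_inv, substAut_inv, inv_one, ← mul_assoc] at h1
            exact h1
          · have hw : ∀ {i} (hj : j ≠ i) (hk : k ≠ i),
                ⁅FreeGroup.of j, FreeGroup.of k⁆ ∈ cofactor i := fun hj hk =>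
              (⁅cogen hj, cogen hk⁆ : cofactor _).2
            have h1 := transv_conj_right hab (hw hja hka) (hw hj hk)
            have h2 : (⟨⁅FreeGroup.of j, FreeGroup.of k⁆, hw hja hka⟩ : cofactor a) =
              ⁅cogen hja, cogen hka⁆ := rfl
            have h3 : (⟨⁅FreeGroup.of j, FreeGroup.of k⁆, hw hj hk⟩ : cofactor i) =
              ⁅cogen hj, cogen hk⁆ := rfl
            rw [h2, h3] at h1
            rw [h1]
            exact mul_mem (substAut_one_conj_mem _ (substAut_one_inv_mem
              (substAut_commutator_mem _ _))) (substAut_commutator_mem _ _)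
      · exact (conj_substAut_mem_of_eq (transv_ne hab ha) (hgen i ha hb)).2 _ _

/-- The inverse of a transvection is its conjugate by the sign change of `x_b`. -/
theorem transv_inv {a b : Fin n} (hab : b ≠ a) : (transv hab)⁻¹ =
    signedPerm 1 (fun k => if k = b then -1 else 1) * transv hab *
      signedPerm 1 (fun k => if k = b then -1 else 1) := by
  rw [transv, substAut_inv]
  refine mulAut_ext fun j => ?_
  simp only [MulAut.mul_apply]
  by_cases ha : j = a
  · subst ha
    simp [hab.symm]
  · by_cases hb : j = b
    · subst hb; simp [substAut_ne hab]
    · simp [substAut_ne ha, hb]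

instance magnusSubgroup_normal : (magnusSubgroup n).Normal := by
  -- Conjugating a subgroup into itself is not obviously stable under inverses. `E` is therefore cut
  -- out by asking it of `g` and of `g⁻¹`; for generators, inverses are again expressed through
  -- elements already known to lie in `S`.
  let S : Submonoid (MulAut (FreeGroup (Fin n))) :=
    { carrier := {g | ∀ x ∈ magnusSubgroup n, g * x * g⁻¹ ∈ magnusSubgroup n}
      one_mem' := by simp
      mul_mem' := fun {g h} hg hh x hx => by
        have := hg _ (hh x hx)
        rwa [show g * (h * x * h⁻¹) * g⁻¹ = g * h * x * (g * h)⁻¹ by group] at this }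
  let E : Subgroup (MulAut (FreeGroup (Fin n))) :=
    { carrier := {g | g ∈ S ∧ g⁻¹ ∈ S}
      one_mem' := ⟨S.one_mem, by simp [S.one_mem]⟩
      mul_mem' := fun {g h} hg hh =>
        ⟨S.mul_mem hg.1 hh.1, by rw [mul_inv_rev]; exact S.mul_mem hh.2 hg.2⟩
      inv_mem' := fun {g} hg => ⟨hg.2, by rw [inv_inv]; exact hg.1⟩ }
  have hs : ∀ σ f, signedPerm (n := n) σ f ∈ S := fun σ f => signedPerm_conj_mem σ f
  have hE : E = ⊤ := by
    refine mulAut_eq_top E (fun σ f => ⟨hs σ f, ?_⟩) fun i j h => ⟨transv_conj_mem h, ?_⟩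
    · have h1 : (signedPerm σ f)⁻¹ = signedPerm σ⁻¹ fun i => f (σ⁻¹ i) := by
        rw [inv_eq_iff_mul_eq_one, signedPerm_mul, mul_inv_cancel, ← signedPerm_one]
        congr 1
        funext i
        exact Int.units_mul_self _
      rw [h1]
      exact hs _ _
    · rw [transv_inv]
      exact S.mul_mem (S.mul_mem (hs _ _) (transv_conj_mem h)) (hs _ _)
  refine ⟨fun x hx g => ?_⟩
  have : g ∈ E := hE ▸ Subgroup.mem_top g
  exact this.1 x hx

end OutFree

/-! ### Peak reduction for the elementary relations of `GL(n, ℤ)` -/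

/-- Elements `e i j` and `s σ f` of a group that satisfy the elementary relations between
transvections and signed permutation matrices, with an action on `ℤ^ι` by these matrices. -/
structure SteinbergSystem (ι Q : Type*) [DecidableEq ι] [Group Q] where
  e : ι → ι → Q
  s : Equiv.Perm ι → (ι → ℤˣ) → Q
  act : Q →* Module.End ℤ (ι → ℤ)
  comm : ∀ i j k l, i ≠ j → k ≠ l → j ≠ k → l ≠ i → Commute (e i j) (e k l)
  chain : ∀ i j k, i ≠ j → j ≠ k → i ≠ k → e i j * e j k = e j k * e i j * (e i k)⁻¹
  weyl : ∀ i j, i ≠ j → e i j * (e j i)⁻¹ * e i j =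
    s (Equiv.swap i j) (fun k => if k = j then -1 else 1)
  s_mul : ∀ σ τ f g, s σ f * s τ g = s (σ * τ) (fun i => f (τ i) * g i)
  s_one : s 1 (fun _ => 1) = 1
  s_e : ∀ σ f i j, i ≠ j → s σ f * e i j = e (σ i) (σ j) ^ ((f i * f j : ℤˣ) : ℤ) * s σ f
  act_e : ∀ i j, i ≠ j → ∀ v k, act (e i j) v k = if k = j then v j + v i else v k
  act_s : ∀ σ f v i, act (s σ f) v (σ i) = f i * v i

namespace SteinbergSystem

/-- The signed permutation `(σ, f)` only involves the indices in `A`. -/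
def SuppIn {ι : Type*} (A : Finset ι) (σ : Equiv.Perm ι) (f : ι → ℤˣ) : Prop := ∀ i ∉ A, σ i = i ∧ f i = 1

theorem SuppIn.mul {ι : Type*} {A : Finset ι} {σ τ : Equiv.Perm ι} {f g : ι → ℤˣ} (h : SuppIn A σ f)
    (h' : SuppIn A τ g) : SuppIn A (σ * τ) (fun i => f (τ i) * g i) := fun i hi => by
  simp [(h' i hi).1, (h' i hi).2, (h i hi).1, (h i hi).2]

theorem SuppIn.inv {ι : Type*} {A : Finset ι} {σ : Equiv.Perm ι} {f : ι → ℤˣ} (h : SuppIn A σ f) :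
    SuppIn A σ⁻¹ (fun i => f (σ⁻¹ i)) := fun i hi => by
  have h1 : σ⁻¹ i = i := by rw [Equiv.Perm.inv_eq_iff_eq, (h i hi).1]
  simp only [h1, (h i hi).2, and_self]

theorem SuppIn.apply_mem {ι : Type*} {A : Finset ι} {σ : Equiv.Perm ι} {f : ι → ℤˣ} (h : SuppIn A σ f)
    {i : ι} (hi : i ∈ A) : σ i ∈ A := by
  by_contra hcon
  have := σ.injective (h _ hcon).1
  exact hcon (by rwa [this])

variable {ι Q : Type*} [DecidableEq ι] [Group Q] (S : SteinbergSystem ι Q)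

/-- The generators `e i j ^ ε` with `ε = ±1`. -/
def E (i j : ι) (ε : ℤˣ) : Q := S.e i j ^ (ε : ℤ)

theorem E_one (i j : ι) : S.E i j 1 = S.e i j := by simp [E]

theorem E_neg (i j : ι) (ε : ℤˣ) : S.E i j (-ε) = (S.E i j ε)⁻¹ := by simp [E]

theorem E_comm {i j k l : ι} (hij : i ≠ j) (hkl : k ≠ l) (hjk : j ≠ k) (hli : l ≠ i) (ε δ : ℤˣ) :
    S.E i j ε * S.E k l δ = S.E k l δ * S.E i j ε :=
  ((S.comm i j k l hij hkl hjk hli).zpow_zpow _ _).eq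

theorem E_chain {i j k : ι} (hij : i ≠ j) (hjk : j ≠ k) (hik : i ≠ k) (ε δ : ℤˣ) :
    S.E j k δ * S.E i j ε = S.E i j ε * S.E i k (ε * δ) * S.E j k δ := by
  have c1 := S.comm i k j k hik hjk hjk.symm hik.symm
  have c2 := S.comm i j i k hij hik hij.symm hik.symm
  have h1 : S.e j k * S.e i j * (S.e j k)⁻¹ = S.e i j * S.e i k := by
    rw [mul_inv_eq_iff_eq_mul, mul_assoc, c1.eq, ← mul_assoc, S.chain i j k hij hjk hik]
    group
  have h2 : (S.e j k)⁻¹ * S.e i j * S.e j k = S.e i j * (S.e i k)⁻¹ := by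
    rw [mul_assoc, S.chain i j k hij hjk hik]
    group
  have h3 : ∀ δ : ℤˣ, S.E j k δ * S.e i j * (S.E j k δ)⁻¹ = S.e i j * S.E i k δ := by
    intro δ
    rcases Int.units_eq_one_or δ with rfl | rfl
    · simpa [E] using h1
    · simpa [E] using h2
  rw [← mul_inv_eq_iff_eq_mul, E, E, ← MulAut.conj_apply, map_zpow, MulAut.conj_apply,
    show S.e j k ^ (δ : ℤ) = S.E j k δ from rfl, h3, E, (c2.zpow_right _).mul_zpow, ← zpow_mul,
    E, Units.val_mul, mul_comm (ε : ℤ)]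

theorem E_chain' {i j k : ι} (hij : i ≠ j) (hjk : j ≠ k) (hik : i ≠ k) (ε δ : ℤˣ) :
    S.E i j ε * S.E j k δ = S.E j k δ * (S.E i k (-(ε * δ)) * S.E i j ε) := by
  rw [E_comm S hik hij hik.symm hij.symm, ← mul_assoc, E_chain S hij hjk hik, mul_assoc, mul_assoc,
    E_comm S hjk hik hik.symm hjk.symm, ← mul_assoc (S.E i k (ε * δ)), E_neg, mul_inv_cancel,
    one_mul]

theorem s_E (σ : Equiv.Perm ι) (f : ι → ℤˣ) {i j : ι} (hij : i ≠ j) (ε : ℤˣ) :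
    S.s σ f * S.E i j ε = S.E (σ i) (σ j) (f i * f j * ε) * S.s σ f := by
  rw [← mul_inv_eq_iff_eq_mul, E, ← MulAut.conj_apply, map_zpow, MulAut.conj_apply,
    S.s_e σ f i j hij, mul_inv_cancel_right, ← zpow_mul, E, Units.val_mul (f i * f j)]

theorem s_inv (σ : Equiv.Perm ι) (f : ι → ℤˣ) :
    (S.s σ f)⁻¹ = S.s σ⁻¹ (fun i => f (σ⁻¹ i)) := by
  rw [inv_eq_iff_mul_eq_one, S.s_mul, mul_inv_cancel, ← S.s_one]
  congr 1
  funext i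
  exact Int.units_mul_self _

theorem act_E {i j : ι} (hij : i ≠ j) (ε : ℤˣ) (v : ι → ℤ) (k : ι) :
    S.act (S.E i j ε) v k = if k = j then v j + ε * v i else v k := by
  rcases Int.units_eq_one_or ε with rfl | rfl
  · simp [E_one, S.act_e i j hij]
  · have h : S.act (S.e i j) (S.act (S.e i j)⁻¹ v) = v := by
      rw [← Module.End.mul_apply, ← map_mul, mul_inv_cancel, map_one, Module.End.one_apply]
    rw [E_neg, E_one]
    generalize S.act (S.e i j)⁻¹ v = w at *
    subst h
    simp only [S.act_e i j hij]
    by_cases hk : k = j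
    · subst hk; simp [hij]
    · simp [hk]

theorem exists_weyl {A : Finset ι} {i j : ι} (hi : i ∈ A) (hj : j ∈ A) (hij : i ≠ j) (ε : ℤˣ) :
    ∃ σ f, SuppIn A σ f ∧ S.E i j ε * S.E j i (-ε) * S.E i j ε = S.s σ f := by
  have h1 : SuppIn A (Equiv.swap i j) (fun k => if k = j then -1 else 1) := by
    intro k hk
    have hki : k ≠ i := fun h => hk (h ▸ hi)
    have hkj : k ≠ j := fun h => hk (h ▸ hj)
    simp [Equiv.swap_apply_of_ne_of_ne hki hkj, hkj]
  have h2 := S.weyl i j hij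
  rcases Int.units_eq_one_or ε with rfl | rfl
  · refine ⟨_, _, h1, ?_⟩
    rw [E_neg, E_one, E_one, h2]
  · refine ⟨_, _, h1.inv, Eq.trans ?_
      (S.s_inv (Equiv.swap i j) (fun k => if k = j then -1 else 1))⟩
    rw [← h2, neg_neg, E_neg, E_one, E_one]
    group

/-- The subgroup generated by the elements with indices in `A`. -/
def elem (A : Finset ι) : Subgroup Q :=
  Subgroup.closure ({q | ∃ i ∈ A, ∃ j ∈ A, i ≠ j ∧ q = S.e i j} ∪
    {q | ∃ σ f, SuppIn A σ f ∧ q = S.s σ f})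

/-- The subgroup of `elem A` generated by the obvious elements that fix the `a`-th vector. -/
def stab (A : Finset ι) (a : ι) : Subgroup Q :=
  Subgroup.closure ({q | ∃ i ∈ A.erase a, ∃ j ∈ A, i ≠ j ∧ q = S.e i j} ∪
    {q | ∃ σ f, SuppIn (A.erase a) σ f ∧ q = S.s σ f})

/-- The move `e i j ^ ε` subtracts the coordinate `v i`, in absolute value, from `v j`. -/
structure Allowed (A : Finset ι) (v : ι → ℤ) (i j : ι) (ε : ℤˣ) : Prop where
  left_mem : i ∈ A
  right_mem : j ∈ A
  ne : i ≠ j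
  ne_zero : v i ≠ 0
  abs : (v j + ε * v i).natAbs + (v i).natAbs = (v j).natAbs

/-- The cosets that are connected to the standard ones by a chain of decreasing moves. -/
inductive Descends (A : Finset ι) (a : ι) : Q ⧸ S.stab A a → (ι → ℤ) → Prop
  | base (σ : Equiv.Perm ι) (f : ι → ℤˣ) (h : SuppIn A σ f) :
    Descends A a ((S.s σ f : Q) : Q ⧸ S.stab A a) (S.act (S.s σ f) (Pi.single a 1))
  | step (i j : ι) (ε : ℤˣ) (p : Q ⧸ S.stab A a) (v : ι → ℤ) (h : Allowed A v i j ε)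
    (hp : Descends A a (S.E i j ε • p) (S.act (S.E i j ε) v)) : Descends A a p v

variable {S} {A : Finset ι} {a : ι}

theorem E_mem_stab {i j : ι} (hi : i ∈ A) (hia : i ≠ a) (hj : j ∈ A) (hij : i ≠ j) (ε : ℤˣ) :
    S.E i j ε ∈ S.stab A a := by
  unfold E
  refine Subgroup.zpow_mem _ ?_ _
  exact Subgroup.subset_closure (Or.inl ⟨i, Finset.mem_erase.2 ⟨hia, hi⟩, j, hj, hij, rfl⟩)

theorem act_s_single (σ : Equiv.Perm ι) (f : ι → ℤˣ) (k : ι) :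
    S.act (S.s σ f) (Pi.single a 1) k = if k = σ a then (f a : ℤ) else 0 := by
  obtain ⟨k, rfl⟩ := σ.surjective k
  rw [S.act_s]
  by_cases h : k = a
  · subst h; simp
  · simp [h]

/-- Moves with a vanishing coefficient act trivially. -/
theorem Descends.smul_eq {p : Q ⧸ S.stab A a} {v : ι → ℤ} (h : S.Descends A a p v) {i j : ι}
    (hi : i ∈ A) (hj : j ∈ A) (hij : i ≠ j) (h0 : v i = 0) (ε : ℤˣ) : S.E i j ε • p = p := by
  induction h generalizing i j ε with
  | base σ f hσ =>
    rw [act_s_single] at h0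
    have hia : i ≠ σ a := by
      rintro rfl
      simp at h0
    have hi' := hσ.inv.apply_mem hi
    have hj' := hσ.inv.apply_mem hj
    have hij' : σ⁻¹ i ≠ σ⁻¹ j := (σ⁻¹).injective.ne hij
    have h1 := S.s_E σ f hij' (f (σ⁻¹ i) * f (σ⁻¹ j) * ε)
    rw [show σ (σ⁻¹ i) = i from σ.apply_symm_apply i,
      show σ (σ⁻¹ j) = j from σ.apply_symm_apply j, ← mul_assoc, Int.units_mul_self, one_mul] at h1
    rw [MulAction.Quotient.smul_coe, smul_eq_mul, ← h1]
    refine QuotientGroup.mk_mul_of_mem _ (E_mem_stab hi' (fun h => hia ?_) hj' hij' _)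
    rw [← h]
    exact (σ.apply_symm_apply i).symm
  | step k l δ p v hk hp ih =>
    have hik : i ≠ k := by
      rintro rfl
      exact hk.ne_zero h0
    have hil : i ≠ l := by
      rintro rfl
      have h1 := hk.abs
      have h2 := hk.ne_zero
      rw [h0] at h1
      omega
    have h0' : S.act (S.E k l δ) v i = 0 := by rw [S.act_E hk.ne, if_neg hil, h0]
    apply smul_left_cancel (S.E k l δ)
    -- Move `E i j ε` past the first step of the descending path. If `j = k` the chain relation
    -- creates an extra factor `E i l`, which also starts at the vanishing coordinate `i`, so the
    -- induction hypothesis absorbs it too.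
    by_cases hjk : j = k
    · subst hjk
      rw [smul_smul, S.E_chain hij hk.ne hil, mul_smul, ← smul_smul,
        ih hi hk.right_mem hil h0', ih hi hj hij h0']
    · rw [smul_smul, ← S.E_comm hij hk.ne hjk hil.symm, mul_smul, ih hi hj hij h0']

theorem act_E_eq_self {i j : ι} (hij : i ≠ j) {v : ι → ℤ} (h0 : v i = 0) (ε : ℤˣ) :
    S.act (S.E i j ε) v = v := by
  funext k
  rw [S.act_E hij]
  split_ifs with h
  · subst h; simp [h0]
  · rfl

theorem Descends.s_smul {p : Q ⧸ S.stab A a} {v : ι → ℤ} (h : S.Descends A a p v)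
    {σ : Equiv.Perm ι} {f : ι → ℤˣ} (hσ : SuppIn A σ f) :
    S.Descends A a (S.s σ f • p) (S.act (S.s σ f) v) := by
  induction h with
  | base τ g hτ =>
    rw [← Module.End.mul_apply, ← map_mul, MulAction.Quotient.smul_coe, smul_eq_mul, S.s_mul]
    exact .base _ _ (hσ.mul hτ)
  | step i j ε p v h hp ih =>
    have e1 := S.s_E σ f h.ne ε
    refine .step (σ i) (σ j) (f i * f j * ε) _ _ ⟨hσ.apply_mem h.left_mem,
      hσ.apply_mem h.right_mem, σ.injective.ne h.ne, ?_, ?_⟩ ?_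
    · rw [S.act_s]
      exact mul_ne_zero (Units.ne_zero _) h.ne_zero
    · have h1 := h.abs
      rw [S.act_s, S.act_s]
      rcases Int.units_eq_one_or (f i) with h2 | h2 <;>
        rcases Int.units_eq_one_or (f j) with h3 | h3 <;> simp [h2, h3] <;> omega
    · rw [smul_smul, ← Module.End.mul_apply, ← map_mul, ← e1, map_mul, Module.End.mul_apply,
        mul_smul]
      exact ih

/-- The sum of the absolute values of the coordinates. -/
def height [Fintype ι] (v : ι → ℤ) : ℕ := ∑ i, (v i).natAbs

theorem Allowed.height_lt [Fintype ι] {v : ι → ℤ} {i j : ι} {ε : ℤˣ} (h : Allowed A v i j ε) :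
    height (S.act (S.E i j ε) v) < height v := by
  refine Finset.sum_lt_sum (fun k _ => ?_) ⟨j, Finset.mem_univ _, ?_⟩
  · rw [S.act_E h.ne]
    have := h.abs
    split_ifs with hk
    · subst hk; omega
    · rfl
  · rw [S.act_E h.ne, if_pos rfl]
    have := h.abs
    have := h.ne_zero
    omega

/-! ### Local confluence of decreasing moves, and uniqueness of the coset over a vector. -/

section PeakReduction

variable {p : Q ⧸ S.stab A a} {v : ι → ℤ}

theorem smul_act_mul (q q' : Q) : S.Descends A a (q • q' • p) (S.act q (S.act q' v)) ↔
    S.Descends A a ((q * q') • p) (S.act (q * q') v) := by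
  rw [smul_smul, map_mul, Module.End.mul_apply]

theorem Descends.of_smul_inv (hd : S.Descends A a p v) {i j : ι} {ε : ℤˣ}
    (h : Allowed A (S.act (S.E i j ε) v) i j (-ε)) :
    S.Descends A a (S.E i j ε • p) (S.act (S.E i j ε) v) := by
  refine .step i j (-ε) _ _ h ?_
  rw [smul_act_mul, S.E_neg, inv_mul_cancel, one_smul, map_one, Module.End.one_apply]
  exact hd

/-- Both moves can decrease only if `|v i| = |v j|`. After the first, coordinate `j` is zero, so `E
j i (-δ)` acts trivially there, and the Weyl relation says that the two results differ by a signed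
permutation. -/
theorem peak_opposite {i j : ι} {ε δ : ℤˣ}
    (h0 : Allowed A v i j ε) (h : Allowed A v j i δ)
    (hd : S.Descends A a (S.E i j ε • p) (S.act (S.E i j ε) v)) :
    S.Descends A a (S.E j i δ • p) (S.act (S.E j i δ) v) := by
  obtain ⟨a1, a2, a3, a4, a5⟩ := h0
  obtain ⟨b1, b2, b3, b4, b5⟩ := h
  obtain rfl : δ = ε := by
    rcases Int.units_eq_one_or ε with rfl | rfl <;> rcases Int.units_eq_one_or δ with rfl | rfl <;>
      simp at * <;> omega
  have hz : S.act (S.E i j δ) v j = 0 := by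
    rw [S.act_E a3, if_pos rfl]
    omega
  obtain ⟨σ, f, hσ, hw⟩ := S.exists_weyl a2 a1 b3 δ
  have e1 : S.E j i δ = S.s σ f * (S.E j i (-δ) * S.E i j δ) := by
    rw [← hw, S.E_neg, S.E_neg]
    group
  have d1 : S.Descends A a (S.E j i (-δ) • S.E i j δ • p)
      (S.act (S.E j i (-δ)) (S.act (S.E i j δ) v)) := by
    rw [hd.smul_eq a2 a1 b3 hz, act_E_eq_self b3 hz]
    exact hd
  rw [e1, ← smul_act_mul, mul_smul, map_mul,
    Module.End.mul_apply]
  exact d1.s_smul hσ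

variable [Fintype ι]

/-- Decreasing moves can be applied below a given height. -/
def Confluent (S : SteinbergSystem ι Q) (A : Finset ι) (a : ι) (N : ℕ) : Prop :=
  ∀ p v, height v < N → S.Descends A a p v → ∀ i j ε, Allowed A v i j ε →
    S.Descends A a (S.E i j ε • p) (S.act (S.E i j ε) v)

theorem Confluent.peak_comm (IH : Confluent S A a (height v)) {i j k l : ι} {ε δ : ℤˣ}
    (h0 : Allowed A v k l δ) (h : Allowed A v i j ε) (hjk : j ≠ k) (hli : l ≠ i)
    (hlj : Allowed A (S.act (S.E k l δ) v) i j ε) (hjl : Allowed A (S.act (S.E i j ε) v) k l δ)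
    (hd : S.Descends A a (S.E k l δ • p) (S.act (S.E k l δ) v)) :
    S.Descends A a (S.E i j ε • p) (S.act (S.E i j ε) v) := by
  refine .step k l δ _ _ hjl ?_
  rw [smul_act_mul, ← S.E_comm h.ne h0.ne hjk hli, ← smul_act_mul]
  exact IH _ _ h0.height_lt hd i j ε hlj

theorem Confluent.peak_disjoint (IH : Confluent S A a (height v)) {i j k l : ι} {ε δ : ℤˣ}
    (h0 : Allowed A v k l δ) (h : Allowed A v i j ε) (hjk : j ≠ k) (hli : l ≠ i) (hlj : l ≠ j)
    (hd : S.Descends A a (S.E k l δ • p) (S.act (S.E k l δ) v)) :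
    S.Descends A a (S.E i j ε • p) (S.act (S.E i j ε) v) := by
  refine IH.peak_comm h0 h hjk hli ⟨h.left_mem, h.right_mem, h.ne, ?_, ?_⟩
    ⟨h0.left_mem, h0.right_mem, h0.ne, ?_, ?_⟩ hd
  · rw [S.act_E h0.ne, if_neg hli.symm]; exact h.ne_zero
  · rw [S.act_E h0.ne, S.act_E h0.ne, if_neg hli.symm, if_neg hlj.symm]; exact h.abs
  · rw [S.act_E h.ne, if_neg hjk.symm]; exact h0.ne_zero
  · rw [S.act_E h.ne, S.act_E h.ne, if_neg hjk.symm, if_neg hlj]; exact h0.abs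

/-- By the chain relation, `E i j ε * E j l δ` is also reached from `E i j ε` through `E i l (-(ε *
δ))` and then `E j l δ`. The whole detour starts below the height of `v`, where confluence is known.
-/
theorem Confluent.peak_chain (IH : Confluent S A a (height v)) {i j l : ι} {ε δ : ℤˣ}
    (h0 : Allowed A v i j ε) (h : Allowed A v j l δ) (hil : i ≠ l)
    (hd : S.Descends A a (S.E i j ε • p) (S.act (S.E i j ε) v)) :
    S.Descends A a (S.E j l δ • p) (S.act (S.E j l δ) v) := by
  obtain ⟨a1, a2, a3, a4, a5⟩ := h0
  obtain ⟨b1, b2, b3, b4, b5⟩ := h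
  have h0 : Allowed A v i j ε := ⟨a1, a2, a3, a4, a5⟩
  have e1 : Allowed A (S.act (S.E i j ε) v) i l (-(ε * δ)) := by
    refine ⟨a1, b2, hil, ?_, ?_⟩ <;> simp only [S.act_E a3, if_neg a3, if_neg b3.symm]
    · exact a4
    · rcases Int.units_eq_one_or ε with rfl | rfl <;> rcases Int.units_eq_one_or δ with rfl | rfl <;>
        simp at * <;> omega
  have d1 := IH _ _ h0.height_lt hd _ _ _ e1
  have lt1 := (e1.height_lt (S := S)).trans h0.height_lt
  have d2 : S.Descends A a (S.E j l δ • S.E i l (-(ε * δ)) • S.E i j ε • p)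
      (S.act (S.E j l δ) (S.act (S.E i l (-(ε * δ))) (S.act (S.E i j ε) v))) := by
    -- Coordinate `j` may have been used up by the first move; then `E j l δ` fixes both the coset
    -- and the vector instead of being an allowed move.
    by_cases hz : S.act (S.E i l (-(ε * δ))) (S.act (S.E i j ε) v) j = 0
    · rw [d1.smul_eq a2 b2 b3 hz, act_E_eq_self b3 hz]
      exact d1
    · refine IH _ _ lt1 d1 _ _ _ ⟨a2, b2, b3, hz, ?_⟩
      simp only [S.act_E a3, S.act_E hil, if_neg a3, if_neg b3.symm, if_neg b3, if_true] at hz ⊢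
      rcases Int.units_eq_one_or ε with rfl | rfl <;> rcases Int.units_eq_one_or δ with rfl | rfl <;>
        simp at * <;> omega
  refine .step i j ε _ _ ⟨a1, a2, a3, ?_, ?_⟩ ?_
  · rw [S.act_E b3, if_neg hil]; exact a4
  · rw [S.act_E b3, S.act_E b3, if_neg hil, if_neg b3]; exact a5
  · rw [smul_act_mul, S.E_chain' a3 b3 hil, ← smul_act_mul, mul_smul, map_mul,
    Module.End.mul_apply]
    exact d2

theorem Confluent.peak_chain_symm (IH : Confluent S A a (height v)) {i j l : ι} {ε δ : ℤˣ}
    (h : Allowed A v i j ε) (h0 : Allowed A v j l δ) (hil : i ≠ l)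
    (hd : S.Descends A a (S.E j l δ • p) (S.act (S.E j l δ) v)) :
    S.Descends A a (S.E i j ε • p) (S.act (S.E i j ε) v) := by
  obtain ⟨a1, a2, a3, a4, a5⟩ := h
  obtain ⟨b1, b2, b3, b4, b5⟩ := h0
  have h0 : Allowed A v j l δ := ⟨b1, b2, b3, b4, b5⟩
  have d1 : S.Descends A a (S.E i j ε • S.E j l δ • p) (S.act (S.E i j ε) (S.act (S.E j l δ) v)) := by
    refine IH _ _ h0.height_lt hd _ _ _ ⟨a1, a2, a3, ?_, ?_⟩
    · rw [S.act_E b3, if_neg hil]; exact a4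
    · rw [S.act_E b3, S.act_E b3, if_neg hil, if_neg b3]; exact a5
  rw [smul_act_mul, S.E_chain' a3 b3 hil, ← smul_act_mul, mul_smul, map_mul,
    Module.End.mul_apply] at d1
  refine .step i l (-(ε * δ)) _ _ ⟨a1, b2, hil, ?_, ?_⟩ ?_
  · rw [S.act_E a3, if_neg a3]; exact a4
  · simp only [S.act_E a3, if_neg a3, if_neg b3.symm]
    rcases Int.units_eq_one_or ε with rfl | rfl <;> rcases Int.units_eq_one_or δ with rfl | rfl <;>
      simp at * <;> omega
  by_cases hz : S.act (S.E i l (-(ε * δ))) (S.act (S.E i j ε) v) j = 0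
  · have d2 := d1.smul_eq a2 b2 b3 (by rw [act_E_eq_self b3 hz]; exact hz) (-δ)
    rw [S.E_neg, inv_smul_smul] at d2
    rw [act_E_eq_self b3 hz, ← d2] at d1
    exact d1
  · refine .step j l δ _ _ ⟨a2, b2, b3, hz, ?_⟩ d1
    simp only [S.act_E a3, S.act_E hil, if_neg a3, if_neg b3.symm, if_neg b3, if_true] at hz ⊢
    rcases Int.units_eq_one_or ε with rfl | rfl <;> rcases Int.units_eq_one_or δ with rfl | rfl <;>
      simp at * <;> omega

/-- If both subtractions from `v j` fit together, they commute. Otherwise `ε * v i` and `δ * v k`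
still have the same sign, so the smaller can be subtracted from the larger. That third move shares a
source with one of the given moves and forms a chain with the other, so it links two peaks already
treated. -/
theorem Confluent.peak_target (IH : Confluent S A a (height v)) {i j k : ι} {ε δ : ℤˣ}
    (h0 : Allowed A v i j ε) (h : Allowed A v k j δ) (hik : i ≠ k)
    (hd : S.Descends A a (S.E i j ε • p) (S.act (S.E i j ε) v)) :
    S.Descends A a (S.E k j δ • p) (S.act (S.E k j δ) v) := by
  obtain ⟨a1, a2, a3, a4, a5⟩ := id h0
  obtain ⟨b1, b2, b3, b4, b5⟩ := id h
  by_cases hle : (v i).natAbs + (v k).natAbs ≤ (v j).natAbs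
  · refine IH.peak_comm h0 h a3.symm b3.symm ⟨b1, b2, b3, ?_, ?_⟩ ⟨a1, a2, a3, ?_, ?_⟩ hd <;>
    simp only [S.act_E a3, S.act_E b3, if_neg a3, if_neg b3, if_true]
    · exact b4
    · rcases Int.units_eq_one_or ε with rfl | rfl <;> rcases Int.units_eq_one_or δ with rfl | rfl <;>
        simp at * <;> omega
    · exact a4
    · rcases Int.units_eq_one_or ε with rfl | rfl <;> rcases Int.units_eq_one_or δ with rfl | rfl <;>
        simp at * <;> omega
  · rcases le_total (v i).natAbs (v k).natAbs with hxy | hxy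
    · have h1 : Allowed A v i k (-(ε * δ)) := by
        refine ⟨a1, b1, hik, a4, ?_⟩
        rcases Int.units_eq_one_or ε with rfl | rfl <;>
          rcases Int.units_eq_one_or δ with rfl | rfl <;> simp at * <;> omega
      exact IH.peak_chain h1 h a3 (IH.peak_disjoint h0 h1 hik.symm a3.symm b3.symm hd)
    · have h1 : Allowed A v k i (-(ε * δ)) := by
        refine ⟨b1, a1, hik.symm, b4, ?_⟩
        rcases Int.units_eq_one_or ε with rfl | rfl <;>
          rcases Int.units_eq_one_or δ with rfl | rfl <;> simp at * <;> omega
      exact IH.peak_disjoint h1 h b3.symm hik a3 (IH.peak_chain_symm h1 h0 b3 hd)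

/-- Induction on height. The new move is compared with the first step of the given descending path,
according to which of the four indices coincide. A base vector has a single nonzero coordinate and
admits no decreasing move. -/
theorem confluent (S : SteinbergSystem ι Q) (A : Finset ι) (a : ι) (N : ℕ) :
    Confluent S A a N := by
  induction N with
  | zero => exact fun p v h => absurd h (Nat.not_lt_zero _)
  | succ N ih =>
    intro p v hN hd i j ε h
    have IH : Confluent S A a (height v) := fun p' v' hlt =>
      ih p' v' (hlt.trans_le (Nat.lt_succ_iff.1 hN))
    cases hd with
    | base σ f hσ =>
      have h1 := h.ne_zero
      have h2 : S.act (S.s σ f) (Pi.single a 1) j ≠ 0 := by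
        have := h.abs
        omega
      rw [act_s_single] at h1 h2
      have h3 : i = σ a := by by_contra h'; exact h1 (if_neg h')
      have h4 : j = σ a := by by_contra h'; exact h2 (if_neg h')
      exact absurd (h3.trans h4.symm) h.ne
    | step k l δ _ _ h0 hd =>
      by_cases hjk : j = k
      · subst hjk
        by_cases hli : l = i
        · subst hli
          exact peak_opposite h0 h hd
        · exact IH.peak_chain_symm h h0 (Ne.symm hli) hd
      · by_cases hli : l = i
        · subst hli
          exact IH.peak_chain h0 h (Ne.symm hjk) hd
        · by_cases hlj : l = j
          · subst hlj
            by_cases hki : k = i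
            · subst hki
              obtain rfl : ε = δ := by
                have h1 := h.abs
                have h2 := h0.abs
                have h3 := h.ne_zero
                rcases Int.units_eq_one_or ε with rfl | rfl <;>
                  rcases Int.units_eq_one_or δ with rfl | rfl <;> simp at * <;> omega
              exact hd
            · exact IH.peak_target h0 h hki hd
          · exact IH.peak_disjoint h0 h hjk hli hlj hd

theorem Descends.allowed_smul (hd : S.Descends A a p v) {i j : ι} {ε : ℤˣ}
    (h : Allowed A v i j ε) : S.Descends A a (S.E i j ε • p) (S.act (S.E i j ε) v) :=
  confluent S A a _ p v (Nat.lt_succ_self _) hd i j ε h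

theorem Descends.smul (hd : S.Descends A a p v) {i j : ι} (hi : i ∈ A) (hj : j ∈ A) (hij : i ≠ j)
    (ε : ℤˣ) : S.Descends A a (S.E i j ε • p) (S.act (S.E i j ε) v) := by
  by_cases hz : v i = 0
  · rw [hd.smul_eq hi hj hij hz, act_E_eq_self hij hz]
    exact hd
  by_cases h1 : (v j + ε * v i).natAbs + (v i).natAbs = (v j).natAbs
  · exact hd.allowed_smul ⟨hi, hj, hij, hz, h1⟩
  by_cases h2 : (v j).natAbs + (v i).natAbs = (v j + ε * v i).natAbs
  · refine hd.of_smul_inv ⟨hi, hj, hij, ?_, ?_⟩ <;> simp only [S.act_E hij, if_neg hij, if_true]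
    · exact hz
    · simpa using h2
  -- The remaining case is `v j ≠ 0` of sign opposite to `ε * v i` with `|v j| < |v i|`, so neither
  -- the move nor its inverse decreases. The Weyl relation rewrites it as a decreasing move, then
  -- one whose inverse decreases, then a signed permutation.
  · obtain ⟨σ, f, hσ, hw⟩ := S.exists_weyl hi hj hij ε
    have e1 : S.E i j ε = S.s σ f * (S.E i j (-ε) * S.E j i ε) := by
      rw [← hw, S.E_neg, S.E_neg]
      group
    rw [e1, ← smul_act_mul, mul_smul, map_mul,
    Module.End.mul_apply]
    refine Descends.s_smul ?_ hσ
    have d1 : S.Descends A a (S.E j i ε • p) (S.act (S.E j i ε) v) := by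
      refine hd.allowed_smul ⟨hj, hi, hij.symm, ?_, ?_⟩
      · rintro h0
        rw [h0] at h1 h2
        rcases Int.units_eq_one_or ε with rfl | rfl <;> simp at h1 h2
      · rcases Int.units_eq_one_or ε with rfl | rfl <;> simp at * <;> omega
    refine d1.of_smul_inv ⟨hi, hj, hij, ?_, ?_⟩ <;>
      simp only [S.act_E hij, S.act_E hij.symm, if_neg hij, if_neg hij.symm, if_true]
    · rcases Int.units_eq_one_or ε with rfl | rfl <;> simp at * <;> omega
    · rcases Int.units_eq_one_or ε with rfl | rfl <;> simp at * <;> omega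

/-- By confluence the second coset can follow the descending path of the first down to a vector
`±e_k`. No move is allowed there, so both cosets come from signed permutations with the same effect
on the `a`-th basis vector, and these differ by an element of the stabilizer. -/
theorem Descends.unique {p' : Q ⧸ S.stab A a} (ha : a ∈ A) (hd : S.Descends A a p v)
    (hd' : S.Descends A a p' v) : p = p' := by
  induction hd generalizing p' with
  | step i j ε p v h hp ih => exact smul_left_cancel _ (ih (hd'.allowed_smul h))
  | base σ f hσ =>
    generalize hv : S.act (S.s σ f) (Pi.single a 1) = w at hd'
    cases hd' with
    | step i j ε _ _ h _ =>
      have h1 := h.ne_zero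
      have h2 : w j ≠ 0 := by
        have := h.abs
        omega
      rw [← hv, act_s_single] at h1 h2
      have h3 : i = σ a := by by_contra h'; exact h1 (if_neg h')
      have h4 : j = σ a := by by_contra h'; exact h2 (if_neg h')
      exact absurd (h3.trans h4.symm) h.ne
    | base τ g hτ =>
      rw [QuotientGroup.eq]
      have h1 := congrFun hv (σ a)
      rw [act_s_single, act_s_single, if_pos rfl] at h1
      have h2 : σ a = τ a := by
        by_contra h'
        rw [if_neg h'] at h1
        exact Units.ne_zero _ h1
      rw [if_pos h2] at h1
      rw [S.s_inv, S.s_mul]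
      refine Subgroup.subset_closure (Or.inr ⟨_, _, fun i hi => ?_, rfl⟩)
      by_cases hia : i = a
      · subst hia
        have h3 : σ⁻¹ (τ i) = i := by rw [← h2]; exact σ.symm_apply_apply i
        refine ⟨h3, ?_⟩
        rw [h3, Units.ext h1]
        exact Int.units_mul_self _
      · exact hσ.inv.mul hτ i fun h => hi (Finset.mem_erase.2 ⟨hia, h⟩)

/-- Each generator preserves `Descends`, so the cosets of `q` and of `1` both descend over the same
vector, and uniqueness makes them equal. -/
theorem mem_stab_of_mem_elem (ha : a ∈ A) {q : Q} (hq : q ∈ S.elem A)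
    (h : S.act q (Pi.single a 1) = Pi.single a 1) : q ∈ S.stab A a := by
  have key : ∀ q ∈ S.elem A,
      S.Descends A a ((q : Q) : Q ⧸ S.stab A a) (S.act q (Pi.single a 1)) := by
    intro q hq
    have hmul : ∀ x y : Q, S.Descends A a (x • ((y : Q) : Q ⧸ S.stab A a))
        (S.act x (S.act y (Pi.single a 1))) ↔
        S.Descends A a ((x * y : Q) : Q ⧸ S.stab A a) (S.act (x * y) (Pi.single a 1)) := by
      intro x y
      rw [MulAction.Quotient.smul_coe, smul_eq_mul, map_mul, Module.End.mul_apply]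
    induction hq using Subgroup.closure_induction_left with
    | one =>
      have := Descends.base (S := S) (A := A) (a := a) 1 (fun _ => 1) (fun i _ => ⟨rfl, rfl⟩)
      rwa [S.s_one] at this
    | mul_left x hx y hy ih =>
      rw [← hmul]
      rcases hx with ⟨i, hi, j, hj, hij, rfl⟩ | ⟨σ, f, hσ, rfl⟩
      · rw [← S.E_one]; exact ih.smul hi hj hij 1
      · exact ih.s_smul hσ
    | inv_mul_cancel x hx y hy ih =>
      rw [← hmul]
      rcases hx with ⟨i, hi, j, hj, hij, rfl⟩ | ⟨σ, f, hσ, rfl⟩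
      · rw [← S.E_one, ← S.E_neg]; exact ih.smul hi hj hij _
      · rw [S.s_inv]; exact ih.s_smul hσ.inv
  have h1 := key q hq
  have h2 := key 1 (one_mem _)
  rw [h] at h1
  rw [map_one, Module.End.one_apply] at h2
  have h3 := h2.unique ha h1
  rw [QuotientGroup.eq, inv_one, one_mul] at h3
  exact h3

end PeakReduction

end SteinbergSystem

/-! ### Faithfulness of the action, by induction on the index set. -/

namespace SteinbergSystem

variable {ι Q : Type*} [DecidableEq ι] [Group Q] (S : SteinbergSystem ι Q)

variable {S}

theorem elem_act_apply {A : Finset ι} {a : ι} (ha : a ∉ A) {t : Q} (ht : t ∈ S.elem A)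
    (v : ι → ℤ) : S.act t v a = v a := by
  induction ht using Subgroup.closure_induction generalizing v with
  | mem x hx =>
    rcases hx with ⟨i, hi, j, hj, hij, rfl⟩ | ⟨σ, f, hσ, rfl⟩
    · rw [S.act_e i j hij, if_neg]
      rintro rfl
      exact ha hj
    · have h := S.act_s σ f v a
      rw [(hσ a ha).1, (hσ a ha).2] at h
      simpa using h
  | one => simp
  | mul x y hx hy ihx ihy => rw [map_mul, Module.End.mul_apply, ihx, ihy]
  | inv x hx ih =>
    rw [← ih (S.act x⁻¹ v), ← Module.End.mul_apply, ← map_mul, mul_inv_cancel, map_one,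
      Module.End.one_apply]

/-- The matrix analogue is a block triangular group: the subgroup `V` generated by the `e i a` is
normalised by the generators with indices in `A`, so every product can be sorted with its `V`-part
on the right. -/
theorem exists_mul_of_mem_stab {A : Finset ι} {a : ι} (ha : a ∉ A) {q : Q}
    (hq : q ∈ S.stab (insert a A) a) : ∃ t ∈ S.elem A,
      ∃ x ∈ Subgroup.closure {q | ∃ i ∈ A, q = S.e i a}, q = t * x := by
  set V := Subgroup.closure {q | ∃ i ∈ A, q = S.e i a} with hV
  have hne : ∀ {i}, i ∈ A → i ≠ a := fun hi h => ha (h ▸ hi)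
  have hEV : ∀ {i}, i ∈ A → ∀ ε, S.E i a ε ∈ V := by
    intro i hi ε
    unfold E
    refine Subgroup.zpow_mem _ ?_ _
    exact Subgroup.subset_closure ⟨i, hi, rfl⟩
  have hconjE : ∀ i ∈ A, ∀ j ∈ A, i ≠ j → ∀ ε, ∀ x ∈ V, (S.E i j ε)⁻¹ * x * S.E i j ε ∈ V := by
    intro i hi j hj hij ε x hx
    have h1 : V ≤ V.comap (MulAut.conj (S.E i j ε)⁻¹).toMonoidHom := by
      rw [hV, Subgroup.closure_le, ← hV]
      rintro _ ⟨l, hl, rfl⟩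
      change MulAut.conj (S.E i j ε)⁻¹ (S.e l a) ∈ V
      rw [MulAut.conj_apply, inv_inv, mul_assoc, ← S.E_one]
      by_cases hlj : l = j
      · subst hlj
        rw [S.E_chain hij (hne hl) (hne hi), mul_assoc, inv_mul_cancel_left]
        exact mul_mem (hEV hi _) (hEV hl _)
      · rw [← S.E_comm hij (hne hl) (Ne.symm hlj) (hne hi).symm, inv_mul_cancel_left]
        exact hEV hl _
    have h2 := h1 hx
    change MulAut.conj (S.E i j ε)⁻¹ x ∈ V at h2
    rwa [MulAut.conj_apply, inv_inv] at h2
  have hconjs : ∀ σ f, SuppIn A σ f → ∀ x ∈ V, (S.s σ f)⁻¹ * x * S.s σ f ∈ V := by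
    intro σ f hσ x hx
    have h1 : V ≤ V.comap (MulAut.conj (S.s σ f)⁻¹).toMonoidHom := by
      rw [hV, Subgroup.closure_le, ← hV]
      rintro _ ⟨l, hl, rfl⟩
      change MulAut.conj (S.s σ f)⁻¹ (S.e l a) ∈ V
      have hl' := hσ.inv.apply_mem hl
      have ha' : σ a = a := (hσ a ha).1
      have h2 := S.s_E σ f (hne hl') (f (σ⁻¹ l) * f a * 1)
      rw [ha', show σ (σ⁻¹ l) = l from σ.apply_symm_apply l, ← mul_assoc, Int.units_mul_self,
        one_mul, S.E_one] at h2
      rw [MulAut.conj_apply, inv_inv, mul_assoc, ← h2, inv_mul_cancel_left]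
      exact hEV hl' _
    have h2 := h1 hx
    change MulAut.conj (S.s σ f)⁻¹ x ∈ V at h2
    rwa [MulAut.conj_apply, inv_inv] at h2
  have key : ∀ t ∈ S.elem A, ∀ x ∈ V, ∀ g ∈ S.elem A, (∀ x ∈ V, g⁻¹ * x * g ∈ V) →
      ∃ t' ∈ S.elem A, ∃ x' ∈ V, t * x * g = t' * x' := fun t ht x hx g hg hgV =>
    ⟨t * g, mul_mem ht hg, g⁻¹ * x * g, hgV x hx, by group⟩
  have hEel : ∀ i ∈ A, ∀ j ∈ A, i ≠ j → ∀ ε, S.E i j ε ∈ S.elem A := by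
    intro i hi j hj hij ε
    unfold E
    refine Subgroup.zpow_mem _ ?_ _
    exact Subgroup.subset_closure (Or.inl ⟨i, hi, j, hj, hij, rfl⟩)
  have hE : ∀ t ∈ S.elem A, ∀ x ∈ V, ∀ i ∈ A, ∀ j ∈ insert a A, i ≠ j → ∀ ε,
      ∃ t' ∈ S.elem A, ∃ x' ∈ V, t * x * S.E i j ε = t' * x' := by
    intro t ht x hx i hi j hj hij ε
    rcases Finset.mem_insert.1 hj with rfl | hj
    · exact ⟨t, ht, x * S.E i j ε, mul_mem hx (hEV hi ε), mul_assoc _ _ _⟩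
    · exact key t ht x hx _ (hEel i hi j hj hij ε) (hconjE i hi j hj hij ε)
  have hs : ∀ t ∈ S.elem A, ∀ x ∈ V, ∀ σ f, SuppIn A σ f →
      ∃ t' ∈ S.elem A, ∃ x' ∈ V, t * x * S.s σ f = t' * x' := by
    intro t ht x hx σ f hσ
    exact key t ht x hx _ (Subgroup.subset_closure (Or.inr ⟨σ, f, hσ, rfl⟩)) (hconjs σ f hσ)
  rw [stab, Finset.erase_insert ha] at hq
  induction hq using Subgroup.closure_induction_right with
  | one => exact ⟨1, one_mem _, 1, one_mem _, (one_mul 1).symm⟩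
  | mul_right x hx y hy ih =>
    obtain ⟨t, ht, z, hz, rfl⟩ := ih
    rcases hy with ⟨i, hi, j, hj, hij, rfl⟩ | ⟨σ, f, hσ, rfl⟩
    · rw [← S.E_one]; exact hE t ht z hz i hi j hj hij 1
    · exact hs t ht z hz σ f hσ
  | mul_inv_cancel x hx y hy ih =>
    obtain ⟨t, ht, z, hz, rfl⟩ := ih
    rcases hy with ⟨i, hi, j, hj, hij, rfl⟩ | ⟨σ, f, hσ, rfl⟩
    · rw [← S.E_one, ← S.E_neg]; exact hE t ht z hz i hi j hj hij _
    · rw [S.s_inv]; exact hs t ht z hz _ _ hσ.inv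

variable [Fintype ι] (S)

/-- The homomorphism `m ↦ ∏ e i a ^ m i`, the product taken over `i ≠ a`. -/
def column (a : ι) : (ι → Multiplicative ℤ) →* Q :=
  MonoidHom.noncommPiCoprod (fun i => if i = a then 1 else zpowersHom Q (S.e i a))
    (fun i j _ x y => by
      by_cases hi : i = a
      · simp [hi]
      by_cases hj : j = a
      · simp [hj]
      simp only [if_neg hi, if_neg hj, zpowersHom_apply]
      exact (S.comm i a j a hi hj (Ne.symm hj) (Ne.symm hi)).zpow_zpow _ _)

theorem column_mulSingle {a i : ι} (m : Multiplicative ℤ) :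
    S.column a (Pi.mulSingle i m) = if i = a then 1 else S.e i a ^ m.toAdd := by
  refine (MonoidHom.noncommPiCoprod_mulSingle (N := fun _ => Multiplicative ℤ) _ i m).trans ?_
  split_ifs <;> simp

theorem exists_column {A : Finset ι} {a : ι} (ha : a ∉ A) {x : Q}
    (hx : x ∈ Subgroup.closure {q | ∃ i ∈ A, q = S.e i a}) :
    ∃ m : ι → Multiplicative ℤ, x = S.column a m ∧
      ∀ v k, S.act x v k = v k + if k = a then ∑ i ∈ Finset.univ.erase a, (m i).toAdd * v i else 0 := by
  induction hx using Subgroup.closure_induction with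
  | mem x hx =>
    obtain ⟨i, hi, rfl⟩ := hx
    have hia : i ≠ a := fun h => ha (h ▸ hi)
    refine ⟨Pi.mulSingle i (Multiplicative.ofAdd 1), ?_, fun v k => ?_⟩
    · rw [column_mulSingle, if_neg hia]; simp
    · rw [S.act_e i a hia, Finset.sum_eq_single i]
      · split_ifs with h
        · subst h; simp
        · simp
      · intro j _ hj
        simp [hj]
      · simp [hia]
  | one => exact ⟨1, by simp, fun v k => by simp⟩
  | mul x y hx hy ihx ihy =>
    obtain ⟨m, rfl, hm⟩ := ihx
    obtain ⟨m', rfl, hm'⟩ := ihy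
    refine ⟨m * m', by rw [map_mul], fun v k => ?_⟩
    rw [map_mul, Module.End.mul_apply, hm, hm']
    by_cases h : k = a
    · simp only [h, if_true, Pi.mul_apply, toAdd_mul, add_mul, Finset.sum_add_distrib]
      rw [add_assoc, add_comm (∑ i ∈ Finset.univ.erase a, (m i).toAdd * v i)]
      congr 2
      refine Finset.sum_congr rfl fun i hi => ?_
      rw [hm', if_neg (Finset.ne_of_mem_erase hi), add_zero]
    · simp [h]
  | inv x hx ih =>
    obtain ⟨m, rfl, hm⟩ := ih
    refine ⟨m⁻¹, by rw [map_inv], fun v k => ?_⟩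
    obtain ⟨w, rfl⟩ : ∃ w, v = S.act (S.column a m) w :=
      ⟨S.act (S.column a m)⁻¹ v, by
        rw [← Module.End.mul_apply, ← map_mul, mul_inv_cancel, map_one, Module.End.one_apply]⟩
    rw [← Module.End.mul_apply, ← map_mul, inv_mul_cancel, map_one, Module.End.one_apply, hm]
    by_cases h : k = a
    · simp only [h, if_true, Pi.inv_apply, toAdd_inv, neg_mul, Finset.sum_neg_distrib]
      rw [add_assoc, left_eq_add, add_neg_eq_zero]
      refine Finset.sum_congr rfl fun i hi => ?_
      rw [hm, if_neg (Finset.ne_of_mem_erase hi), add_zero]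
    · simp [h]

/-- The generators `e i a` commute, so `x` is determined by its exponents. The exponent at `j` is
read off as the `a`-th coordinate of the image of the `j`-th basis vector. -/
theorem eq_one_of_mem_column {A : Finset ι} {a : ι} (ha : a ∉ A) {x : Q}
    (hx : x ∈ Subgroup.closure {q | ∃ i ∈ A, q = S.e i a})
    (h : ∀ v, S.act x v a = v a) : x = 1 := by
  obtain ⟨m, rfl, hm⟩ := S.exists_column ha hx
  have h1 : ∀ j ≠ a, m j = 1 := by
    intro j hj
    have h2 := hm (Pi.single j 1) a
    rw [h, if_pos rfl, left_eq_add, Finset.sum_eq_single j] at h2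
    · simpa using h2
    · intro i _ hi; simp [hi]
    · simp [hj]
  have h3 : m = Pi.mulSingle a (m a) := by
    funext j
    by_cases hj : j = a
    · subst hj; simp
    · simp [hj, h1 j hj]
  rw [h3, column_mulSingle, if_pos rfl]

variable {S}

/-- An element acting trivially fixes the `a`-th basis vector, so it factors as `t * x` with `t` in
the smaller group and `x` in the column group. As `t` never changes coordinate `a`, that coordinate
alone forces `x = 1`, and `t` is handled by induction. -/
theorem eq_one_of_mem_elem (A : Finset ι) {q : Q} (hq : q ∈ S.elem A) (h : S.act q = 1) :
    q = 1 := by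
  induction A using Finset.induction_on generalizing q with
  | empty =>
    have h1 : S.elem ∅ ≤ ⊥ := by
      rw [elem, Subgroup.closure_le]
      rintro _ (⟨i, hi, -⟩ | ⟨σ, f, hσ, rfl⟩)
      · exact absurd hi (Finset.notMem_empty i)
      · have h2 : σ = 1 := Equiv.ext fun i => (hσ i (Finset.notMem_empty i)).1
        have h3 : f = fun _ => 1 := funext fun i => (hσ i (Finset.notMem_empty i)).2
        rw [h2, h3, S.s_one]
        exact one_mem _
    exact Subgroup.mem_bot.1 (h1 hq)
  | insert a A ha ih =>
    have h1 := mem_stab_of_mem_elem (Finset.mem_insert_self a A) hq (by rw [h]; rfl)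
    obtain ⟨t, ht, x, hx, rfl⟩ := exists_mul_of_mem_stab ha h1
    obtain rfl : x = 1 := S.eq_one_of_mem_column ha hx fun v => by
      rw [← elem_act_apply ha ht (S.act x v), ← Module.End.mul_apply, ← map_mul, h, Module.End.one_apply]
    rw [mul_one] at h ⊢
    exact ih ht h

/-- The elementary relations determine the group of integer matrices. -/
theorem eq_one_of_mem_closure {q : Q} (hq : q ∈ Subgroup.closure ({q | ∃ i j, i ≠ j ∧ q = S.e i j} ∪
    {q | ∃ σ f, q = S.s σ f})) (h : S.act q = 1) : q = 1 := by
  refine eq_one_of_mem_elem (S := S) Finset.univ (Subgroup.closure_mono ?_ hq) h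
  rintro _ (⟨i, j, hij, rfl⟩ | ⟨σ, f, rfl⟩)
  · exact Or.inl ⟨i, Finset.mem_univ i, j, Finset.mem_univ j, hij, rfl⟩
  · exact Or.inr ⟨σ, f, fun i hi => absurd (Finset.mem_univ i) hi, rfl⟩

end SteinbergSystem

namespace OutFree

variable {n : ℕ}

/-! ### `IA_n` is generated by Magnus's automorphisms and commutators -/

/-- The group `Aut(F_n)` modulo Magnus's automorphisms and `[IA_n, IA_n]`. -/
abbrev AutModMagnus (n : ℕ) : Type := MulAut (FreeGroup (Fin n)) ⧸ magnusSubgroup n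

/-- The class of `φ` modulo Magnus's automorphisms and `[IA_n, IA_n]`. -/
def modMagnus (n : ℕ) : MulAut (FreeGroup (Fin n)) →* AutModMagnus n :=
  QuotientGroup.mk' (magnusSubgroup n)

theorem modMagnus_eq_one {φ : MulAut (FreeGroup (Fin n))} :
    modMagnus n φ = 1 ↔ φ ∈ magnusSubgroup n := QuotientGroup.eq_one_iff φ

/-- The transvection `x_i ↦ x_j x_i`. -/
def leftTransv {i j : Fin n} (h : j ≠ i) : MulAut (FreeGroup (Fin n)) := substAut i (cogen h) 1

@[simp] theorem leftTransv_self {a b : Fin n} (h : b ≠ a) :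
    leftTransv h (FreeGroup.of a) = FreeGroup.of b * FreeGroup.of a := by
  simp [leftTransv]

theorem leftTransv_ne {a b j : Fin n} (h : b ≠ a) (hj : j ≠ a) :
    leftTransv h (FreeGroup.of j) = FreeGroup.of j := substAut_ne hj _ _

theorem transv_inv_self {a b : Fin n} (h : b ≠ a) :
    MulEquiv.symm (transv h) (FreeGroup.of a) = FreeGroup.of a * (FreeGroup.of b)⁻¹ := by
  change (transv h)⁻¹ _ = _
  rw [transv, substAut_inv]; simp

theorem transv_inv_ne {a b j : Fin n} (h : b ≠ a) (hj : j ≠ a) :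
    MulEquiv.symm (transv h) (FreeGroup.of j) = FreeGroup.of j := by
  change (transv h)⁻¹ _ = _
  rw [transv, substAut_inv, substAut_ne hj]

theorem leftTransv_inv_self {a b : Fin n} (h : b ≠ a) :
    MulEquiv.symm (leftTransv h) (FreeGroup.of a) = (FreeGroup.of b)⁻¹ * FreeGroup.of a := by
  change (leftTransv h)⁻¹ _ = _
  rw [leftTransv, substAut_inv]; simp

theorem leftTransv_inv_ne {a b j : Fin n} (h : b ≠ a) (hj : j ≠ a) :
    MulEquiv.symm (leftTransv h) (FreeGroup.of j) = FreeGroup.of j := by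
  change (leftTransv h)⁻¹ _ = _
  rw [leftTransv, substAut_inv, substAut_ne hj]

theorem modMagnus_leftTransv {i j : Fin n} (h : j ≠ i) :
    modMagnus n (leftTransv h) = modMagnus n (transv h) := by
  rw [← inv_mul_eq_one, ← map_inv, ← map_mul, modMagnus_eq_one, leftTransv, transv, substAut_inv,
    substAut_mul, one_mul, inv_one, one_mul]
  have := substAut_conj_mem (cogen h)⁻¹
  rwa [inv_inv] at this

/-- When `i = k` the two right multiplications need not commute in `Aut(F_n)`. Modulo Magnus's
automorphisms one of them may be replaced by the left multiplication, which commutes with the other.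
-/
theorem transv_comm {i j k l : Fin n} (hij : j ≠ i) (hkl : l ≠ k) (hjk : j ≠ k) (hli : l ≠ i) :
    Commute (modMagnus n (transv hij)) (modMagnus n (transv hkl)) := by
  by_cases hik : i = k
  · subst hik
    rw [← modMagnus_leftTransv hij, Commute, SemiconjBy, ← map_mul, ← map_mul, leftTransv, transv,
      substAut_mul, substAut_mul]
    simp
  · rw [Commute, SemiconjBy, ← map_mul, ← map_mul]
    congr 1
    refine mulAut_ext fun m => ?_
    rw [MulAut.mul_apply, MulAut.mul_apply]
    by_cases hmi : m = i
    · subst hmi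
      simp [transv_ne hkl hik, transv_ne hkl hjk]
    · by_cases hmk : m = k
      · subst hmk
        simp [transv_ne hij hmi, transv_ne hij hli]
      · simp [transv_ne hij hmi, transv_ne hkl hmk]

theorem transv_chain {i j k : Fin n} (hij : j ≠ i) (hjk : k ≠ j) (hik : k ≠ i) :
    transv hij * transv hjk = transv hjk * transv hij * (transv hik)⁻¹ := by
  refine mulAut_ext fun m => ?_
  simp only [MulAut.mul_apply, MulAut.inv_def]
  by_cases hmi : m = i
  · subst hmi
    simp [transv_inv_self hik, transv_ne hjk hij.symm, transv_ne hij hik, transv_ne hjk hjk, mul_assoc]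
  · rw [transv_inv_ne hik hmi, transv_ne hij hmi]
    by_cases hmj : m = j
    · subst hmj
      simp [transv_ne hij hmi, transv_ne hij hik]
    · rw [transv_ne hjk hmj, transv_ne hij hmi]

theorem transv_weyl {i j : Fin n} (hij : j ≠ i) :
    transv hij * (transv hij.symm)⁻¹ * leftTransv hij =
      signedPerm (Equiv.swap i j) (fun k => if k = j then -1 else 1) := by
  refine mulAut_ext fun m => ?_
  simp only [MulAut.mul_apply, signedPerm_of, MulAut.inv_def]
  by_cases hmi : m = i
  · subst hmi
    simp [transv_inv_self hij.symm, transv_inv_ne hij.symm hij.symm, transv_ne hij hij, hij.symm]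
  · rw [leftTransv_ne hij hmi]
    by_cases hmj : m = j
    · subst hmj
      simp [transv_inv_self hij.symm, transv_ne hij hij]
    · rw [transv_inv_ne hij.symm hmj, transv_ne hij hmi, Equiv.swap_apply_of_ne_of_ne hmi hmj,
        if_neg hmj]
      simp

/-- If `f` inverts `x_i`, conjugation turns a right transvection into a left one. This is why the
relation is stated modulo Magnus's automorphisms. -/
theorem signedPerm_transv (σ : Equiv.Perm (Fin n)) (f : Fin n → ℤˣ) {i j : Fin n} (hij : j ≠ i) :
    modMagnus n (signedPerm σ f) * modMagnus n (transv hij) =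
      modMagnus n (transv (σ.injective.ne hij)) ^ ((f i * f j : ℤˣ) : ℤ) *
        modMagnus n (signedPerm σ f) := by
  have h1 : f i = 1 → ∀ ε : ℤˣ, f j = ε → signedPerm σ f * transv hij =
      transv (σ.injective.ne hij) ^ (ε : ℤ) * signedPerm σ f := by
    intro hi ε hj
    refine mulAut_ext fun m => ?_
    rw [MulAut.mul_apply, MulAut.mul_apply]
    by_cases hm : m = i
    · subst hm
      rcases Int.units_eq_one_or ε with rfl | rfl <;> simp [hi, hj, transv_inv_self]
    · have hm' := σ.injective.ne hm
      rw [transv_ne _ hm, signedPerm_of, map_zpow]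
      rcases Int.units_eq_one_or ε with rfl | rfl <;>
        simp [transv_ne _ hm', transv_inv_ne _ hm']
  have h2 : f i = -1 → ∀ ε : ℤˣ, f j = ε → signedPerm σ f * transv hij =
      leftTransv (σ.injective.ne hij) ^ (-ε : ℤ) * signedPerm σ f := by
    intro hi ε hj
    refine mulAut_ext fun m => ?_
    rw [MulAut.mul_apply, MulAut.mul_apply]
    by_cases hm : m = i
    · subst hm
      rcases Int.units_eq_one_or ε with rfl | rfl <;> simp [hi, hj, leftTransv_inv_self]
    · have hm' := σ.injective.ne hm
      rw [transv_ne _ hm, signedPerm_of, map_zpow]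
      rcases Int.units_eq_one_or ε with rfl | rfl <;>
        simp [leftTransv_ne _ hm', leftTransv_inv_ne _ hm']
  rcases Int.units_eq_one_or (f i) with hi | hi
  · rw [← map_mul, h1 hi _ rfl, map_mul, map_zpow, hi, one_mul]
  · rw [← map_mul, h2 hi _ rfl, map_mul, map_zpow, modMagnus_leftTransv, hi]
    simp

/-- The action of `GL(H_ℤ)` in coordinates. -/
def glCoord (n : ℕ) : GLHZ n →* Module.End ℤ (Fin n → ℤ) where
  toFun A := ((basisHZ n).equivFun.toLinearMap ∘ₗ A.toLinearMap) ∘ₗ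
    (basisHZ n).equivFun.symm.toLinearMap
  map_one' := by ext; simp
  map_mul' A B := by
    refine LinearMap.ext fun v => ?_
    simp only [LinearMap.comp_apply, Module.End.mul_apply, LinearEquiv.coe_coe,
      LinearEquiv.symm_apply_apply]
    rfl

theorem glCoord_apply (A : GLHZ n) (v : Fin n → ℤ) (k : Fin n) :
    glCoord n A v k = ∑ m, v m * (basisHZ n).repr (A (basisHZ n m)) k := by
  simp [glCoord, Module.Basis.equivFun_symm_apply, map_sum]

/-- The action of `Aut(F_n)` modulo Magnus's automorphisms on `ℤ^n`. -/
def magnusAct (n : ℕ) : AutModMagnus n →* Module.End ℤ (Fin n → ℤ) :=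
  (glCoord n).comp (QuotientGroup.lift (magnusSubgroup n) (autToGL n) magnusSubgroup_le_IA)

theorem magnusAct_modMagnus (φ : MulAut (FreeGroup (Fin n))) :
    magnusAct n (modMagnus n φ) = glCoord n (autToGL n φ) := rfl

theorem cls_zpow (γ : FreeGroup (Fin n)) (m : ℤ) : cls (γ ^ m) = m • cls γ := rfl

/-- The elementary relations hold modulo Magnus's automorphisms. -/
def magnusSystem (n : ℕ) : SteinbergSystem (Fin n) (AutModMagnus n) where
  e i j := if h : j ≠ i then modMagnus n (transv h) else 1
  s σ f := modMagnus n (signedPerm σ f)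
  act := magnusAct n
  comm i j k l hij hkl hjk hli := by
    rw [dif_pos hij.symm, dif_pos hkl.symm]
    exact transv_comm _ _ hjk hli
  chain i j k hij hjk hik := by
    rw [dif_pos hij.symm, dif_pos hjk.symm, dif_pos hik.symm, ← map_mul, ← map_mul, ← map_inv,
      ← map_mul, transv_chain]
  weyl i j hij := by
    rw [dif_pos hij.symm, dif_pos hij, ← transv_weyl hij.symm, map_mul, map_mul, map_inv,
      modMagnus_leftTransv]
  s_mul σ τ f g := by rw [← map_mul, signedPerm_mul]
  s_one := by rw [signedPerm_one, map_one]
  s_e σ f i j hij := by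
    rw [dif_pos hij.symm, dif_pos (σ.injective.ne hij.symm), signedPerm_transv]
  act_e i j hij v k := by
    have h : ∀ m, (basisHZ n).repr (autToGL n (transv hij.symm) (basisHZ n m)) k =
        (if m = k then 1 else 0) + if m = i then (if j = k then 1 else 0) else 0 := by
      intro m
      rw [basisHZ_apply, autToGL_cls]
      by_cases hm : m = i
      · subst hm
        rw [transv_self, cls_mul, ← basisHZ_apply, ← basisHZ_apply]
        simp [Finsupp.single_apply]
      · rw [transv_ne _ hm, ← basisHZ_apply]
        simp [Finsupp.single_apply, hm]
    rw [dif_pos hij.symm, magnusAct_modMagnus, glCoord_apply]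
    simp only [h, mul_add, Finset.sum_add_distrib, mul_ite, mul_one, mul_zero, Finset.sum_ite_eq',
      Finset.mem_univ, if_true]
    by_cases hk : k = j
    · subst hk; simp
    · simp [hk, Ne.symm hk]
  act_s σ f v i := by
    have h : ∀ m, (basisHZ n).repr (autToGL n (signedPerm σ f) (basisHZ n m)) (σ i) =
        if m = i then (f i : ℤ) else 0 := by
      intro m
      rw [basisHZ_apply, autToGL_cls, signedPerm_of, cls_zpow, ← basisHZ_apply]
      by_cases hm : m = i
      · subst hm; simp
      · simp [hm]
    rw [magnusAct_modMagnus, glCoord_apply]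
    simp [h, mul_comm]

/-- The quotient of `Aut(F_n)` by the Magnus subgroup is generated by the elements of
`magnusSystem`, so it acts faithfully on `ℤ^n`; but `IA_n` acts trivially. -/
theorem magnusSubgroup_eq_IA : magnusSubgroup n = IA n := by
  refine le_antisymm magnusSubgroup_le_IA fun φ hφ => ?_
  rw [← modMagnus_eq_one]
  refine SteinbergSystem.eq_one_of_mem_closure (S := magnusSystem n) ?_ ?_
  · have h := mulAut_eq_top ((Subgroup.closure ({q | ∃ i j, i ≠ j ∧ q = (magnusSystem n).e i j} ∪
      {q | ∃ σ f, q = (magnusSystem n).s σ f})).comap (modMagnus n))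
      (fun σ f => Subgroup.subset_closure (Or.inr ⟨σ, f, rfl⟩))
      (fun i j hij => Subgroup.subset_closure (Or.inl ⟨i, j, hij.symm, by
        simp [magnusSystem, hij]⟩))
    have h1 : φ ∈ (⊤ : Subgroup (MulAut (FreeGroup (Fin n)))) := Subgroup.mem_top φ
    rw [← h] at h1
    exact h1
  · change magnusAct n (modMagnus n φ) = 1
    rw [magnusAct_modMagnus, MonoidHom.mem_ker.1 hφ, map_one]

/-! ### The abelianization of `IA_n` -/

/-- The linear map on `Λ²` with `Y ∧ Z ↦ c Y Z - c Z Y`. -/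
def wedgeLift {V : Type*} [AddCommGroup V] (c : HZ n →ₗ[ℤ] HZ n →ₗ[ℤ] V) :
    ⋀[ℤ]^2 (HZ n) →ₗ[ℤ] V :=
  exteriorPower.alternatingMapLinearEquiv
    { toFun := fun v => c (v 0) (v 1) - c (v 1) (v 0)
      map_update_add' := fun m i x y => by
        fin_cases i <;> simp [Function.update] <;> abel
      map_update_smul' := fun m i r x => by
        fin_cases i <;> simp [Function.update, smul_sub]
      map_eq_zero_of_eq' := fun v i j h hij => by
        have h1 : v 0 = v 1 := by
          fin_cases i <;> fin_cases j <;> simp_all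
        simp [h1] }

theorem wedgeLift_wedge {V : Type*} [AddCommGroup V] (c : HZ n →ₗ[ℤ] HZ n →ₗ[ℤ] V) (Y Z : HZ n) :
    wedgeLift c (wedge n Y Z) = c Y Z - c Z Y := by
  rw [wedgeLift, wedge_apply, exteriorPower.alternatingMapLinearEquiv_apply_ιMulti]
  rfl

/-- The abelianization of `IA_n`, written additively. -/
abbrev IAAbel (n : ℕ) : Type := Additive (Abelianization (IA n))

/-- The class in the abelianization of an element of `IA_n`. -/
def iaCls (φ : IA n) : IAAbel n := Additive.ofMul (Abelianization.of φ)

theorem johnsonHom_one : johnsonHom (1 : IA n) = 0 := by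
  have := johnsonHom_mul (1 : IA n) 1
  rwa [mul_one, left_eq_add] at this

theorem johnsonHom_inv (φ : IA n) : johnsonHom φ⁻¹ = - johnsonHom φ := by
  have := johnsonHom_mul φ⁻¹ φ
  rw [inv_mul_cancel, johnsonHom_one] at this
  exact eq_neg_of_add_eq_zero_left this.symm

/-- The automorphism `x_i ↦ x_j x_i x_j⁻¹` as an element of `IA_n`. -/
def magnusConj {i j : Fin n} (h : j ≠ i) : IA n :=
  ⟨substAut i (cogen h) (cogen h)⁻¹, magnusSubgroup_le_IA (substAut_conj_mem _)⟩

/-- The automorphism `x_i ↦ x_i [x_j, x_k]` as an element of `IA_n`. -/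
def magnusComm {i j k : Fin n} (hj : j ≠ i) (hk : k ≠ i) : IA n :=
  ⟨substAut i 1 ⁅cogen hj, cogen hk⁆, magnusSubgroup_le_IA (substAut_commutator_mem _ _)⟩

theorem johnsonHom_of_fix (φ : IA n) {l : Fin n} (h : φ.1 (FreeGroup.of l) = FreeGroup.of l) :
    johnsonHom φ (basisHZ n l) = 0 := by
  rw [basisHZ_apply, johnsonHom_cls, h, sub_self]

theorem johnsonHom_magnusConj {i j : Fin n} (h : j ≠ i) (l : Fin n) :
    johnsonHom (magnusConj h) (basisHZ n l) =
      if l = i then wedge n (basisHZ n j) (basisHZ n i) else 0 := by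
  split_ifs with hl
  · subst hl
    rw [basisHZ_apply, basisHZ_apply, johnsonHom_apply, ← magnusQuad_commutator, magnusConj]
    simp [commutatorElement_def]
  · exact johnsonHom_of_fix _ (substAut_ne hl _ _)

theorem johnsonHom_magnusComm {i j k : Fin n} (hj : j ≠ i) (hk : k ≠ i) (l : Fin n) :
    johnsonHom (magnusComm hj hk) (basisHZ n l) =
      if l = i then wedge n (basisHZ n j) (basisHZ n k) else 0 := by
  split_ifs with hl
  · subst hl
    have h1 : substAut l 1 ⁅cogen hj, cogen hk⁆ (FreeGroup.of l) =
        FreeGroup.of l * ⁅FreeGroup.of j, FreeGroup.of k⁆ := by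
      rw [substAut_self, Subgroup.coe_one, one_mul]
      rfl
    have h2 : cls ⁅FreeGroup.of j, FreeGroup.of k⁆ = 0 := cls_commutator (cogen hj) (cogen hk)
    rw [basisHZ_apply, basisHZ_apply, basisHZ_apply, johnsonHom_cls, magnusComm, h1,
      magnusQuad_mul, h2, map_zero, add_zero, add_sub_cancel_left, magnusQuad_commutator]
  · exact johnsonHom_of_fix _ (substAut_ne hl _ _)

/-- The class of the Magnus automorphism with image `X_i^* ⊗ X_j ∧ X_k`. -/
def magnusClass (i j k : Fin n) : IAAbel n :=
  if hj : j = i then (if hk : k = i then 0 else - iaCls (magnusConj hk))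
  else if hk : k = i then iaCls (magnusConj hj) else iaCls (magnusComm hj hk)

theorem magnusClass_self (i j : Fin n) : magnusClass i j j = 0 := by
  unfold magnusClass
  split_ifs with h
  · rfl
  · have h1 : magnusComm h h = 1 := by
      ext1
      change substAut i 1 ⁅cogen h, cogen h⁆ = 1
      rw [commutatorElement_self, substAut_one]
    rw [h1]
    rfl

theorem magnusClass_swap (i j k : Fin n) : magnusClass i k j = - magnusClass i j k := by
  unfold magnusClass
  split_ifs with hk hj hj
  · simp
  · rfl
  · simp
  · have h1 : magnusComm hk hj = (magnusComm hj hk)⁻¹ := by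
      ext1
      change substAut i 1 ⁅cogen hk, cogen hj⁆ = (substAut i 1 ⁅cogen hj, cogen hk⁆)⁻¹
      rw [substAut_inv, inv_one, commutatorElement_inv]
    rw [h1]
    rfl

/-- The homomorphism `Λ² H_ℤ → IA_n^abel` with `X_j ∧ X_k ↦ magnusClass i j k`. -/
def magnusWedge (i : Fin n) : ⋀[ℤ]^2 (HZ n) →ₗ[ℤ] IAAbel n :=
  wedgeLift ((basisHZ n).constr ℤ fun j => (basisHZ n).constr ℤ fun k =>
    if j < k then magnusClass i j k else 0)

theorem magnusWedge_wedge (i j k : Fin n) :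
    magnusWedge i (wedge n (basisHZ n j) (basisHZ n k)) = magnusClass i j k := by
  rw [magnusWedge, wedgeLift_wedge]
  simp only [Module.Basis.constr_basis]
  rcases lt_trichotomy j k with h | rfl | h
  · simp [h, h.not_gt]
  · simp [magnusClass_self]
  · simp [h, h.not_gt, magnusClass_swap i k j]

/-- A left inverse of the Johnson homomorphism on `IA_n^abel`. -/
def johnsonInv (n : ℕ) : (HZ n →ₗ[ℤ] ⋀[ℤ]^2 (HZ n)) →ₗ[ℤ] IAAbel n :=
  ∑ i, (magnusWedge i).comp (LinearMap.applyₗ (basisHZ n i))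

theorem johnsonInv_apply (u : HZ n →ₗ[ℤ] ⋀[ℤ]^2 (HZ n)) :
    johnsonInv n u = ∑ i, magnusWedge i (u (basisHZ n i)) := by
  simp [johnsonInv, LinearMap.sum_apply]

/-- Both sides are homomorphisms from `IA_n` to an abelian group, so they agree on commutators. They
agree on Magnus's automorphisms by construction, and together these generate `IA_n`. -/
theorem johnsonInv_johnsonHom (φ : IA n) : johnsonInv n (johnsonHom φ) = iaCls φ := by
  let α : IA n →* Multiplicative (IAAbel n) :=
    { toFun := fun φ => Multiplicative.ofAdd (johnsonInv n (johnsonHom φ))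
      map_one' := by rw [johnsonHom_one, map_zero]; rfl
      map_mul' := fun φ ψ => by rw [johnsonHom_mul, map_add]; rfl }
  let β : IA n →* Multiplicative (IAAbel n) :=
    { toFun := fun φ => Multiplicative.ofAdd (iaCls φ)
      map_one' := rfl
      map_mul' := fun φ ψ => rfl }
  have hcomm : ∀ (f : IA n →* Multiplicative (IAAbel n)) (x y : IA n), f ⁅x, y⁆ = 1 := by
    intro f x y
    rw [map_commutatorElement, commutatorElement_eq_one_iff_mul_comm, mul_comm]
  have hle : magnusSubgroup n ≤ (α.eqLocus β).map (IA n).subtype := by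
    refine sup_le ((Subgroup.closure_le _).2 ?_) (Subgroup.commutator_le.2 ?_)
    · rintro _ (⟨i, j, h, rfl⟩ | ⟨i, j, k, hj, hk, rfl⟩)
      · refine ⟨magnusConj h, ?_, rfl⟩
        change johnsonInv n (johnsonHom (magnusConj h)) = iaCls (magnusConj h)
        rw [johnsonInv_apply, Finset.sum_eq_single i]
        · rw [johnsonHom_magnusConj, if_pos rfl, magnusWedge_wedge, magnusClass, dif_neg h,
            dif_pos rfl]
        · intro l _ hl
          rw [johnsonHom_magnusConj, if_neg hl, map_zero]
        · simp
      · refine ⟨magnusComm hj hk, ?_, rfl⟩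
        change johnsonInv n (johnsonHom (magnusComm hj hk)) = iaCls (magnusComm hj hk)
        rw [johnsonInv_apply, Finset.sum_eq_single i]
        · rw [johnsonHom_magnusComm, if_pos rfl, magnusWedge_wedge, magnusClass, dif_neg hj,
            dif_neg hk]
        · intro l _ hl
          rw [johnsonHom_magnusComm, if_neg hl, map_zero]
        · simp
    · intro x hx y hy
      refine ⟨⁅(⟨x, hx⟩ : IA n), (⟨y, hy⟩ : IA n)⁆, ?_, rfl⟩
      change α _ = β _
      rw [hcomm, hcomm]
  have h1 : φ.1 ∈ (α.eqLocus β).map (IA n).subtype := 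
    hle (by rw [magnusSubgroup_eq_IA]; exact φ.2)
  obtain ⟨ψ, hψ, h2⟩ := h1
  obtain rfl : ψ = φ := Subtype.ext h2
  exact hψ

/-- The image is a subgroup of `Hom(H_ℤ, Λ² H_ℤ)`, and up to sign Magnus's automorphisms hit every
`X_i^* ⊗ (X_j ∧ X_k)`; the cases `j = i` and `k = i` use the conjugations. -/
theorem johnsonHom_surjective (u : HZ n →ₗ[ℤ] ⋀[ℤ]^2 (HZ n)) : ∃ φ : IA n, johnsonHom φ = u := by
  let f : IA n →* Multiplicative (HZ n →ₗ[ℤ] ⋀[ℤ]^2 (HZ n)) :=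
    { toFun := fun φ => Multiplicative.ofAdd (johnsonHom φ)
      map_one' := by rw [johnsonHom_one]; rfl
      map_mul' := fun φ ψ => by rw [johnsonHom_mul]; rfl }
  let R : Submodule ℤ (HZ n →ₗ[ℤ] ⋀[ℤ]^2 (HZ n)) :=
    { carrier := {u | ∃ φ : IA n, johnsonHom φ = u}
      zero_mem' := ⟨1, johnsonHom_one⟩
      add_mem' := by
        rintro _ _ ⟨φ, rfl⟩ ⟨ψ, rfl⟩
        exact ⟨φ * ψ, johnsonHom_mul φ ψ⟩
      smul_mem' := by
        rintro m _ ⟨φ, rfl⟩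
        refine ⟨φ ^ m, ?_⟩
        have h := map_zpow f φ m
        exact h }
  let sing : Fin n → ⋀[ℤ]^2 (HZ n) →ₗ[ℤ] (HZ n →ₗ[ℤ] ⋀[ℤ]^2 (HZ n)) := fun i =>
    LinearMap.smulRightₗ ((basisHZ n).coord i)
  have hsing : ∀ i w l, sing i w (basisHZ n l) = if l = i then w else 0 := by
    intro i w l
    by_cases h : l = i
    · subst h; simp [sing]
    · simp [sing, h]
  have hgen : ∀ i j k, sing i (wedge n (basisHZ n j) (basisHZ n k)) ∈ R := by
    intro i j k
    by_cases hj : j = i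
    · by_cases hk : k = i
      · rw [hj, hk, wedge_self, map_zero]
        exact R.zero_mem
      · rw [hj, wedge_swap, map_neg]
        refine R.neg_mem ⟨magnusConj hk, (basisHZ n).ext fun l => ?_⟩
        rw [johnsonHom_magnusConj, hsing]
    · by_cases hk : k = i
      · rw [hk]
        refine ⟨magnusConj hj, (basisHZ n).ext fun l => ?_⟩
        rw [johnsonHom_magnusConj, hsing]
      · refine ⟨magnusComm hj hk, (basisHZ n).ext fun l => ?_⟩
        rw [johnsonHom_magnusComm, hsing]
  have hwedge : ∀ i Y Z, sing i (wedge n Y Z) ∈ R := by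
    intro i Y Z
    rw [← (basisHZ n).sum_repr Y, ← (basisHZ n).sum_repr Z]
    simp only [map_sum, map_smul, LinearMap.sum_apply, LinearMap.smul_apply]
    exact R.sum_mem fun j _ => R.smul_mem _ (R.sum_mem fun k _ => R.smul_mem _ (hgen i _ _))
  have hall : ∀ i w, sing i w ∈ R := by
    intro i w
    have h1 : (⊤ : Submodule ℤ (⋀[ℤ]^2 (HZ n))) ≤ R.comap (sing i) := by
      rw [← exteriorPower.ιMulti_span, Submodule.span_le]
      rintro _ ⟨v, rfl⟩
      have h2 : exteriorPower.ιMulti ℤ 2 v = wedge n (v 0) (v 1) := by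
        rw [wedge_apply]
        congr 1
        ext l
        fin_cases l <;> rfl
      change sing i (exteriorPower.ιMulti ℤ 2 v) ∈ R
      rw [h2]
      exact hwedge i _ _
    exact h1 Submodule.mem_top
  have hu : u = ∑ i, sing i (u (basisHZ n i)) := by
    refine (basisHZ n).ext fun l => ?_
    simp [LinearMap.sum_apply, hsing]
  rw [hu]
  exact R.sum_mem fun i _ => hall i _

/-! ### The abelianization of `IO_n` -/

/-- The projection `IA_n → IO_n`. -/
def iaToIO (n : ℕ) : IA n →* IOn n :=
  ((QuotientGroup.mk' (Inn n)).comp (IA n).subtype).codRestrict (IOn n) fun φ => φ.2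

theorem iaToIO_coe (φ : IA n) : (iaToIO n φ : Out n) = QuotientGroup.mk φ.1 := rfl

theorem iaToIO_surjective (n : ℕ) : Function.Surjective (iaToIO n) := by
  rintro ⟨ψ, hψ⟩
  obtain ⟨φ, rfl⟩ := QuotientGroup.mk_surjective ψ
  exact ⟨⟨φ, hψ⟩, rfl⟩

theorem iaToIO_eq_one {φ : IA n} : iaToIO n φ = 1 ↔
    ∃ γ, φ = ⟨MulAut.conj γ, conj_mem_IA γ⟩ := by
  rw [← Subtype.coe_inj, iaToIO_coe, Subgroup.coe_one, QuotientGroup.eq_one_iff]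
  constructor
  · rintro ⟨γ, h⟩
    exact ⟨γ, Subtype.ext h.symm⟩
  · rintro ⟨γ, rfl⟩
    exact ⟨γ, rfl⟩

/-- The Johnson homomorphism with values in `H_ℤ^* ⊗ Λ² H_ℤ`. -/
def johnsonTensor (φ : IA n) : TensorTarget n :=
  (dualTensorHomEquiv ℤ (HZ n) (⋀[ℤ]^2 (HZ n))).symm (johnsonHom φ)

theorem dualTensorHom_johnsonTensor (φ : IA n) :
    dualTensorHom ℤ (HZ n) (⋀[ℤ]^2 (HZ n)) (johnsonTensor φ) = johnsonHom φ :=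
  (dualTensorHomEquiv ℤ (HZ n) (⋀[ℤ]^2 (HZ n))).apply_symm_apply (johnsonHom φ)

theorem johnsonTensor_conj (γ : FreeGroup (Fin n)) :
    johnsonTensor ⟨MulAut.conj γ, conj_mem_IA γ⟩ = iotaStar n (cls γ) := by
  rw [johnsonTensor, johnsonHom_conj]
  rfl

theorem johnsonTensor_conj_aut (g : MulAut (FreeGroup (Fin n))) (φ : IA n) :
    johnsonTensor (MulAut.conjNormal g φ) = tensorRep n (autToGL n g) (johnsonTensor φ) := by
  apply (dualTensorHomEquiv ℤ (HZ n) (⋀[ℤ]^2 (HZ n))).injective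
  ext1 Z
  change dualTensorHom ℤ (HZ n) (⋀[ℤ]^2 (HZ n)) _ Z = dualTensorHom ℤ (HZ n) (⋀[ℤ]^2 (HZ n)) _ Z
  rw [dualTensorHom_tensorRep, dualTensorHom_johnsonTensor, dualTensorHom_johnsonTensor,
    johnsonHom_conj_aut]

/-- The Johnson homomorphism on `IA_n` modulo `ι_*(H_ℤ)`. -/
def iaJohnson (n : ℕ) : IA n →* Multiplicative (TensorQuot n) where
  toFun φ := Multiplicative.ofAdd (Submodule.Quotient.mk (johnsonTensor φ))
  map_one' := by rw [johnsonTensor, johnsonHom_one, map_zero]; rfl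
  map_mul' φ ψ := by rw [johnsonTensor, johnsonHom_mul, map_add]; rfl

/-- The Johnson homomorphism on `IO_n`. -/
def ioJohnson (n : ℕ) : IOn n →* Multiplicative (TensorQuot n) :=
  (iaToIO n).liftOfSurjective (iaToIO_surjective n) ⟨iaJohnson n, fun φ hφ => by
    obtain ⟨γ, rfl⟩ := iaToIO_eq_one.1 hφ
    change Submodule.Quotient.mk (johnsonTensor _) = (0 : TensorQuot n)
    rw [johnsonTensor_conj, Submodule.Quotient.mk_eq_zero]
    exact ⟨_, rfl⟩⟩

theorem ioJohnson_iaToIO (φ : IA n) : ioJohnson n (iaToIO n φ) = iaJohnson n φ :=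
  MonoidHom.liftOfRightInverse_comp_apply _ _ _ _ _

/-- The homomorphism induced on `IO_n^abel` by the Johnson homomorphism. -/
def ioAbelJohnson (n : ℕ) : IOAbel n →ₗ[ℤ] TensorQuot n :=
  (MonoidHom.toAdditiveLeft (Abelianization.lift (ioJohnson n))).toIntLinearMap

theorem ioAbelJohnson_ioCls (φ : IA n) : ioAbelJohnson n (ioCls (iaToIO n φ)) =
    Submodule.Quotient.mk (johnsonTensor φ) :=
  congrArg Multiplicative.toAdd (ioJohnson_iaToIO φ)

theorem ioAbel_induction {p : IOAbel n → Prop} (h : ∀ φ, p (ioCls (iaToIO n φ))) (x : IOAbel n) :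
    p x := by
  refine IOAbel_induction (fun ψ => ?_) x
  obtain ⟨φ, rfl⟩ := iaToIO_surjective n ψ
  exact h φ

/-- The left inverse `johnsonInv` shows that the kernel of the Johnson homomorphism is contained in
`[IA_n, IA_n]`, which maps into `[IO_n, IO_n]`. -/
theorem ioCls_iaToIO_eq_zero {φ : IA n} (h : johnsonHom φ = 0) : ioCls (iaToIO n φ) = 0 := by
  have h1 := johnsonInv_johnsonHom φ
  rw [h, map_zero] at h1
  have h2 : φ ∈ commutator (IA n) := by
    rw [← Abelianization.ker_of]
    exact h1.symm
  have h3 : commutator (IA n) ≤ (commutator (IOn n)).comap (iaToIO n) := by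
    rw [← Subgroup.map_le_iff_le_comap, commutator_def, commutator_def, Subgroup.map_commutator]
    exact Subgroup.commutator_mono le_top le_top
  have h4 : iaToIO n φ ∈ commutator (IOn n) := h3 h2
  rw [← Abelianization.ker_of] at h4
  exact h4

theorem ioAbelJohnson_bijective (n : ℕ) : Function.Bijective (ioAbelJohnson n) := by
  constructor
  · rw [← LinearMap.ker_eq_bot, LinearMap.ker_eq_bot']
    intro x
    refine ioAbel_induction (p := fun x => ioAbelJohnson n x = 0 → x = 0) (fun φ hφ => ?_) x
    rw [ioAbelJohnson_ioCls, Submodule.Quotient.mk_eq_zero] at hφ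
    obtain ⟨Y, hY⟩ := hφ
    obtain ⟨γ, rfl⟩ : ∃ γ, cls γ = Y :=
      HZ_induction (p := fun Y => ∃ γ, cls γ = Y) (fun γ => ⟨γ, rfl⟩) Y
    rw [← johnsonTensor_conj] at hY
    have h1 : johnsonHom ⟨MulAut.conj γ, conj_mem_IA γ⟩ = johnsonHom φ :=
      (dualTensorHomEquiv ℤ (HZ n) (⋀[ℤ]^2 (HZ n))).symm.injective hY
    -- Dividing `φ` by the inner automorphism with the same Johnson image does not change its class
    -- in `IO_n`, and brings that image to zero.
    have h2 := ioCls_iaToIO_eq_zero (φ := φ * (⟨MulAut.conj γ, conj_mem_IA γ⟩ : IA n)⁻¹)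
      (by rw [johnsonHom_mul, johnsonHom_inv, h1, add_neg_cancel])
    have h3 : iaToIO n ⟨MulAut.conj γ, conj_mem_IA γ⟩ = 1 := iaToIO_eq_one.2 ⟨γ, rfl⟩
    rwa [map_mul, map_inv, h3, inv_one, mul_one] at h2
  · intro t
    obtain ⟨t, rfl⟩ := Submodule.Quotient.mk_surjective _ t
    obtain ⟨φ, hφ⟩ := johnsonHom_surjective (dualTensorHomEquiv ℤ (HZ n) (⋀[ℤ]^2 (HZ n)) t)
    refine ⟨ioCls (iaToIO n φ), ?_⟩
    rw [ioAbelJohnson_ioCls, johnsonTensor, hφ, LinearEquiv.symm_apply_apply]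

theorem ioAbelJohnson_equivariant (A : GLHZ n) (x : IOAbel n) :
    ioAbelJohnson n (glRepIO n A x) = quotRep n A (ioAbelJohnson n x) := by
  obtain ⟨g, rfl⟩ := autToGL_surjective n A
  refine ioAbel_induction (p := fun x => ioAbelJohnson n (glRepIO n (autToGL n g) x) =
    quotRep n (autToGL n g) (ioAbelJohnson n x)) (fun φ => ?_) x
  have h1 : MulAut.conjNormal (QuotientGroup.mk g : Out n) (iaToIO n φ) =
      iaToIO n (MulAut.conjNormal g φ) := by
    ext1
    rw [MulAut.conjNormal_apply, iaToIO_coe, iaToIO_coe, MulAut.conjNormal_apply]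
    rfl
  rw [← outToGL_mk, glRepIO_apply, h1, ioAbelJohnson_ioCls, ioAbelJohnson_ioCls,
    johnsonTensor_conj_aut]
  rfl

/-! ### The rank -/

theorem iotaStar_hasLeftInverse (hn : 2 ≤ n) :
    ∃ r : TensorTarget n →ₗ[ℤ] HZ n, r ∘ₗ iotaStar n = LinearMap.id := by
  have : Nontrivial (Fin n) := Fin.nontrivial_iff_two_le.2 hn
  -- The coordinate `Y_j` is recovered as the coefficient of `X_j ∧ X_{i j}` in `Y ∧ X_{i j}`, for
  -- any index `i j ≠ j`. Here `n ≥ 2` is needed.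
  choose i hi using fun j : Fin n => exists_ne j
  let d : Fin n → ⋀[ℤ]^2 (HZ n) →ₗ[ℤ] ℤ := fun j =>
    wedgeLift (((LinearMap.mul ℤ ℤ).comp ((basisHZ n).coord j)).compl₂ ((basisHZ n).coord (i j)))
  have hd : ∀ j Y, d j (wedge n Y (basisHZ n (i j))) = (basisHZ n).coord j Y := by
    intro j Y
    simp [d, wedgeLift_wedge, hi j]
  refine ⟨(∑ j, (LinearMap.toSpanSingleton ℤ (HZ n) (basisHZ n j)) ∘ₗ d j ∘ₗ
    LinearMap.applyₗ (basisHZ n (i j))) ∘ₗ dualTensorHom ℤ (HZ n) (⋀[ℤ]^2 (HZ n)), ?_⟩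
  refine LinearMap.ext fun Y => ?_
  change (∑ j, (LinearMap.toSpanSingleton ℤ (HZ n) (basisHZ n j)) ∘ₗ d j ∘ₗ
    LinearMap.applyₗ (basisHZ n (i j))) (dualTensorHom ℤ (HZ n) (⋀[ℤ]^2 (HZ n)) (iotaStar n Y)) = Y
  rw [LinearMap.sum_apply]
  simp only [LinearMap.comp_apply, LinearMap.applyₗ_apply_apply,
    dualTensorHom_iotaStar, hd, LinearMap.toSpanSingleton_apply]
  exact (basisHZ n).sum_repr Y

/-- A basis of `H_ℤ^* ⊗ Λ² H_ℤ`. -/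
def basisTensorTarget (n : ℕ) :
    Module.Basis (Fin n × Set.powersetCard (Fin n) 2) ℤ (TensorTarget n) :=
  (basisHZ n).dualBasis.tensorProduct ((basisHZ n).exteriorPower 2)

instance (n : ℕ) : Module.Free ℤ (TensorTarget n) := Module.Free.of_basis (basisTensorTarget n)

instance (n : ℕ) : Module.Finite ℤ (TensorTarget n) :=
  Module.Finite.of_basis (basisTensorTarget n)

theorem finrank_tensorTarget (n : ℕ) :
    Module.finrank ℤ (TensorTarget n) = n * n.choose 2 := by
  rw [Module.finrank_eq_card_basis (basisTensorTarget n), Fintype.card_prod, Fintype.card_fin,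
    ← Nat.card_eq_fintype_card, Set.powersetCard.card, Nat.card_fin]

/-- The retraction `r` makes the image of `ι_*` a direct summand with complement `ker r`, so the
quotient is free and ranks subtract. -/
theorem tensorQuot_free_finrank (hn : 2 ≤ n) : Module.Free ℤ (TensorQuot n) ∧
    Module.finrank ℤ (TensorQuot n) = (n + 1) * n * (n - 2) / 2 := by
  obtain ⟨r, hr⟩ := iotaStar_hasLeftInverse hn
  have hr' : ∀ Y, r (iotaStar n Y) = Y := fun Y => congrArg (fun f => f Y) hr
  have hc : IsCompl (LinearMap.range (iotaStar n)) (LinearMap.ker r) := by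
    refine ⟨Submodule.disjoint_def.2 ?_, codisjoint_iff.2 (eq_top_iff.2 fun t _ => ?_)⟩
    · rintro _ ⟨Y, rfl⟩ h
      rw [LinearMap.mem_ker, hr'] at h
      rw [h, map_zero]
    · rw [← add_sub_cancel (iotaStar n (r t)) t]
      refine Submodule.add_mem_sup ⟨_, rfl⟩ ?_
      rw [LinearMap.mem_ker, map_sub, hr', sub_self]
  refine ⟨Module.Free.of_equiv (Submodule.quotientEquivOfIsCompl _ _ hc).symm, ?_⟩
  have h1 := Submodule.finrank_quotient_add_finrank (LinearMap.range (iotaStar n))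
  rw [LinearMap.finrank_range_of_inj (Function.LeftInverse.injective hr'),
    Module.finrank_eq_card_basis (basisHZ n), Fintype.card_fin, finrank_tensorTarget] at h1
  -- Writing `n = m + 2` removes the truncated subtraction, and doubling removes the divisions by
  -- two.
  obtain ⟨m, rfl⟩ := Nat.exists_eq_add_of_le' hn
  have h3 : (m + 2).choose 2 * 2 = (m + 2) * (m + 1) := by
    rw [Nat.choose_two_right]
    exact Nat.div_mul_cancel (Nat.even_mul_pred_self (m + 2)).two_dvd
  rw [Nat.add_sub_cancel]
  symm
  refine Nat.div_eq_of_eq_mul_left two_pos ?_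
  generalize Module.finrank ℤ (TensorQuot (m + 2)) = N at *
  generalize (m + 2).choose 2 = c at *
  have h4 : (N + (m + 2)) * 2 = (m + 2) * ((m + 2) * (m + 1)) := by
    rw [h1, mul_assoc, h3]
  nlinarith

end OutFree

end

theorem theorem6p2 (n : ℕ) (hn : 2 ≤ n) :
    (∃ e : OutFree.IOAbel n ≃ₗ[ℤ] OutFree.TensorQuot n,
      ∀ (A : OutFree.GLHZ n) (x : OutFree.IOAbel n),
        e (OutFree.glRepIO n A x) = OutFree.quotRep n A (e x)) ∧
    Module.Free ℤ (OutFree.IOAbel n) ∧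
    Module.Finite ℤ (OutFree.IOAbel n) ∧
    Module.finrank ℤ (OutFree.IOAbel n) = (n + 1) * n * (n - 2) / 2 := by
  let e := LinearEquiv.ofBijective (OutFree.ioAbelJohnson n) (OutFree.ioAbelJohnson_bijective n)
  obtain ⟨h1, h2⟩ := OutFree.tensorQuot_free_finrank hn
  exact ⟨⟨e, OutFree.ioAbelJohnson_equivariant⟩, Module.Free.of_equiv e.symm,
    Module.Finite.equiv e.symm, e.finrank_eq.trans h2⟩
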